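/- Let $\mathbb K$ be a field of characteristic $0$, let $A$ be an associative unital (not necessarily commutative) $\mathbb K$-algebra, $A^e=A\otimes A^{op}$, and let $\mathcal B$ be a (left) $A$-bialgebroid: a $\mathbb K$-algebra $\mathcal B$ with an algebra map $\eta_{\mathcal B}:A^e\to\mathcal B$, $s(a)=\eta_{\mathcal B}(a\otimes 1)$, $t(a)=\eta_{\mathcal B}(1\otimes a)$, and a coassociative counital $A$-coring structure $(\Delta,\varepsilon)$ on $\mathcal B$ with $A$-actions $a\cdot x\cdot b=s(a)t(b)x$, such that $\Delta$ takes values in Takeuchi's product $\mathcal B\times_A\mathcal B$ and is multiplicative and unital, $\varepsilon(1)=1$ and $\varepsilon(xs(\varepsilon(y)))=\varepsilon(xy)=\varepsilon(xt(\varepsilon(y)))$. An isomorphism of $A$-bialgebroids is an algebra isomorphism compatible with $s,t,\Delta,\varepsilon$. An $A$-anchored Lie algebra is a Lie algebra $L$ over $\mathbb K$ with a Lie algebra map $\omega:L\to \mathrm{Der}_{\mathbb K}(A)$. For such $(L,\omega)$, let $A\odot U(L)\odot A$ be the Connes–Moscovici bialgebroid: the space $A\otimes U(L)\otimes A$ with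 product $(a\otimes u\otimes b)(a'\otimes u'\otimes b')=\sum a(u_1\cdot a')\otimes u_2u'\otimes (u_3\cdot b')b$ (where $U(L)$ acts on $A$ through $\omega$), $s(a)=a\otimes1\otimes1$, $t(b)=1\otimes1\otimes b$, $\Delta(a\otimes u\otimes b)=\sum(a\otimes u_1\otimes 1)\otimes_A(1\otimes u_2\otimes b)$, $\varepsilon(a\otimes u\otimes b)=a\,\varepsilon_{U(L)}(u)\,b$. The space $\mathrm{Prim}(\mathcal B)=\{X\in\mathcal B : \Delta(X)=X\otimes_A1+1\otimes_AX\}$ is an $A$-anchored Lie algebra under the commutator, with anchor $\omega_{\mathcal B}(X)(a)=\varepsilon(Xs(a))$, and $\langle s-t\rangle=\{s(a)-t(a): a\in A\}$ is a Lie subalgebra of it. Let $F_n(\mathcal B)$ be the image in $\mathcal B$ of the part of degree $\le n$ of the tensor algebra over $A^e$ of the bimodule $A^e\otimes\mathrm{Prim}(\mathcal B)\otimes A^e$ under the algebra map induced by $\eta_{\mathcal B}$ and $p\otimes X\otimes q\mapsto\eta_{\mathcal B}(p)X\eta_{\mathcal B}(q)$, and set $F_{-1}(\mathcal B)=0$.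 Then $\mathcal B$ is primitively generated if $\mathcal B=\bigcup_nF_n(\mathcal B)$, and graded projective if every $F_n(\mathcal B)/F_{n-1}(\mathcal B)$, $n\ge0$, is a projective left $A^e$-module. For a subset $S\subseteq\mathrm{Prim}(\mathcal B)$ write $A^e\cdot S$ for the left $A^e$-submodule of $\mathcal B$ generated by $S$. For a Lie subalgebra $L\subseteq\mathrm{Prim}(\mathcal B)$ consider the conditions: * (CM1) there is an action $\delta$ of $L$ on $\langle s-t\rangle$ by derivations, compatible with the anchors ($[\omega_{\mathcal B}(X),\omega_{\mathcal B}(Y)]=\omega_{\mathcal B}(\delta(X)(Y))$), such that $(X,Y)\mapsto X+Y$ is an isomorphism of $A$-anchored Lie algebras $L\ltimes_\delta\langle s-t\rangle\cong\mathrm{Prim}(\mathcal B)$, where the semi-direct product has the anchor $(X,Y)\mapsto\omega_{\mathcal B}(X)+\omega_{\mathcal B}(Y)$; * (CM2) $\mathcal B$ is graded projective and primitively generated; * (CM3) either $A^e\cdot L=0$ and $\eta_{\mathcal B}$ is injective, or $A^e\cdot L\neq0$ is a free left $A^e$-module with a $\mathbb K$-basis of $L$ as a basis; * (CM4) $A^e\cdot\langle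 s-t\rangle\cap A^e\cdot L=0$. **Theorem.** 1. $\mathcal B\cong A\odot U(L)\odot A$ as $A$-bialgebroids for some $A$-anchored Lie algebra $(L,\omega)$ if and only if some Lie subalgebra $L\subseteq\mathrm{Prim}(\mathcal B)$ satisfies (CM1)–(CM4). 2. If $A\ne0$, then for every $A$-anchored Lie algebra $(L,\omega)$: $\mathcal B\cong A\odot U(L)\odot A$ as $A$-bialgebroids if and only if there is an injective Lie algebra map $j:L\to\mathrm{Prim}(\mathcal B)$ with $\omega_{\mathcal B}\circ j=\omega$ such that $j(L)$ satisfies (CM1)–(CM4). 3. If $L\subseteq\mathrm{Prim}(\mathcal B)$ satisfies (CM1)–(CM4), then $A^e\cdot\mathrm{Prim}(\mathcal B)=(A^e\cdot L)\oplus(A^e\cdot\langle s-t\rangle)$. -/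

import Mathlib

open scoped TensorProduct
open MulOpposite

attribute [local instance] LieRing.ofAssociativeRing

universe uK uA uB uC uL

namespace ConnesMoscovici

noncomputable section

/-- The enveloping algebra `Aᵉ = A ⊗ Aᵒᵖ` of a `K`-algebra `A`. -/
abbrev Env (K : Type uK) (A : Type uA) [Field K] [Ring A] [Algebra K A] : Type uA :=
  A ⊗[K] Aᵐᵒᵖ

instance instRingEnv {K : Type uK} {A : Type uA} [Field K] [Ring A] [Algebra K A] : Ring (Env K A) :=
  inferInstanceAs (Ring (A ⊗[K] Aᵐᵒᵖ))

section Tensor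

variable {K : Type uK} {A : Type uA} {B : Type uB} {C : Type uC}
  [Field K] [Ring A] [Algebra K A] [Ring B] [Algebra K B] [Ring C] [Algebra K C]

/-- The source `s : A → B`, `s a = η (a ⊗ 1)`. -/
def src (η : Env K A →ₐ[K] B) : A →ₐ[K] B :=
  η.comp Algebra.TensorProduct.includeLeft

/-- The target `t : Aᵒᵖ → B`, `t b = η (1 ⊗ b)`. -/
def tgt (η : Env K A →ₐ[K] B) : Aᵐᵒᵖ →ₐ[K] B :=
  η.comp Algebra.TensorProduct.includeRight

theorem src_mul_tgt (η : Env K A →ₐ[K] B) (a : A) (b : Aᵐᵒᵖ) :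
    src η a * tgt η b = tgt η b * src η a := by
  simp [src, tgt, ← map_mul]

theorem eta_tmul (η : Env K A →ₐ[K] B) (a : A) (b : Aᵐᵒᵖ) :
    η (a ⊗ₜ b) = src η a * tgt η b := by
  simp [src, tgt, ← map_mul]

/-- The relations `t(a) x ⊗ y - x ⊗ s(a) y` defining `B ⊗_A B`. -/
def tensRel (η : Env K A →ₐ[K] B) : Submodule K (B ⊗[K] B) :=
  Submodule.span K {z | ∃ (a : A) (x y : B),
    z = (tgt η (op a) * x) ⊗ₜ[K] y - x ⊗ₜ[K] (src η a * y)}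

/-- `B ⊗_A B`, where `B` is the `A`-bimodule `a · x · b = s(a) t(b) x`. -/
abbrev Tens (η : Env K A →ₐ[K] B) : Type uB := (B ⊗[K] B) ⧸ tensRel η

/-- The `K`-bilinear map `(x, y) ↦ x ⊗_A y`. -/
def tens (η : Env K A →ₐ[K] B) : B →ₗ[K] B →ₗ[K] Tens η :=
  (TensorProduct.mk K B B).compr₂ (tensRel η).mkQ

theorem tens_balanced (η : Env K A →ₐ[K] B) (a : A) (x y : B) :
    tens η (tgt η (op a) * x) y = tens η x (src η a * y) := by
  refine (Submodule.Quotient.eq _).2 (Submodule.subset_span ⟨a, x, y, rfl⟩)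

/-- The linear map out of `B ⊗_A B` induced by an `A`-balanced `K`-bilinear map. -/
def tensLift (η : Env K A →ₐ[K] B) {M : Type*} [AddCommGroup M] [Module K M]
    (f : B →ₗ[K] B →ₗ[K] M)
    (hf : ∀ (a : A) (x y : B), f (tgt η (op a) * x) y = f x (src η a * y)) :
    Tens η →ₗ[K] M :=
  (tensRel η).liftQ (TensorProduct.lift f) (by
    rw [tensRel, Submodule.span_le]
    rintro _ ⟨a, x, y, rfl⟩
    simp [hf])

@[simp] theorem tensLift_tens (η : Env K A →ₐ[K] B) {M : Type*} [AddCommGroup M] [Module K M]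
    (f : B →ₗ[K] B →ₗ[K] M)
    (hf : ∀ (a : A) (x y : B), f (tgt η (op a) * x) y = f x (src η a * y)) (x y : B) :
    tensLift η f hf (tens η x y) = f x y := by
  simp [tensLift, tens]

theorem tens_hom_ext (η : Env K A →ₐ[K] B) {M : Type*} [AddCommGroup M] [Module K M]
    {f g : Tens η →ₗ[K] M} (h : ∀ x y, f (tens η x y) = g (tens η x y)) : f = g := by
  apply Submodule.linearMap_qext
  apply TensorProduct.ext'
  exact h

/-- The left action `a · (x ⊗_A y) = s(a) x ⊗_A y`. -/
def tensActL (η : Env K A →ₐ[K] B) (a : A) : Tens η →ₗ[K] Tens η :=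
  tensLift η ((tens η).comp (LinearMap.mulLeft K (src η a))) (by
    intro b x y
    simp [← tens_balanced, ← mul_assoc, src_mul_tgt])

/-- The right action `(x ⊗_A y) · a = x ⊗_A t(a) y`. -/
def tensActR (η : Env K A →ₐ[K] B) (a : A) : Tens η →ₗ[K] Tens η :=
  tensLift η ((tens η).compl₂ (LinearMap.mulLeft K (tgt η (op a)))) (by
    intro b x y
    simp [tens_balanced, ← mul_assoc, src_mul_tgt])

/-- Factorwise right multiplication `x ⊗_A y ↦ x u ⊗_A y v`. -/
def tensMulR (η : Env K A →ₐ[K] B) (u v : B) : Tens η →ₗ[K] Tens η :=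
  tensLift η ((tens η).compl₁₂ (LinearMap.mulRight K u) (LinearMap.mulRight K v)) (by
    intro b x y
    simp [tens_balanced, mul_assoc])

@[simp] theorem tensActL_tens (η : Env K A →ₐ[K] B) (a : A) (x y : B) :
    tensActL η a (tens η x y) = tens η (src η a * x) y := by simp [tensActL]

@[simp] theorem tensActR_tens (η : Env K A →ₐ[K] B) (a : A) (x y : B) :
    tensActR η a (tens η x y) = tens η x (tgt η (op a) * y) := by simp [tensActR]

@[simp] theorem tensMulR_tens (η : Env K A →ₐ[K] B) (u v x y : B) :
    tensMulR η u v (tens η x y) = tens η (x * u) (y * v) := by simp [tensMulR]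

/-- Takeuchi's product `B ×_A B`: the `∑ xᵢ ⊗_A yᵢ` such that, for all `a`,
`∑ xᵢ t(a) ⊗_A yᵢ = ∑ xᵢ ⊗_A yᵢ s(a)`. -/
def takeuchi (η : Env K A →ₐ[K] B) : Submodule K (Tens η) :=
  ⨅ a : A, LinearMap.eqLocus (tensMulR η (tgt η (op a)) 1) (tensMulR η 1 (src η a))

theorem mem_takeuchi (η : Env K A →ₐ[K] B) {w : Tens η} :
    w ∈ takeuchi η ↔ ∀ a : A, tensMulR η (tgt η (op a)) 1 w = tensMulR η 1 (src η a) w := by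
  simp [takeuchi]

theorem tensMulR_tensMulR (η : Env K A →ₐ[K] B) (u v u' v' : B) (w : Tens η) :
    tensMulR η u v (tensMulR η u' v' w) = tensMulR η (u' * u) (v' * v) w := by
  have : (tensMulR η u v).comp (tensMulR η u' v') = tensMulR η (u' * u) (v' * v) :=
    tens_hom_ext η (by intro x y; simp [mul_assoc])
  exact LinearMap.congr_fun this w

/-- `(u, v) ↦ (w ↦ w (u ⊗ v))` as a bilinear map. -/
def tensMulRHom (η : Env K A →ₐ[K] B) : B →ₗ[K] B →ₗ[K] Tens η →ₗ[K] Tens η :=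
  LinearMap.mk₂ K (tensMulR η)
    (fun u u' v => tens_hom_ext η (by intro x y; simp [mul_add]))
    (fun c u v => tens_hom_ext η (by intro x y; simp))
    (fun u v v' => tens_hom_ext η (by intro x y; simp [mul_add]))
    (fun c u v => tens_hom_ext η (by intro x y; simp))

/-- The componentwise product `(∑ xᵢ ⊗_A yᵢ) (∑ uⱼ ⊗_A vⱼ) = ∑ xᵢ uⱼ ⊗_A yᵢ vⱼ`, which is
well defined when the left factor lies in `B ×_A B`. -/
def takMul (η : Env K A →ₐ[K] B) (w : takeuchi η) : Tens η →ₗ[K] Tens η :=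
  tensLift η ((tensMulRHom η).compr₂ (LinearMap.applyₗ (w : Tens η))) (by
    intro a u v
    have h := (mem_takeuchi η).1 w.2 a
    have h1 : tensMulR η (tgt η (op a) * u) v (w : Tens η)
        = tensMulR η u v (tensMulR η (tgt η (op a)) 1 w) := by
      rw [tensMulR_tensMulR, one_mul]
    have h2 : tensMulR η u (src η a * v) (w : Tens η)
        = tensMulR η u v (tensMulR η 1 (src η a) w) := by
      rw [tensMulR_tensMulR, one_mul]
    simpa [tensMulRHom, h1, h2] using congrArg (tensMulR η u v) h)

@[simp] theorem takMul_tens (η : Env K A →ₐ[K] B) (w : takeuchi η) (u v : B) :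
    takMul η w (tens η u v) = tensMulR η u v w := by
  simp [takMul, tensMulRHom]

theorem tensMulR_takMul (η : Env K A →ₐ[K] B) (w : takeuchi η) (u v : B) (z : Tens η) :
    tensMulR η u v (takMul η w z) = takMul η w (tensMulR η u v z) := by
  have : (tensMulR η u v).comp (takMul η w) = (takMul η w).comp (tensMulR η u v) :=
    tens_hom_ext η (by intro x y; simp [tensMulR_tensMulR])
  exact LinearMap.congr_fun this z

theorem takMul_mem (η : Env K A →ₐ[K] B) (w : takeuchi η) {z : Tens η} (hz : z ∈ takeuchi η) :
    takMul η w z ∈ takeuchi η := by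
  rw [mem_takeuchi] at hz ⊢
  intro a
  rw [tensMulR_takMul, tensMulR_takMul, hz]

theorem takMul_assoc (η : Env K A →ₐ[K] B) (w w' : takeuchi η) (z : Tens η) :
    takMul η ⟨takMul η w w', takMul_mem η w w'.2⟩ z = takMul η w (takMul η w' z) := by
  have : takMul η ⟨takMul η w w', takMul_mem η w w'.2⟩ = (takMul η w).comp (takMul η w') :=
    tens_hom_ext η (by intro x y; simp [tensMulR_takMul])
  exact LinearMap.congr_fun this z

theorem takMul_add (η : Env K A →ₐ[K] B) (w w' : takeuchi η) (z : Tens η) :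
    takMul η (w + w') z = takMul η w z + takMul η w' z := by
  have : takMul η (w + w') = takMul η w + takMul η w' :=
    tens_hom_ext η (by intro x y; simp)
  exact LinearMap.congr_fun this z

theorem tens_src_mem (η : Env K A →ₐ[K] B) (a : A) : tens η (src η a) 1 ∈ takeuchi η := by
  rw [mem_takeuchi]
  intro b
  simp [src_mul_tgt, tens_balanced]

theorem tens_tgt_mem (η : Env K A →ₐ[K] B) (a : A) : tens η 1 (tgt η (op a)) ∈ takeuchi η := by
  rw [mem_takeuchi]
  intro b
  have := tens_balanced η b 1 (tgt η (op a))
  rw [mul_one] at this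
  simp [this, src_mul_tgt]

theorem takMul_src (η : Env K A →ₐ[K] B) (a : A) (z : Tens η) :
    takMul η ⟨_, tens_src_mem η a⟩ z = tensActL η a z := by
  have : takMul η ⟨_, tens_src_mem η a⟩ = tensActL η a :=
    tens_hom_ext η (by intro x y; simp)
  exact LinearMap.congr_fun this z

theorem takMul_tgt (η : Env K A →ₐ[K] B) (a : A) (z : Tens η) :
    takMul η ⟨_, tens_tgt_mem η a⟩ z = tensActR η a z := by
  have : takMul η ⟨_, tens_tgt_mem η a⟩ = tensActR η a :=
    tens_hom_ext η (by intro x y; simp)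
  exact LinearMap.congr_fun this z

/-- The relations defining `B ⊗_A B ⊗_A B`. -/
def tens₃Rel (η : Env K A →ₐ[K] B) : Submodule K (B ⊗[K] (B ⊗[K] B)) :=
  Submodule.span K
    ({z | ∃ (a : A) (x y w : B), z = (tgt η (op a) * x) ⊗ₜ[K] (y ⊗ₜ[K] w)
        - x ⊗ₜ[K] ((src η a * y) ⊗ₜ[K] w)} ∪
     {z | ∃ (a : A) (x y w : B), z = x ⊗ₜ[K] ((tgt η (op a) * y) ⊗ₜ[K] w)
        - x ⊗ₜ[K] (y ⊗ₜ[K] (src η a * w))})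

/-- `B ⊗_A B ⊗_A B`. -/
abbrev Tens₃ (η : Env K A →ₐ[K] B) : Type uB := (B ⊗[K] (B ⊗[K] B)) ⧸ tens₃Rel η

/-- The class `x ⊗_A y ⊗_A z`. -/
def tens₃ (η : Env K A →ₐ[K] B) (x y z : B) : Tens₃ η :=
  (tens₃Rel η).mkQ (x ⊗ₜ[K] (y ⊗ₜ[K] z))

theorem tens₃_balanced_left (η : Env K A →ₐ[K] B) (a : A) (x y z : B) :
    tens₃ η (tgt η (op a) * x) y z = tens₃ η x (src η a * y) z :=
  (Submodule.Quotient.eq _).2 (Submodule.subset_span (Or.inl ⟨a, x, y, z, rfl⟩))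

theorem tens₃_balanced_right (η : Env K A →ₐ[K] B) (a : A) (x y z : B) :
    tens₃ η x (tgt η (op a) * y) z = tens₃ η x y (src η a * z) :=
  (Submodule.Quotient.eq _).2 (Submodule.subset_span (Or.inr ⟨a, x, y, z, rfl⟩))

/-- `(x ⊗_A y, z) ↦ x ⊗_A y ⊗_A z`. -/
def tensAssocL (η : Env K A →ₐ[K] B) : Tens η →ₗ[K] B →ₗ[K] Tens₃ η :=
  tensLift η
    (LinearMap.mk₂ K
      (fun x y => (tens₃Rel η).mkQ.comp
        ((TensorProduct.mk K B (B ⊗[K] B) x).comp (TensorProduct.mk K B B y)))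
      (by intros; ext; simp)
      (by intros; ext; simp)
      (by intros; ext; simp [TensorProduct.tmul_add])
      (by intros; ext; simp))
    (by intro a x y; ext z; exact tens₃_balanced_left η a x y z)

/-- `(y ⊗_A z, x) ↦ x ⊗_A y ⊗_A z`. -/
def tensAssocR (η : Env K A →ₐ[K] B) : Tens η →ₗ[K] B →ₗ[K] Tens₃ η :=
  tensLift η
    (LinearMap.mk₂ K
      (fun y z => (tens₃Rel η).mkQ.comp ((TensorProduct.mk K B (B ⊗[K] B)).flip (y ⊗ₜ[K] z)))
      (by intros; ext; simp [TensorProduct.add_tmul])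
      (by intros; ext; simp [← TensorProduct.smul_tmul'])
      (by intros; ext; simp [TensorProduct.tmul_add])
      (by intros; ext; simp [TensorProduct.tmul_smul]))
    (by intro a y z; ext x; exact tens₃_balanced_right η a x y z)

@[simp] theorem tensAssocL_tens (η : Env K A →ₐ[K] B) (x y z : B) :
    tensAssocL η (tens η x y) z = tens₃ η x y z := by simp [tensAssocL, tens₃]

@[simp] theorem tensAssocR_tens (η : Env K A →ₐ[K] B) (x y z : B) :
    tensAssocR η (tens η y z) x = tens₃ η x y z := by simp [tensAssocR, tens₃]

/-- `Δ ⊗_A B : B ⊗_A B → B ⊗_A B ⊗_A B`, for a right `A`-linear `Δ`. -/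
def comulTens (η : Env K A →ₐ[K] B) (Δ : B →ₗ[K] Tens η)
    (hΔ : ∀ (a : A) (x : B), Δ (tgt η (op a) * x) = tensActR η a (Δ x)) :
    Tens η →ₗ[K] Tens₃ η :=
  tensLift η ((tensAssocL η).comp Δ) (by
    intro a x y
    have : ((tensAssocL η).flip y).comp (tensActR η a)
        = (tensAssocL η).flip (src η a * y) :=
      tens_hom_ext η (by intro u v; simp [tens₃_balanced_right])
    simpa [hΔ] using LinearMap.congr_fun this (Δ x))

/-- `B ⊗_A Δ : B ⊗_A B → B ⊗_A B ⊗_A B`, for a left `A`-linear `Δ`. -/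
def tensComul (η : Env K A →ₐ[K] B) (Δ : B →ₗ[K] Tens η)
    (hΔ : ∀ (a : A) (x : B), Δ (src η a * x) = tensActL η a (Δ x)) :
    Tens η →ₗ[K] Tens₃ η :=
  tensLift η ((tensAssocR η).comp Δ).flip (by
    intro a x y
    have : ((tensAssocR η).flip x).comp (tensActL η a)
        = (tensAssocR η).flip (tgt η (op a) * x) :=
      tens_hom_ext η (by intro u v; simp [tens₃_balanced_left])
    simpa [hΔ] using (LinearMap.congr_fun this (Δ y)).symm)

/-- `ε ⊗_A B : B ⊗_A B → A ⊗_A B = B`, that is `x ⊗_A y ↦ s(ε x) y`. -/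
def counitTens (η : Env K A →ₐ[K] B) (ε : B →ₗ[K] A)
    (hε : ∀ (a : A) (x : B), ε (tgt η (op a) * x) = ε x * a) : Tens η →ₗ[K] B :=
  tensLift η ((LinearMap.mul K B).comp ((src η).toLinearMap.comp ε)) (by
    intro a x y
    simp [hε, mul_assoc])

/-- `B ⊗_A ε : B ⊗_A B → B ⊗_A A = B`, that is `x ⊗_A y ↦ t(ε y) x`. -/
def tensCounit (η : Env K A →ₐ[K] B) (ε : B →ₗ[K] A)
    (hε : ∀ (a : A) (x : B), ε (src η a * x) = a * ε x) : Tens η →ₗ[K] B :=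
  tensLift η ((LinearMap.mul K B).comp
      ((tgt η).toLinearMap.comp ((opLinearEquiv K).toLinearMap.comp ε))).flip (by
    intro a x y
    simp [hε, mul_assoc])

@[simp] theorem counitTens_tens (η : Env K A →ₐ[K] B) (ε : B →ₗ[K] A)
    (hε : ∀ (a : A) (x : B), ε (tgt η (op a) * x) = ε x * a) (x y : B) :
    counitTens η ε hε (tens η x y) = src η (ε x) * y := by simp [counitTens]

@[simp] theorem tensCounit_tens (η : Env K A →ₐ[K] B) (ε : B →ₗ[K] A)
    (hε : ∀ (a : A) (x : B), ε (src η a * x) = a * ε x) (x y : B) :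
    tensCounit η ε hε (tens η x y) = tgt η (op (ε y)) * x := by simp [tensCounit]

/-- `φ ⊗_A φ : B ⊗_A B → C ⊗_A C` for an algebra map `φ` compatible with source and target. -/
def tensMap (η : Env K A →ₐ[K] B) (θ : Env K A →ₐ[K] C) (φ : B →ₐ[K] C)
    (hs : ∀ a : A, φ (src η a) = src θ a) (ht : ∀ a : A, φ (tgt η (op a)) = tgt θ (op a)) :
    Tens η →ₗ[K] Tens θ :=
  tensLift η ((tens θ).compl₁₂ φ.toLinearMap φ.toLinearMap) (by
    intro a x y
    simp [hs, ht, tens_balanced])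

@[simp] theorem tensMap_tens (η : Env K A →ₐ[K] B) (θ : Env K A →ₐ[K] C) (φ : B →ₐ[K] C)
    (hs : ∀ a : A, φ (src η a) = src θ a) (ht : ∀ a : A, φ (tgt η (op a)) = tgt θ (op a))
    (x y : B) : tensMap η θ φ hs ht (tens η x y) = tens θ (φ x) (φ y) := by simp [tensMap]

end Tensor

/-- A left `A`-bialgebroid structure on the `K`-algebra `B`. -/
structure LeftBialgebroid (K : Type uK) (A : Type uA) (B : Type uB)
    [Field K] [Ring A] [Algebra K A] [Ring B] [Algebra K B] where
  /-- the algebra map `η : Aᵉ → B`, giving the source `src η` and the target `tgt η` -/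
  η : Env K A →ₐ[K] B
  /-- the comultiplication `Δ : B → B ⊗_A B` -/
  comul : B →ₗ[K] Tens η
  /-- the counit `ε : B → A` -/
  counit : B →ₗ[K] A
  comul_src : ∀ (a : A) (x : B), comul (src η a * x) = tensActL η a (comul x)
  comul_tgt : ∀ (a : A) (x : B), comul (tgt η (op a) * x) = tensActR η a (comul x)
  counit_src : ∀ (a : A) (x : B), counit (src η a * x) = a * counit x
  counit_tgt : ∀ (a : A) (x : B), counit (tgt η (op a) * x) = counit x * a
  coassoc : ∀ x : B, comulTens η comul comul_tgt (comul x) = tensComul η comul comul_src (comul x)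
  counit_comul : ∀ x : B, counitTens η counit counit_tgt (comul x) = x
  comul_counit : ∀ x : B, tensCounit η counit counit_src (comul x) = x
  comul_mem : ∀ x : B, comul x ∈ takeuchi η
  comul_one : comul 1 = tens η 1 1
  comul_mul : ∀ x y : B, comul (x * y) = takMul η ⟨comul x, comul_mem x⟩ (comul y)
  counit_mul_src : ∀ x y : B, counit (x * src η (counit y)) = counit (x * y)
  counit_mul_tgt : ∀ x y : B, counit (x * tgt η (op (counit y))) = counit (x * y)
  counit_one : counit 1 = 1


section Anchored

variable (K : Type uK) (A : Type uA) [Field K] [Ring A] [Algebra K A]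

/-- The Lie algebra `Der_K(A)` of `K`-linear derivations of the (noncommutative) algebra `A`. -/
def Der : LieSubalgebra K (Module.End K A) where
  carrier := {D | ∀ a b : A, D (a * b) = D a * b + a * D b}
  add_mem' := by
    intro D E hD hE a b
    simp only [Set.mem_ofPred_eq] at hD hE
    simp only [LinearMap.add_apply, hD, hE]
    noncomm_ring
  zero_mem' := by intro a b; simp
  smul_mem' := by
    intro c D hD a b
    simp only [Set.mem_ofPred_eq] at hD
    simp [hD]
  lie_mem' := by
    intro D E hD hE a b
    simp only [Set.mem_ofPred_eq] at hD hE
    simp only [LieRing.of_associative_ring_bracket, LinearMap.sub_apply, Module.End.mul_apply, hD,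
      hE, map_add]
    noncomm_ring

variable {K A}

theorem Der.leibniz (D : Der K A) (a b : A) :
    (D : Module.End K A) (a * b) = (D : Module.End K A) a * b + a * (D : Module.End K A) b :=
  D.2 a b

theorem Der.map_one (D : Der K A) : (D : Module.End K A) 1 = 0 := by
  simpa using Der.leibniz D 1 1

end Anchored

section Enveloping

open UniversalEnvelopingAlgebra (ι)

variable (K : Type uK) {A : Type uA} (L : Type uL) [Field K] [Ring A] [Algebra K A]
  [LieRing L] [LieAlgebra K L]

/-- The comultiplication of `U(L)`: the algebra map with `X ↦ X ⊗ 1 + 1 ⊗ X`. -/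
def comulU : UniversalEnvelopingAlgebra K L →ₐ[K]
    UniversalEnvelopingAlgebra K L ⊗[K] UniversalEnvelopingAlgebra K L :=
  UniversalEnvelopingAlgebra.lift K
    { toFun := fun X => ι K X ⊗ₜ[K] 1 + 1 ⊗ₜ[K] ι K X
      map_add' := by
        intro X Y
        simp only [map_add, TensorProduct.add_tmul, TensorProduct.tmul_add]
        abel
      map_smul' := by
        intro c X
        simp [TensorProduct.smul_tmul', TensorProduct.tmul_smul]
      map_lie' := by
        intro X Y
        simp only [LieHom.map_lie, LieRing.of_associative_ring_bracket, mul_add, add_mul,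
          Algebra.TensorProduct.tmul_mul_tmul, mul_one, one_mul, TensorProduct.sub_tmul,
          TensorProduct.tmul_sub]
        abel }

/-- The counit of `U(L)`: the algebra map with `X ↦ 0`. -/
def counitU : UniversalEnvelopingAlgebra K L →ₐ[K] K :=
  UniversalEnvelopingAlgebra.lift K 0

/-- The iterated comultiplication `u ↦ ∑ u₁ ⊗ u₂ ⊗ u₃` of `U(L)`. -/
def comulU₂ : UniversalEnvelopingAlgebra K L →ₐ[K] UniversalEnvelopingAlgebra K L ⊗[K]
    (UniversalEnvelopingAlgebra K L ⊗[K] UniversalEnvelopingAlgebra K L) :=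
  (Algebra.TensorProduct.map (AlgHom.id K _) (comulU K L)).comp (comulU K L)

variable {L}

@[simp] theorem comulU_ι (X : L) : comulU K L (ι K X) = ι K X ⊗ₜ[K] 1 + 1 ⊗ₜ[K] ι K X :=
  UniversalEnvelopingAlgebra.lift_ι_apply K _ X

@[simp] theorem counitU_ι (X : L) : counitU K L (ι K X) = 0 :=
  UniversalEnvelopingAlgebra.lift_ι_apply K _ X

@[simp] theorem comulU₂_ι (X : L) : comulU₂ K L (ι K X) =
    ι K X ⊗ₜ[K] (1 ⊗ₜ[K] 1) + 1 ⊗ₜ[K] (ι K X ⊗ₜ[K] 1) + 1 ⊗ₜ[K] (1 ⊗ₜ[K] ι K X) := by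
  rw [comulU₂, AlgHom.comp_apply, comulU_ι, map_add, Algebra.TensorProduct.map_tmul,
    Algebra.TensorProduct.map_tmul, map_one, comulU_ι, AlgHom.id_apply, map_one,
    TensorProduct.tmul_add, Algebra.TensorProduct.one_def, add_assoc]

theorem U_induction {p : UniversalEnvelopingAlgebra K L → Prop}
    (halg : ∀ c : K, p (algebraMap K _ c)) (hι : ∀ X : L, p (ι K X))
    (hadd : ∀ u v, p u → p v → p (u + v)) (hmul : ∀ u v, p u → p v → p (u * v))
    (u : UniversalEnvelopingAlgebra K L) : p u := by
  let S : Subalgebra K (UniversalEnvelopingAlgebra K L) :=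
    { carrier := {u | p u}
      mul_mem' := fun {a b} ha hb => hmul a b ha hb
      add_mem' := fun {a b} ha hb => hadd a b ha hb
      algebraMap_mem' := halg }
  let f : L →ₗ⁅K⁆ S :=
    { toFun := fun X => ⟨ι K X, hι X⟩
      map_add' := fun X Y => Subtype.ext (by simp only [map_add]; rfl)
      map_smul' := fun c X => Subtype.ext (by simp only [map_smul]; rfl)
      map_lie' := fun {X Y} => Subtype.ext (by
        simp only [LieHom.map_lie, LieRing.of_associative_ring_bracket]; rfl) }
  have h : S.val.comp (UniversalEnvelopingAlgebra.lift K f) = AlgHom.id K _ := by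
    apply UniversalEnvelopingAlgebra.hom_ext
    ext X
    have := UniversalEnvelopingAlgebra.lift_ι_apply K f X
    exact congrArg Subtype.val this
  have := AlgHom.congr_fun h u
  have h2 : ((UniversalEnvelopingAlgebra.lift K f u : S) : UniversalEnvelopingAlgebra K L) = u :=
    this
  rw [← h2]
  exact (UniversalEnvelopingAlgebra.lift K f u).2

theorem coassocU : ((Algebra.TensorProduct.assoc K K K (UniversalEnvelopingAlgebra K L)
      (UniversalEnvelopingAlgebra K L) (UniversalEnvelopingAlgebra K L)).toAlgHom.comp
      (Algebra.TensorProduct.map (comulU K L) (AlgHom.id K _))).comp (comulU K L) =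
    (Algebra.TensorProduct.map (AlgHom.id K _) (comulU K L)).comp (comulU K L) := by
  apply UniversalEnvelopingAlgebra.hom_ext
  ext X
  change (Algebra.TensorProduct.assoc K K K (UniversalEnvelopingAlgebra K L)
      (UniversalEnvelopingAlgebra K L) (UniversalEnvelopingAlgebra K L))
      ((Algebra.TensorProduct.map (comulU K L) (AlgHom.id K _)) (comulU K L (ι K X))) =
    (Algebra.TensorProduct.map (AlgHom.id K _) (comulU K L)) (comulU K L (ι K X))
  rw [comulU_ι, map_add, map_add, map_add, Algebra.TensorProduct.map_tmul,
    Algebra.TensorProduct.map_tmul, Algebra.TensorProduct.map_tmul,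
    Algebra.TensorProduct.map_tmul, comulU_ι]
  simp only [AlgHom.id_apply, map_one, Algebra.TensorProduct.one_def, TensorProduct.add_tmul, map_add,
    TensorProduct.tmul_add, Algebra.TensorProduct.assoc_tmul, add_assoc]

theorem counitU_comulU : ((Algebra.TensorProduct.lid K (UniversalEnvelopingAlgebra K L)).toAlgHom.comp
      (Algebra.TensorProduct.map (counitU K L) (AlgHom.id K _))).comp (comulU K L) =
    AlgHom.id K _ := by
  apply UniversalEnvelopingAlgebra.hom_ext
  ext X
  change (Algebra.TensorProduct.lid K (UniversalEnvelopingAlgebra K L))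
      ((Algebra.TensorProduct.map (counitU K L) (AlgHom.id K _)) (comulU K L (ι K X))) = ι K X
  rw [comulU_ι, map_add, map_add, Algebra.TensorProduct.map_tmul, Algebra.TensorProduct.map_tmul,
    counitU_ι, map_one]
  simp only [AlgHom.id_apply, map_one, TensorProduct.zero_tmul, map_zero,
    Algebra.TensorProduct.lid_tmul, one_smul, zero_add]

theorem comulU_counitU : ((Algebra.TensorProduct.rid K K (UniversalEnvelopingAlgebra K L)).toAlgHom.comp
      (Algebra.TensorProduct.map (AlgHom.id K _) (counitU K L))).comp (comulU K L) =
    AlgHom.id K _ := by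
  apply UniversalEnvelopingAlgebra.hom_ext
  ext X
  change (Algebra.TensorProduct.rid K K (UniversalEnvelopingAlgebra K L))
      ((Algebra.TensorProduct.map (AlgHom.id K _) (counitU K L)) (comulU K L (ι K X))) = ι K X
  rw [comulU_ι, map_add, map_add, Algebra.TensorProduct.map_tmul, Algebra.TensorProduct.map_tmul,
    counitU_ι, map_one]
  simp only [AlgHom.id_apply, map_one, TensorProduct.tmul_zero, map_zero,
    Algebra.TensorProduct.rid_tmul, one_smul, add_zero]

variable {K}

/-- The action `u · a = Ω(u)(a)` of `U(L)` on `A` extending the anchor `ω`. -/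
def actU (ω : L →ₗ⁅K⁆ Der K A) : UniversalEnvelopingAlgebra K L →ₐ[K] Module.End K A :=
  UniversalEnvelopingAlgebra.lift K ((Der K A).incl.comp ω)

@[simp] theorem actU_ι (ω : L →ₗ⁅K⁆ Der K A) (X : L) :
    actU ω (ι K X) = (ω X : Module.End K A) :=
  UniversalEnvelopingAlgebra.lift_ι_apply K _ X

/-- The underlying space `A ⊗ U(L) ⊗ A` of `A ⊙ U(L) ⊙ A`, for the anchor `ω`. -/
def CM (_ω : L →ₗ⁅K⁆ Der K A) : Type (max uA uK uL) :=
  A ⊗[K] (UniversalEnvelopingAlgebra K L ⊗[K] A)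

namespace CM

variable (ω : L →ₗ⁅K⁆ Der K A)

instance : AddCommGroup (CM ω) :=
  inferInstanceAs (AddCommGroup (A ⊗[K] (UniversalEnvelopingAlgebra K L ⊗[K] A)))

instance : Module K (CM ω) :=
  inferInstanceAs (Module K (A ⊗[K] (UniversalEnvelopingAlgebra K L ⊗[K] A)))

/-- The pure tensor `a ⊗ u ⊗ b`. -/
def pure (a : A) (u : UniversalEnvelopingAlgebra K L) (b : A) : CM ω :=
  a ⊗ₜ[K] (u ⊗ₜ[K] b)

variable {M : Type*} [AddCommGroup M] [Module K M]

/-- The linear map out of `A ⊗ U(L) ⊗ A` induced by a trilinear map. -/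
def lift₃ (f : A →ₗ[K] UniversalEnvelopingAlgebra K L →ₗ[K] A →ₗ[K] M) : CM ω →ₗ[K] M :=
  TensorProduct.lift
    ((TensorProduct.uncurry (RingHom.id K) (UniversalEnvelopingAlgebra K L) A M).comp f)

@[simp] theorem lift₃_pure (f : A →ₗ[K] UniversalEnvelopingAlgebra K L →ₗ[K] A →ₗ[K] M)
    (a : A) (u : UniversalEnvelopingAlgebra K L) (b : A) :
    lift₃ ω f (pure ω a u b) = f a u b := rfl

variable {ω}

theorem hom_ext {f g : CM ω →ₗ[K] M} (h : ∀ a u b, f (pure ω a u b) = g (pure ω a u b)) :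
    f = g := by
  apply TensorProduct.ext
  ext a : 1
  apply TensorProduct.ext
  ext u b
  exact h a u b

variable (ω)

/-- The trilinear map `(a, u, b) ↦ a ⊗ u ⊗ b`. -/
def pure₃ : A →ₗ[K] UniversalEnvelopingAlgebra K L →ₗ[K] A →ₗ[K] CM ω :=
  ((LinearMap.mk₂ K
    (fun a u => (TensorProduct.mk K A (UniversalEnvelopingAlgebra K L ⊗[K] A) a).comp
      (TensorProduct.mk K (UniversalEnvelopingAlgebra K L) A u))
    (by intros; ext; simp)
    (by intros; ext; simp)
    (by intros; ext; simp [TensorProduct.tmul_add])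
    (by intros; ext; simp)) :
    A →ₗ[K] UniversalEnvelopingAlgebra K L →ₗ[K] A →ₗ[K]
      (A ⊗[K] (UniversalEnvelopingAlgebra K L ⊗[K] A)))

theorem pure₃_apply (a : A) (u : UniversalEnvelopingAlgebra K L) (b : A) :
    pure₃ ω a u b = pure ω a u b := rfl

theorem pure_add_left (a a' : A) (u : UniversalEnvelopingAlgebra K L) (b : A) :
    pure ω (a + a') u b = pure ω a u b + pure ω a' u b := by simp [← pure₃_apply]

theorem pure_add_mid (a : A) (u u' : UniversalEnvelopingAlgebra K L) (b : A) :
    pure ω a (u + u') b = pure ω a u b + pure ω a u' b := by simp [← pure₃_apply]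

theorem pure_add_right (a : A) (u : UniversalEnvelopingAlgebra K L) (b b' : A) :
    pure ω a u (b + b') = pure ω a u b + pure ω a u b' := by simp [← pure₃_apply]

/-- The diagonal action `u · (a ⊗ v ⊗ b) = ∑ (u₁ · a) ⊗ u₂ v ⊗ (u₃ · b)` of `U(L)` on
`A ⊗ U(L) ⊗ A`. -/
def diagAux : UniversalEnvelopingAlgebra K L →ₐ[K]
    Module.End K (A ⊗[K] (UniversalEnvelopingAlgebra K L ⊗[K] A)) :=
  (Module.endTensorEndAlgHom (R := K) (S := K) (A := K) (M := A)
      (N := UniversalEnvelopingAlgebra K L ⊗[K] A)).comp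
    ((Algebra.TensorProduct.map (actU ω)
      ((Module.endTensorEndAlgHom (R := K) (S := K) (A := K)
        (M := UniversalEnvelopingAlgebra K L) (N := A)).comp
        (Algebra.TensorProduct.map (Algebra.lmul K (UniversalEnvelopingAlgebra K L))
          (actU ω)))).comp (comulU₂ K L))

theorem diagAux_ι (X : L) (a : A) (u : UniversalEnvelopingAlgebra K L) (b : A) :
    diagAux ω (ι K X) (a ⊗ₜ (u ⊗ₜ b)) = ((ω X : Module.End K A) a) ⊗ₜ (u ⊗ₜ b)
      + a ⊗ₜ ((ι K X * u) ⊗ₜ b) + a ⊗ₜ (u ⊗ₜ ((ω X : Module.End K A) b)) := by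
  rw [diagAux, AlgHom.comp_apply, AlgHom.comp_apply, comulU₂_ι]
  simp only [map_add, Algebra.TensorProduct.map_tmul, AlgHom.comp_apply, actU_ι,
    map_one, Module.endTensorEndAlgHom_apply]
  rfl

/-- The diagonal action of `U(L)` on `A ⊙ U(L) ⊙ A`. -/
def diag : UniversalEnvelopingAlgebra K L →ₐ[K] Module.End K (CM ω) :=
  diagAux ω

theorem diag_ι (X : L) (a : A) (u : UniversalEnvelopingAlgebra K L) (b : A) :
    diag ω (ι K X) (pure ω a u b) = pure ω ((ω X : Module.End K A) a) u b
      + pure ω a (ι K X * u) b + pure ω a u ((ω X : Module.End K A) b) :=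
  diagAux_ι ω X a u b

/-- `a' ⊗ u ⊗ b ↦ a a' ⊗ u ⊗ b`. -/
def mulL : A →ₗ[K] Module.End K (CM ω) :=
  LinearMap.mk₂ K
    (fun a z => lift₃ ω ((pure₃ ω).comp (LinearMap.mulLeft K a)) z)
    (fun a a' z => by
      rw [← LinearMap.add_apply]
      refine LinearMap.congr_fun (hom_ext ?_) z
      intros; simp [add_mul])
    (fun c a z => by
      rw [← LinearMap.smul_apply]
      refine LinearMap.congr_fun (hom_ext ?_) z
      intros; simp)
    (by intros; simp) (by intros; simp)

/-- `a ⊗ u ⊗ b' ↦ a ⊗ u ⊗ b' b`. -/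
def mulR : A →ₗ[K] Module.End K (CM ω) :=
  LinearMap.mk₂ K
    (fun b z => lift₃ ω ((pure₃ ω).compr₂ (LinearMap.lcomp K _ (LinearMap.mulRight K b))) z)
    (fun b b' z => by
      rw [← LinearMap.add_apply]
      refine LinearMap.congr_fun (hom_ext ?_) z
      intros; simp [mul_add])
    (fun c b z => by
      rw [← LinearMap.smul_apply]
      refine LinearMap.congr_fun (hom_ext ?_) z
      intros; simp)
    (by intros; simp) (by intros; simp)

@[simp] theorem mulL_pure (a a' : A) (u : UniversalEnvelopingAlgebra K L) (b : A) :
    mulL ω a (pure ω a' u b) = pure ω (a * a') u b := rfl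

@[simp] theorem mulR_pure (b a : A) (u : UniversalEnvelopingAlgebra K L) (b' : A) :
    mulR ω b (pure ω a u b') = pure ω a u (b' * b) := rfl

/-- The multiplication
`(a ⊗ u ⊗ b)(a' ⊗ u' ⊗ b') = ∑ a (u₁ · a') ⊗ u₂ u' ⊗ (u₃ · b') b` of `A ⊙ U(L) ⊙ A`. -/
def mulHom : CM ω →ₗ[K] Module.End K (CM ω) :=
  lift₃ ω (LinearMap.mk₂ K
    (fun a u => (LinearMap.mulLeft K (mulL ω a)).comp
      ((LinearMap.mulRight K (diag ω u)).comp (mulR ω)))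
    (by intros; ext : 1; simp [add_mul])
    (by intros; ext : 1; simp)
    (by intros; ext : 1; simp [mul_add])
    (by intros; ext : 1; simp))

theorem mulHom_pure (a : A) (u : UniversalEnvelopingAlgebra K L) (b : A) :
    mulHom ω (pure ω a u b) = mulL ω a * (mulR ω b * diag ω u) := rfl

theorem mulL_mul (a a' : A) : mulL ω (a * a') = mulL ω a * mulL ω a' :=
  hom_ext (by intros; simp [mul_assoc])

theorem mulR_mul (b b' : A) : mulR ω (b * b') = mulR ω b' * mulR ω b :=
  hom_ext (by intros; simp [mul_assoc])

theorem mulL_one : mulL ω (1 : A) = 1 := hom_ext (by intros; simp)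

theorem mulR_one : mulR ω (1 : A) = 1 := hom_ext (by intros; simp)

theorem mulL_mulR (a b : A) : mulL ω a * mulR ω b = mulR ω b * mulL ω a :=
  hom_ext (by intros; simp)

theorem diag_ι_mulL (X : L) (a : A) : diag ω (ι K X) * mulL ω a =
    mulL ω ((ω X : Module.End K A) a) + mulL ω a * diag ω (ι K X) :=
  hom_ext (by
    intro a' u b
    simp only [Module.End.mul_apply, LinearMap.add_apply, mulL_pure, diag_ι, map_add,
      Der.leibniz, pure_add_left]
    abel)

theorem diag_ι_mulR (X : L) (b : A) : diag ω (ι K X) * mulR ω b =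
    mulR ω ((ω X : Module.End K A) b) + mulR ω b * diag ω (ι K X) :=
  hom_ext (by
    intro a u b'
    simp only [Module.End.mul_apply, LinearMap.add_apply, mulR_pure, diag_ι, map_add,
      Der.leibniz, pure_add_right]
    abel)

theorem mulHom_mulL (a : A) (z : CM ω) : mulHom ω (mulL ω a z) = mulL ω a * mulHom ω z := by
  have : (mulHom ω).comp (mulL ω a) = (LinearMap.mulLeft K (mulL ω a)).comp (mulHom ω) :=
    hom_ext (by intros; simp [mulHom_pure, mulL_mul, mul_assoc])
  exact LinearMap.congr_fun this z

theorem mulHom_mulR (b : A) (z : CM ω) : mulHom ω (mulR ω b z) = mulR ω b * mulHom ω z := by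
  have : (mulHom ω).comp (mulR ω b) = (LinearMap.mulLeft K (mulR ω b)).comp (mulHom ω) :=
    hom_ext (by
      intro a u b'
      simp only [LinearMap.comp_apply, mulR_pure, mulHom_pure, mulR_mul,
        LinearMap.mulLeft_apply, ← mul_assoc, mulL_mulR]
      rw [mul_assoc (mulR ω b), mulL_mulR, ← mul_assoc])
  exact LinearMap.congr_fun this z

theorem mulHom_diag (u : UniversalEnvelopingAlgebra K L) :
    ∀ z : CM ω, mulHom ω (diag ω u z) = diag ω u * mulHom ω z := by
  refine U_induction K (p := fun u => ∀ z : CM ω, mulHom ω (diag ω u z) = diag ω u * mulHom ω z)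
    ?_ ?_ ?_ ?_ u
  · intro c z
    simp [Algebra.algebraMap_eq_smul_one]
  · intro X z
    have : (mulHom ω).comp (diag ω (ι K X))
        = (LinearMap.mulLeft K (diag ω (ι K X))).comp (mulHom ω) :=
      hom_ext (by
        intro a u b
        simp only [LinearMap.comp_apply, diag_ι, map_add, mulHom_pure, LinearMap.mulLeft_apply,
          map_mul]
        rw [← mul_assoc (diag ω (ι K X)), diag_ι_mulL, add_mul, mul_assoc (mulL ω a),
          ← mul_assoc (diag ω (ι K X)), diag_ι_mulR]
        noncomm_ring)
    exact LinearMap.congr_fun this z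
  · intro u v hu hv z
    simp [hu, hv, add_mul]
  · intro u v hu hv z
    simp [hu, hv, mul_assoc]

theorem mulHom_mulHom (x y : CM ω) : mulHom ω (mulHom ω x y) = mulHom ω x * mulHom ω y := by
  have : (mulHom ω).comp ((mulHom ω).flip y)
      = (LinearMap.mulRight K (mulHom ω y)).comp (mulHom ω) :=
    hom_ext (by
      intro a u b
      simp only [LinearMap.comp_apply, LinearMap.flip_apply, mulHom_pure, Module.End.mul_apply,
        LinearMap.mulRight_apply, mulHom_mulL, mulHom_mulR, mulHom_diag, mul_assoc])
  exact LinearMap.congr_fun this x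

theorem diag_pure_one (u : UniversalEnvelopingAlgebra K L) :
    ∀ v : UniversalEnvelopingAlgebra K L, diag ω u (pure ω 1 v 1) = pure ω 1 (u * v) 1 := by
  refine U_induction K (p := fun u => ∀ v, diag ω u (pure ω 1 v 1) = pure ω 1 (u * v) 1)
    ?_ ?_ ?_ ?_ u
  · intro c v
    simp [Algebra.algebraMap_eq_smul_one, ← pure₃_apply]
  · intro X v
    rw [diag_ι, Der.map_one]
    simp [← pure₃_apply]
  · intro u u' hu hu' v
    simp [hu, hu', add_mul, pure_add_mid]
  · intro u u' hu hu' v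
    simp [hu, hu', mul_assoc]

theorem diag_one_unit (u : UniversalEnvelopingAlgebra K L) :
    diag ω u (pure ω 1 1 1) = pure ω 1 u 1 := by
  simpa using diag_pure_one ω u 1

instance : Ring (CM ω) where
  mul x y := mulHom ω x y
  one := pure ω 1 1 1
  left_distrib x y z := map_add (mulHom ω x) y z
  right_distrib x y z := by
    change mulHom ω (x + y) z = _
    rw [map_add]; rfl
  zero_mul x := by
    change mulHom ω 0 x = 0
    simp
  mul_zero x := map_zero (mulHom ω x)
  mul_assoc x y z := by
    change mulHom ω (mulHom ω x y) z = mulHom ω x (mulHom ω y z)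
    rw [mulHom_mulHom]; rfl
  one_mul x := by
    change mulHom ω (pure ω 1 1 1) x = x
    simp [mulHom_pure, mulL_one, mulR_one]
  mul_one x := by
    have : (mulHom ω).flip (pure ω 1 1 1) = LinearMap.id :=
      hom_ext (by
        intro a u b
        simp [mulHom_pure, diag_one_unit])
    exact LinearMap.congr_fun this x
  neg_add_cancel := neg_add_cancel
  zsmul := fun n x => n • x
  zsmul_zero' := SubNegMonoid.zsmul_zero'
  zsmul_succ' := SubNegMonoid.zsmul_succ'
  zsmul_neg' := SubNegMonoid.zsmul_neg'
  nsmul := fun n x => n • x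
  nsmul_zero := AddMonoid.nsmul_zero
  nsmul_succ := AddMonoid.nsmul_succ
  sub_eq_add_neg := sub_eq_add_neg

theorem mul_def (x y : CM ω) : x * y = mulHom ω x y := rfl

theorem one_def : (1 : CM ω) = pure ω 1 1 1 := rfl

instance : Algebra K (CM ω) :=
  Algebra.ofModule
    (by intro c x y; simp [mul_def])
    (by intro c x y; simp [mul_def])

theorem pure_mul (a : A) (u : UniversalEnvelopingAlgebra K L) (b : A) (z : CM ω) :
    pure ω a u b * z = mulL ω a (mulR ω b (diag ω u z)) := rfl


/-- The source `a ↦ a ⊗ 1 ⊗ 1`. -/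
def source : A →ₐ[K] CM ω :=
  AlgHom.ofLinearMap (((pure₃ ω).flip 1).flip 1) rfl (by
    intro a a'
    change pure ω (a * a') 1 1 = pure ω a 1 1 * pure ω a' 1 1
    simp [pure_mul, mulR_one])

/-- The target `b ↦ 1 ⊗ 1 ⊗ b`. -/
def target : Aᵐᵒᵖ →ₐ[K] CM ω :=
  AlgHom.ofLinearMap ((pure₃ ω 1 1).comp (opLinearEquiv K).symm.toLinearMap) rfl (by
    intro a a'
    change pure ω 1 1 (a'.unop * a.unop) = pure ω 1 1 a.unop * pure ω 1 1 a'.unop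
    simp [pure_mul, mulL_one])

theorem source_mul (a : A) (z : CM ω) : source ω a * z = mulL ω a z := by
  change pure ω a 1 1 * z = _
  simp [pure_mul, mulR_one]

theorem target_mul (b : A) (z : CM ω) : target ω (op b) * z = mulR ω b z := by
  change pure ω 1 1 b * z = _
  simp [pure_mul, mulL_one]

theorem source_target (a : A) (b : Aᵐᵒᵖ) : Commute (source ω a) (target ω b) := by
  change source ω a * target ω (op b.unop) = target ω (op b.unop) * source ω a
  rw [source_mul, target_mul]
  change mulL ω a (pure ω 1 1 b.unop) = mulR ω b.unop (pure ω a 1 1)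
  simp

/-- The algebra map `η : Aᵉ → A ⊙ U(L) ⊙ A`, `a ⊗ b ↦ a ⊗ 1 ⊗ b`. -/
def eta : Env K A →ₐ[K] CM ω :=
  Algebra.TensorProduct.lift (source ω) (target ω) (source_target ω)

@[simp] theorem src_eta (a : A) : src (eta ω) a = pure ω a 1 1 := by
  have : src (eta ω) a = source ω a := by simp [src, eta]
  rw [this]; rfl

@[simp] theorem tgt_eta (b : A) : tgt (eta ω) (op b) = pure ω 1 1 b := by
  have : tgt (eta ω) (op b) = target ω (op b) := by simp [tgt, eta]
  rw [this]; rfl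

theorem src_eta_mul (a : A) (z : CM ω) : src (eta ω) a * z = mulL ω a z := by
  rw [src_eta]; exact source_mul ω a z

theorem tgt_eta_mul (b : A) (z : CM ω) : tgt (eta ω) (op b) * z = mulR ω b z := by
  rw [tgt_eta]; exact target_mul ω b z

/-- `(a, b) ↦ (u ⊗ v ↦ (a ⊗ u ⊗ 1) ⊗_A (1 ⊗ v ⊗ b))`. -/
def comulPair : A →ₗ[K] A →ₗ[K]
    (UniversalEnvelopingAlgebra K L ⊗[K] UniversalEnvelopingAlgebra K L →ₗ[K] Tens (eta ω)) :=
  LinearMap.mk₂ K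
    (fun a b => TensorProduct.lift
      ((tens (eta ω)).compl₁₂ ((pure₃ ω a).flip 1) ((pure₃ ω 1).flip b)))
    (by intros; ext; simp) (by intros; ext; simp) (by intros; ext; simp) (by intros; ext; simp)

@[simp] theorem comulPair_tmul (a b : A) (u v : UniversalEnvelopingAlgebra K L) :
    comulPair ω a b (u ⊗ₜ v) = tens (eta ω) (pure ω a u 1) (pure ω 1 v b) := rfl

/-- The comultiplication `Δ(a ⊗ u ⊗ b) = ∑ (a ⊗ u₁ ⊗ 1) ⊗_A (1 ⊗ u₂ ⊗ b)`. -/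
def comul : CM ω →ₗ[K] Tens (eta ω) :=
  lift₃ ω (LinearMap.mk₂ K
    (fun a u => (comulPair ω a).flip (comulU K L u))
    (by intros; ext; simp) (by intros; ext; simp) (by intros; ext; simp) (by intros; ext; simp))

@[simp] theorem comul_pure (a : A) (u : UniversalEnvelopingAlgebra K L) (b : A) :
    comul ω (pure ω a u b) = comulPair ω a b (comulU K L u) := rfl

/-- The counit `ε(a ⊗ u ⊗ b) = a ε(u) b`. -/
def counit : CM ω →ₗ[K] A :=
  lift₃ ω (LinearMap.mk₂ K
    (fun a u => counitU K L u • LinearMap.mulLeft K a)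
    (by intros; ext; simp [add_mul]) (by intros; ext; simp [smul_smul, mul_comm])
    (by intros; ext; simp [add_smul]) (by intros; ext; simp [mul_smul]))

@[simp] theorem counit_pure (a : A) (u : UniversalEnvelopingAlgebra K L) (b : A) :
    counit ω (pure ω a u b) = counitU K L u • (a * b) := rfl

theorem counit_mulL (a : A) (z : CM ω) : counit ω (mulL ω a z) = a * counit ω z := by
  have : (counit ω).comp (mulL ω a) = (LinearMap.mulLeft K a).comp (counit ω) :=
    hom_ext (by intros; simp [mul_assoc])
  exact LinearMap.congr_fun this z

theorem counit_mulR (b : A) (z : CM ω) : counit ω (mulR ω b z) = counit ω z * b := by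
  have : (counit ω).comp (mulR ω b) = (LinearMap.mulRight K b).comp (counit ω) :=
    hom_ext (by intros; simp [mul_assoc])
  exact LinearMap.congr_fun this z

theorem counit_diag (u : UniversalEnvelopingAlgebra K L) :
    ∀ z : CM ω, counit ω (diag ω u z) = actU ω u (counit ω z) := by
  refine U_induction K
    (p := fun u => ∀ z : CM ω, counit ω (diag ω u z) = actU ω u (counit ω z)) ?_ ?_ ?_ ?_ u
  · intro c z
    simp [Algebra.algebraMap_eq_smul_one]
  · intro X z
    have : (counit ω).comp (diag ω (ι K X)) = (actU ω (ι K X)).comp (counit ω) :=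
      hom_ext (by
        intro a u b
        simp only [LinearMap.comp_apply, diag_ι, map_add, counit_pure, map_mul, counitU_ι,
          zero_mul, zero_smul, add_zero, actU_ι, map_smul, Der.leibniz, smul_add])
    exact LinearMap.congr_fun this z
  · intro u v hu hv z
    simp [hu, hv]
  · intro u v hu hv z
    simp [hu, hv]

theorem counit_pure_mul (a : A) (u : UniversalEnvelopingAlgebra K L) (b : A) (z : CM ω) :
    counit ω (pure ω a u b * z) = a * (actU ω u (counit ω z) * b) := by
  rw [pure_mul, counit_mulL, counit_mulR, counit_diag]

theorem comul_src (a : A) (x : CM ω) :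
    comul ω (src (eta ω) a * x) = tensActL (eta ω) a (comul ω x) := by
  have : (comul ω).comp (mulL ω a) = (tensActL (eta ω) a).comp (comul ω) :=
    hom_ext (by
      intro a' u b
      have h : comulPair ω (a * a') b = (tensActL (eta ω) a).comp (comulPair ω a' b) := by
        apply TensorProduct.ext'
        intro v w
        simp only [LinearMap.comp_apply, comulPair_tmul, tensActL_tens, src_eta_mul, mulL_pure]
      simpa using LinearMap.congr_fun h (comulU K L u))
  rw [src_eta_mul]
  exact LinearMap.congr_fun this x

theorem comul_tgt (a : A) (x : CM ω) :
    comul ω (tgt (eta ω) (op a) * x) = tensActR (eta ω) a (comul ω x) := by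
  have : (comul ω).comp (mulR ω a) = (tensActR (eta ω) a).comp (comul ω) :=
    hom_ext (by
      intro a' u b
      have h : comulPair ω a' (b * a) = (tensActR (eta ω) a).comp (comulPair ω a' b) := by
        apply TensorProduct.ext'
        intro v w
        simp only [LinearMap.comp_apply, comulPair_tmul, tensActR_tens, tgt_eta_mul, mulR_pure]
      simpa using LinearMap.congr_fun h (comulU K L u))
  rw [tgt_eta_mul]
  exact LinearMap.congr_fun this x

theorem counit_src (a : A) (x : CM ω) : counit ω (src (eta ω) a * x) = a * counit ω x := by
  rw [src_eta_mul, counit_mulL]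

theorem counit_tgt (a : A) (x : CM ω) :
    counit ω (tgt (eta ω) (op a) * x) = counit ω x * a := by
  rw [tgt_eta_mul, counit_mulR]

/-- `u ⊗ v ⊗ w ↦ (a ⊗ u ⊗ 1) ⊗_A (1 ⊗ v ⊗ 1) ⊗_A (1 ⊗ w ⊗ b)`. -/
def triple (a b : A) : UniversalEnvelopingAlgebra K L ⊗[K]
    (UniversalEnvelopingAlgebra K L ⊗[K] UniversalEnvelopingAlgebra K L) →ₗ[K] Tens₃ (eta ω) :=
  (tens₃Rel (eta ω)).mkQ.comp (TensorProduct.map ((pure₃ ω a).flip 1)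
    (TensorProduct.map ((pure₃ ω 1).flip 1) ((pure₃ ω 1).flip b)))

theorem triple_tmul (a b : A) (u v w : UniversalEnvelopingAlgebra K L) :
    triple ω a b (u ⊗ₜ (v ⊗ₜ w)) =
      tens₃ (eta ω) (pure ω a u 1) (pure ω 1 v 1) (pure ω 1 w b) := rfl

theorem comulTens_comulPair (a b : A) :
    (comulTens (eta ω) (comul ω) (comul_tgt ω)).comp (comulPair ω a b) =
      (triple ω a b).comp (((TensorProduct.assoc K _ _ _).toLinearMap).comp
        (TensorProduct.map (comulU K L).toLinearMap LinearMap.id)) := by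
  apply TensorProduct.ext'
  intro u v
  have h : (tensAssocL (eta ω)).flip (pure ω 1 v b) ∘ₗ comulPair ω a 1 =
      (triple ω a b).comp (((TensorProduct.assoc K _ _ _).toLinearMap).comp
        ((TensorProduct.mk K _ (UniversalEnvelopingAlgebra K L)).flip v)) := by
    apply TensorProduct.ext'
    intro p q
    simp [triple_tmul]
  simpa [comulTens] using LinearMap.congr_fun h (comulU K L u)

theorem tensComul_comulPair (a b : A) :
    (tensComul (eta ω) (comul ω) (comul_src ω)).comp (comulPair ω a b) =
      (triple ω a b).comp (TensorProduct.map LinearMap.id (comulU K L).toLinearMap) := by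
  apply TensorProduct.ext'
  intro u v
  have h : (tensAssocR (eta ω)).flip (pure ω a u 1) ∘ₗ comulPair ω 1 b =
      (triple ω a b).comp
        (TensorProduct.mk K (UniversalEnvelopingAlgebra K L) _ u) := by
    apply TensorProduct.ext'
    intro p q
    simp [triple_tmul]
  simpa [tensComul] using LinearMap.congr_fun h (comulU K L v)

theorem coassoc (x : CM ω) : comulTens (eta ω) (comul ω) (comul_tgt ω) (comul ω x) =
    tensComul (eta ω) (comul ω) (comul_src ω) (comul ω x) := by
  have : (comulTens (eta ω) (comul ω) (comul_tgt ω)).comp (comul ω) =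
      (tensComul (eta ω) (comul ω) (comul_src ω)).comp (comul ω) :=
    hom_ext (by
      intro a u b
      have h1 := LinearMap.congr_fun (comulTens_comulPair ω a b) (comulU K L u)
      have h2 := LinearMap.congr_fun (tensComul_comulPair ω a b) (comulU K L u)
      have h3 := congrArg (triple ω a b) (AlgHom.congr_fun (coassocU K (L := L)) u)
      exact (h1.trans h3).trans h2.symm)
  exact LinearMap.congr_fun this x

theorem counit_comul (x : CM ω) :
    counitTens (eta ω) (counit ω) (counit_tgt ω) (comul ω x) = x := by
  have : (counitTens (eta ω) (counit ω) (counit_tgt ω)).comp (comul ω) = LinearMap.id :=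
    hom_ext (by
      intro a u b
      have h : (counitTens (eta ω) (counit ω) (counit_tgt ω)).comp (comulPair ω a b) =
          ((pure₃ ω a).flip b).comp ((TensorProduct.lid K _).toLinearMap.comp
            (TensorProduct.map (counitU K L).toLinearMap LinearMap.id)) := by
        apply TensorProduct.ext'
        intro v w
        simp only [LinearMap.comp_apply, comulPair_tmul, counitTens_tens, counit_pure,
          src_eta_mul, mulL_pure, mul_one, LinearEquiv.coe_coe, TensorProduct.map_tmul,
          TensorProduct.lid_tmul, LinearMap.id_apply, LinearMap.flip_apply, map_smul,
          AlgHom.toLinearMap_apply, pure₃_apply, smul_mul_assoc]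
      have h3 := congrArg ((pure₃ ω a).flip b) (AlgHom.congr_fun (counitU_comulU K (L := L)) u)
      exact (LinearMap.congr_fun h (comulU K L u)).trans h3)
  exact LinearMap.congr_fun this x

theorem comul_counit (x : CM ω) :
    tensCounit (eta ω) (counit ω) (counit_src ω) (comul ω x) = x := by
  have : (tensCounit (eta ω) (counit ω) (counit_src ω)).comp (comul ω) = LinearMap.id :=
    hom_ext (by
      intro a u b
      have h : (tensCounit (eta ω) (counit ω) (counit_src ω)).comp (comulPair ω a b) =
          ((pure₃ ω a).flip b).comp ((TensorProduct.rid K _).toLinearMap.comp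
            (TensorProduct.map LinearMap.id (counitU K L).toLinearMap)) := by
        apply TensorProduct.ext'
        intro v w
        simp only [LinearMap.comp_apply, comulPair_tmul, tensCounit_tens, counit_pure,
          tgt_eta_mul, mulR_pure, one_mul, LinearEquiv.coe_coe, TensorProduct.map_tmul,
          TensorProduct.rid_tmul, LinearMap.id_apply, LinearMap.flip_apply, map_smul,
          AlgHom.toLinearMap_apply, pure₃_apply, LinearMap.smul_apply]
      have h3 := congrArg ((pure₃ ω a).flip b) (AlgHom.congr_fun (comulU_counitU K (L := L)) u)
      exact (LinearMap.congr_fun h (comulU K L u)).trans h3)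
  exact LinearMap.congr_fun this x

theorem comul_one : comul ω 1 = tens (eta ω) 1 1 := by
  rw [one_def, comul_pure, map_one (comulU K L), Algebra.TensorProduct.one_def, comulPair_tmul]

/-- `Δ(x)` lies in the Takeuchi product and `Δ(x y) = Δ(x) Δ(y)` for all `y`. -/
def Mult (x : CM ω) : Prop :=
  ∃ h : comul ω x ∈ takeuchi (eta ω),
    ∀ y : CM ω, comul ω (x * y) = takMul (eta ω) ⟨comul ω x, h⟩ (comul ω y)

variable {ω}

theorem Mult.mul {x x' : CM ω} (hx : Mult ω x) (hx' : Mult ω x') : Mult ω (x * x') := by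
  obtain ⟨h, H⟩ := hx
  obtain ⟨h', H'⟩ := hx'
  refine ⟨by rw [H]; exact takMul_mem _ _ h', fun y => ?_⟩
  rw [mul_assoc, H, H', ← takMul_assoc]
  congr 2
  exact Subtype.ext (H x').symm

theorem Mult.add {x x' : CM ω} (hx : Mult ω x) (hx' : Mult ω x') : Mult ω (x + x') := by
  obtain ⟨h, H⟩ := hx
  obtain ⟨h', H'⟩ := hx'
  refine ⟨by rw [map_add]; exact add_mem h h', fun y => ?_⟩
  rw [add_mul, map_add, H, H', ← takMul_add]
  congr 2
  exact Subtype.ext (map_add _ _ _).symm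

variable (ω)

theorem mult_src (a : A) : Mult ω (src (eta ω) a) := by
  have h : comul ω (src (eta ω) a) = tens (eta ω) (src (eta ω) a) 1 := by
    have := comul_src ω a 1
    rwa [mul_one, comul_one, tensActL_tens, mul_one] at this
  refine ⟨h ▸ tens_src_mem (eta ω) a, fun y => ?_⟩
  rw [comul_src, ← takMul_src]
  congr 2
  exact Subtype.ext h.symm

theorem mult_tgt (a : A) : Mult ω (tgt (eta ω) (op a)) := by
  have h : comul ω (tgt (eta ω) (op a)) = tens (eta ω) 1 (tgt (eta ω) (op a)) := by
    have := comul_tgt ω a 1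
    rwa [mul_one, comul_one, tensActR_tens, mul_one] at this
  refine ⟨h ▸ tens_tgt_mem (eta ω) a, fun y => ?_⟩
  rw [comul_tgt, ← takMul_tgt]
  congr 2
  exact Subtype.ext h.symm

theorem pure_ι_mul (X : L) (z : CM ω) : pure ω 1 (ι K X) 1 * z = diag ω (ι K X) z := by
  simp [pure_mul, mulL_one, mulR_one]

theorem pure_ι_mul_src (X : L) (a : A) : pure ω 1 (ι K X) 1 * src (eta ω) a =
    src (eta ω) a * pure ω 1 (ι K X) 1 + src (eta ω) ((ω X : Module.End K A) a) := by
  rw [src_eta_mul, src_eta, src_eta, pure_ι_mul, diag_ι, Der.map_one, mulL_pure]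
  simp [← pure₃_apply, add_comm]

theorem pure_ι_mul_tgt (X : L) (a : A) : pure ω 1 (ι K X) 1 * tgt (eta ω) (op a) =
    tgt (eta ω) (op a) * pure ω 1 (ι K X) 1 +
      tgt (eta ω) (op ((ω X : Module.End K A) a)) := by
  rw [tgt_eta_mul, tgt_eta, tgt_eta, pure_ι_mul, diag_ι, Der.map_one, mulR_pure]
  simp [← pure₃_apply]

theorem mult_ι (X : L) : Mult ω (pure ω 1 (ι K X) 1) := by
  have h : comul ω (pure ω 1 (ι K X) 1) =
      tens (eta ω) (pure ω 1 (ι K X) 1) 1 + tens (eta ω) 1 (pure ω 1 (ι K X) 1) := by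
    rw [comul_pure, comulU_ι, map_add, comulPair_tmul, comulPair_tmul, ← one_def]
  have hm : comul ω (pure ω 1 (ι K X) 1) ∈ takeuchi (eta ω) := by
    rw [h, mem_takeuchi]
    intro a
    have e1 := tens_balanced (eta ω) a (pure ω 1 (ι K X) 1) 1
    have e2 := tens_balanced (eta ω) a 1 (pure ω 1 (ι K X) 1)
    have e3 := tens_balanced (eta ω) ((ω X : Module.End K A) a) 1 1
    rw [mul_one] at e1 e2 e3
    simp only [map_add, tensMulR_tens, mul_one, one_mul, pure_ι_mul_src, pure_ι_mul_tgt,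
      LinearMap.add_apply, e1, e2]
    rw [mul_one] at e3
    rw [e3]
    abel
  refine ⟨hm, fun y => ?_⟩
  · have : (comul ω).comp (LinearMap.mulLeft K (pure ω 1 (ι K X) 1)) =
        (takMul (eta ω) ⟨comul ω (pure ω 1 (ι K X) 1), hm⟩).comp (comul ω) :=
      hom_ext (by
        intro a u b
        have key : ∀ w, comulPair ω ((ω X : Module.End K A) a) b w +
            comulPair ω a b ((ι K X ⊗ₜ[K] 1 + 1 ⊗ₜ[K] ι K X) * w) +
            comulPair ω a ((ω X : Module.End K A) b) w =
            takMul (eta ω) ⟨comul ω (pure ω 1 (ι K X) 1), hm⟩ (comulPair ω a b w) := by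
          intro w
          induction w using TensorProduct.induction_on with
          | zero => simp
          | add w w' hw hw' =>
            rw [map_add (comulPair ω a b), map_add (takMul _ _), ← hw, ← hw']
            simp only [mul_add, map_add]
            abel
          | tmul p q =>
            simp only [add_mul, Algebra.TensorProduct.tmul_mul_tmul, one_mul, map_add,
              comulPair_tmul, takMul_tens, h, tensMulR_tens, pure_ι_mul, diag_ι,
              LinearMap.add_apply, Der.map_one]
            simp only [← pure₃_apply, map_zero, LinearMap.zero_apply, add_zero, zero_add]
            abel
        change comul ω (pure ω 1 (ι K X) 1 * pure ω a u b) =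
          takMul (eta ω) ⟨comul ω (pure ω 1 (ι K X) 1), hm⟩ (comulPair ω a b (comulU K L u))
        rw [← key, pure_ι_mul, diag_ι, map_add, map_add, comul_pure, comul_pure, comul_pure,
          map_mul, comulU_ι])
    exact LinearMap.congr_fun this y

theorem mult_U (u : UniversalEnvelopingAlgebra K L) : Mult ω (pure ω 1 u 1) := by
  refine U_induction K (p := fun u => Mult ω (pure ω 1 u 1)) ?_ (mult_ι ω) ?_ ?_ u
  · intro c
    have : pure ω 1 (algebraMap K (UniversalEnvelopingAlgebra K L) c) 1 =
        src (eta ω) (c • 1) := by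
      rw [src_eta, Algebra.algebraMap_eq_smul_one]
      simp [← pure₃_apply]
    rw [this]
    exact mult_src ω _
  · intro u v hu hv
    rw [pure_add_mid]
    exact hu.add hv
  · intro u v hu hv
    have : pure ω 1 (u * v) 1 = pure ω 1 u 1 * pure ω 1 v 1 := by
      simp [pure_mul, mulL_one, mulR_one, diag_pure_one]
    rw [this]
    exact hu.mul hv

theorem mult (x : CM ω) : Mult ω x := by
  have hpure : ∀ a u b, Mult ω (pure ω a u b) := by
    intro a u b
    have : pure ω a u b = src (eta ω) a * (tgt (eta ω) (op b) * pure ω 1 u 1) := by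
      rw [src_eta_mul, tgt_eta_mul]
      simp
    rw [this]
    exact (mult_src ω a).mul ((mult_tgt ω b).mul (mult_U ω u))
  have hzero : Mult ω (0 : CM ω) := by
    have := mult_src ω (0 : A)
    rwa [map_zero] at this
  have hx : ∀ x : A ⊗[K] (UniversalEnvelopingAlgebra K L ⊗[K] A), Mult ω (x : CM ω) := by
    intro x
    induction x using TensorProduct.induction_on with
    | zero => exact hzero
    | add x y hx hy => exact Mult.add hx hy
    | tmul a w =>
      induction w using TensorProduct.induction_on with
      | zero => rw [TensorProduct.tmul_zero]; exact hzero
      | add x y hx hy => rw [TensorProduct.tmul_add]; exact Mult.add hx hy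
      | tmul u b => exact hpure a u b
  exact hx x

theorem counit_mul_src (x y : CM ω) :
    counit ω (x * src (eta ω) (counit ω y)) = counit ω (x * y) := by
  have : (counit ω).comp (LinearMap.mulRight K (src (eta ω) (counit ω y))) =
      (counit ω).comp (LinearMap.mulRight K y) :=
    hom_ext (by
      intro a u b
      simp only [LinearMap.comp_apply, LinearMap.mulRight_apply, counit_pure_mul, src_eta,
        counit_pure, map_one, one_smul, mul_one])
  exact LinearMap.congr_fun this x

theorem counit_mul_tgt (x y : CM ω) :
    counit ω (x * tgt (eta ω) (op (counit ω y))) = counit ω (x * y) := by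
  have : (counit ω).comp (LinearMap.mulRight K (tgt (eta ω) (op (counit ω y)))) =
      (counit ω).comp (LinearMap.mulRight K y) :=
    hom_ext (by
      intro a u b
      simp only [LinearMap.comp_apply, LinearMap.mulRight_apply, counit_pure_mul, tgt_eta,
        counit_pure, map_one, one_smul, one_mul])
  exact LinearMap.congr_fun this x

end CM

/-- The Connes–Moscovici bialgebroid `A ⊙ U(L) ⊙ A` of the `A`-anchored Lie algebra `(L, ω)`. -/
def connesMoscovici (ω : L →ₗ⁅K⁆ Der K A) : LeftBialgebroid K A (CM ω) where
  η := CM.eta ω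
  comul := CM.comul ω
  counit := CM.counit ω
  comul_src := CM.comul_src ω
  comul_tgt := CM.comul_tgt ω
  counit_src := CM.counit_src ω
  counit_tgt := CM.counit_tgt ω
  coassoc := CM.coassoc ω
  counit_comul := CM.counit_comul ω
  comul_counit := CM.comul_counit ω
  comul_mem := fun x => (CM.mult ω x).choose
  comul_one := CM.comul_one ω
  comul_mul := fun x => (CM.mult ω x).choose_spec
  counit_mul_src := CM.counit_mul_src ω
  counit_mul_tgt := CM.counit_mul_tgt ω
  counit_one := by
    rw [CM.one_def, CM.counit_pure]
    simp

end Enveloping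

section Semidirect

variable {K : Type uK} {A : Type uA} {L' : Type uL} {L'' : Type uC} [Field K] [Ring A]
  [Algebra K A] [LieRing L'] [LieAlgebra K L'] [LieRing L''] [LieAlgebra K L'']

/-- The compatibility `[ω''(X''), ω'(X')] = ω'(δ(X'')(X'))` of an action `δ : L'' → Der(L')`
with the anchors `ω'` of `L'` and `ω''` of `L''`. -/
def AnchorCompatible (ω' : L' →ₗ⁅K⁆ Der K A) (ω'' : L'' →ₗ⁅K⁆ Der K A)
    (δ : L'' →ₗ⁅K⁆ LieDerivation K L' L') : Prop :=
  ∀ (X'' : L'') (X' : L'), ⁅ω'' X'', ω' X'⁆ = ω' (δ X'' X')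

/-- The anchor `(X'', X') ↦ ω''(X'') + ω'(X')` of the semi-direct product `L'' ⋉_δ L'`
(for an element `z` of the latter, `X'' = z.right` and `X' = z.left`). -/
def semidirectAnchor (ω' : L' →ₗ⁅K⁆ Der K A) (ω'' : L'' →ₗ⁅K⁆ Der K A)
    (δ : L'' →ₗ⁅K⁆ LieDerivation K L' L') (h : AnchorCompatible ω' ω'' δ) :
    LieAlgebra.SemiDirectSum L' L'' δ →ₗ⁅K⁆ Der K A where
  toFun z := ω'' z.right + ω' z.left
  map_add' x y := by
    simp only [LieAlgebra.SemiDirectSum.add_eq_mk, map_add]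
    abel
  map_smul' c x := by
    simp only [LieAlgebra.SemiDirectSum.smul_eq_mk, map_smul, smul_add, RingHom.id_apply]
  map_lie' := by
    intro x y
    simp only [LieAlgebra.SemiDirectSum.lie_eq_mk, map_add, map_sub, LieHom.map_lie, ← h _ _,
      add_lie, lie_add]
    rw [← lie_skew (ω' x.left) (ω'' y.right)]
    abel

end Semidirect

namespace LeftBialgebroid

variable {K : Type uK} {A : Type uA} {B : Type uB} {C : Type uC}
  [Field K] [Ring A] [Algebra K A] [Ring B] [Algebra K B] [Ring C] [Algebra K C]

/-- A morphism of left `A`-bialgebroids. -/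
structure Hom (ℬ : LeftBialgebroid K A B) (𝒞 : LeftBialgebroid K A C) where
  /-- the underlying algebra map -/
  toAlgHom : B →ₐ[K] C
  map_src : ∀ a : A, toAlgHom (src ℬ.η a) = src 𝒞.η a
  map_tgt : ∀ a : A, toAlgHom (tgt ℬ.η (op a)) = tgt 𝒞.η (op a)
  map_counit : ∀ x : B, 𝒞.counit (toAlgHom x) = ℬ.counit x
  map_comul : ∀ x : B,
    tensMap ℬ.η 𝒞.η toAlgHom map_src map_tgt (ℬ.comul x) = 𝒞.comul (toAlgHom x)

/-- Isomorphism of left `A`-bialgebroids. -/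
def Isomorphic (ℬ : LeftBialgebroid K A B) (𝒞 : LeftBialgebroid K A C) : Prop :=
  ∃ (f : Hom ℬ 𝒞) (g : Hom 𝒞 ℬ),
    (∀ x : B, g.toAlgHom (f.toAlgHom x) = x) ∧ ∀ y : C, f.toAlgHom (g.toAlgHom y) = y

variable (ℬ : LeftBialgebroid K A B)

theorem takMul_comul_prim {X : B} (hX : ℬ.comul X = tens ℬ.η X 1 + tens ℬ.η 1 X) (u v : B) :
    takMul ℬ.η ⟨ℬ.comul X, ℬ.comul_mem X⟩ (tens ℬ.η u v) =
      tens ℬ.η (X * u) v + tens ℬ.η u (X * v) := by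
  simp [hX]

theorem comul_mul_prim {X Y : B} (hX : ℬ.comul X = tens ℬ.η X 1 + tens ℬ.η 1 X)
    (hY : ℬ.comul Y = tens ℬ.η Y 1 + tens ℬ.η 1 Y) :
    ℬ.comul (X * Y) = tens ℬ.η (X * Y) 1 + tens ℬ.η Y X + (tens ℬ.η X Y + tens ℬ.η 1 (X * Y)) := by
  rw [ℬ.comul_mul, hY, map_add, ℬ.takMul_comul_prim hX, ℬ.takMul_comul_prim hX, mul_one]

/-- The Lie algebra `Prim(B)` of primitive elements, with the commutator bracket. -/
def prim : LieSubalgebra K B where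
  carrier := {X | ℬ.comul X = tens ℬ.η X 1 + tens ℬ.η 1 X}
  add_mem' := by
    intro X Y hX hY
    simp only [Set.mem_ofPred_eq] at hX hY
    simp only [Set.mem_ofPred_eq, map_add, hX, hY, LinearMap.add_apply]
    abel
  zero_mem' := by simp
  smul_mem' := by
    intro c X hX
    simp only [Set.mem_ofPred_eq] at hX
    simp [hX]
  lie_mem' := by
    intro X Y hX hY
    simp only [Set.mem_ofPred_eq] at hX hY
    simp only [Set.mem_ofPred_eq, LieRing.of_associative_ring_bracket, map_sub]
    rw [ℬ.comul_mul_prim hX hY, ℬ.comul_mul_prim hY hX]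
    simp only [LinearMap.sub_apply]
    abel

theorem mem_prim {X : B} : X ∈ ℬ.prim ↔ ℬ.comul X = tens ℬ.η X 1 + tens ℬ.η 1 X := Iff.rfl

theorem counit_src_one (a : A) : ℬ.counit (src ℬ.η a) = a := by
  simpa [ℬ.counit_one] using ℬ.counit_src a 1

theorem counit_tgt_one (a : A) : ℬ.counit (tgt ℬ.η (op a)) = a := by
  simpa [ℬ.counit_one] using ℬ.counit_tgt a 1

theorem counit_mul_tgt_eq (x : B) (a : A) :
    ℬ.counit (x * tgt ℬ.η (op a)) = ℬ.counit (x * src ℬ.η a) := by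
  simpa [ℬ.counit_src_one] using ℬ.counit_mul_tgt x (src ℬ.η a)

theorem counit_prim {X : B} (hX : X ∈ ℬ.prim) : ℬ.counit X = 0 := by
  have h := ℬ.counit_comul X
  rw [ℬ.mem_prim.1 hX] at h
  simp only [map_add, counitTens_tens, ℬ.counit_one, map_one, one_mul, mul_one,
    add_eq_right] at h
  simpa [ℬ.counit_src_one] using congrArg ℬ.counit h

theorem prim_mul_src {X : B} (hX : X ∈ ℬ.prim) (a : A) :
    X * src ℬ.η a = src ℬ.η a * X + src ℬ.η (ℬ.counit (X * src ℬ.η a)) := by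
  have h := (mem_takeuchi ℬ.η).1 (ℬ.comul_mem X) a
  have h2 := congrArg (counitTens ℬ.η ℬ.counit ℬ.counit_tgt) h
  rw [ℬ.mem_prim.1 hX] at h2
  simp only [map_add, tensMulR_tens, counitTens_tens, one_mul, mul_one, ℬ.counit_one, map_one,
    ℬ.counit_tgt_one, ℬ.counit_prim hX, map_zero, zero_mul, zero_add,
    ℬ.counit_mul_tgt_eq] at h2
  rw [add_comm, h2]

/-- The anchor `ω_B : Prim(B) → Der_K(A)`, `X ↦ (a ↦ ε(X s(a)) = ε(X t(a)))`. -/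
def anchor : ℬ.prim →ₗ⁅K⁆ Der K A where
  toFun X := ⟨ℬ.counit.comp ((LinearMap.mulLeft K (X : B)).comp (src ℬ.η).toLinearMap), by
    intro a b
    simp only [LinearMap.comp_apply, AlgHom.toLinearMap_apply, LinearMap.mulLeft_apply, map_mul]
    rw [← mul_assoc, ℬ.prim_mul_src X.2 a, add_mul, map_add, mul_assoc, ℬ.counit_src,
      ℬ.counit_src, ℬ.counit_src_one, map_add, ℬ.counit_src, ℬ.counit_prim X.2, mul_zero,
      zero_add, ℬ.counit_src_one, add_comm]⟩
  map_add' X Y := by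
    apply Subtype.ext
    ext a
    simp [add_mul]
  map_smul' c X := by
    apply Subtype.ext
    ext a
    simp
  map_lie' := by
    intro X Y
    apply Subtype.ext
    ext a
    simp only [LieSubalgebra.coe_bracket, LieRing.of_associative_ring_bracket,
      LinearMap.comp_apply, AlgHom.toLinearMap_apply, LinearMap.mulLeft_apply, sub_mul, map_sub,
      LinearMap.sub_apply, Module.End.mul_apply, mul_assoc, ℬ.counit_mul_src]

@[simp] theorem anchor_apply (X : ℬ.prim) (a : A) :
    (ℬ.anchor X : Module.End K A) a = ℬ.counit ((X : B) * src ℬ.η a) := rfl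

theorem src_sub_tgt_mem_prim (a : A) : src ℬ.η a - tgt ℬ.η (op a) ∈ ℬ.prim := by
  have h1 := ℬ.comul_src a 1
  have h2 := ℬ.comul_tgt a 1
  have h3 := tens_balanced ℬ.η a 1 1
  rw [mul_one, ℬ.comul_one, tensActL_tens, mul_one] at h1
  rw [mul_one, ℬ.comul_one, tensActR_tens, mul_one] at h2
  rw [mul_one, mul_one] at h3
  rw [mem_prim, map_sub, h1, h2]
  simp only [map_sub, LinearMap.sub_apply, h3]
  abel

/-- The subalgebra `⟨s - t⟩ = {s(a) - t(a) | a ∈ A}` of `Prim(B)`. -/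
def stSub : LieSubalgebra K ℬ.prim where
  carrier := {X | ∃ a : A, (X : B) = src ℬ.η a - tgt ℬ.η (op a)}
  add_mem' := by
    rintro X Y ⟨a, ha⟩ ⟨b, hb⟩
    refine ⟨a + b, ?_⟩
    change (X : B) + (Y : B) = _
    rw [ha, hb, map_add, op_add, map_add]
    abel
  zero_mem' := ⟨0, by simp⟩
  smul_mem' := by
    rintro c X ⟨a, ha⟩
    refine ⟨c • a, ?_⟩
    change c • (X : B) = _
    rw [ha, map_smul, op_smul, map_smul, smul_sub]
  lie_mem' := by
    rintro X Y ⟨a, ha⟩ ⟨b, hb⟩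
    refine ⟨a * b - b * a, ?_⟩
    rw [LieSubalgebra.coe_bracket, ha, hb, LieRing.of_associative_ring_bracket, op_sub, op_mul,
      op_mul, map_sub, map_sub, map_mul, map_mul, map_mul, map_mul]
    have h1 := src_mul_tgt ℬ.η a (op b)
    have h2 := src_mul_tgt ℬ.η b (op a)
    simp only [sub_mul, mul_sub, h1, h2]
    abel

/-- `B` as a left `Aᵉ`-module: `z • x = η(z) x`. -/
def AsModule (_ℬ : LeftBialgebroid K A B) : Type uB := B

instance : AddCommGroup ℬ.AsModule := inferInstanceAs (AddCommGroup B)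

/-- The element of `B` underlying an element of the `Aᵉ`-module `B`. -/
def toB (x : ℬ.AsModule) : B := x

instance : Module (Env K A) ℬ.AsModule where
  smul z x := (ℬ.η z * ℬ.toB x : B)
  one_smul x := by
    change ℬ.η 1 * ℬ.toB x = ℬ.toB x
    rw [map_one, one_mul]
  mul_smul z w x := by
    change ℬ.η (z * w) * ℬ.toB x = ℬ.η z * (ℬ.η w * ℬ.toB x)
    rw [map_mul, mul_assoc]
  smul_zero z := mul_zero (ℬ.η z)
  smul_add z x y := mul_add (ℬ.η z) (ℬ.toB x) (ℬ.toB y)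
  add_smul z w x := by
    change ℬ.η (z + w) * ℬ.toB x = ℬ.η z * ℬ.toB x + ℬ.η w * ℬ.toB x
    rw [map_add, add_mul]
  zero_smul x := by
    change ℬ.η 0 * ℬ.toB x = 0
    rw [map_zero, zero_mul]

theorem toB_smul (z : Env K A) (x : ℬ.AsModule) : ℬ.toB (z • x) = ℬ.η z * ℬ.toB x := rfl

/-- The left `Aᵉ`-submodule `Aᵉ · S` of `B` generated by a set `S` of primitive elements. -/
def envSpan (S : Set ℬ.prim) : Submodule (Env K A) ℬ.AsModule :=
  Submodule.span (Env K A) {x : ℬ.AsModule | ∃ X ∈ S, ℬ.toB x = (X : B)}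

/-- The image in `B` of `Aᵉ ⊗ Prim(B) ⊗ Aᵉ` under `p ⊗ X ⊗ q ↦ η(p) X η(q)`. -/
def primPart : Submodule K B :=
  Submodule.span K {z | ∃ (p q : Env K A) (X : ℬ.prim), z = ℬ.η p * (X : B) * ℬ.η q}

/-- The image in `B` of the degree `k` component of the tensor `Aᵉ`-ring of the `Aᵉ`-bimodule
`M = Aᵉ ⊗ Prim(B) ⊗ Aᵉ`: it is `η(Aᵉ)` for `k = 0`, and for `k ≥ 1` it is spanned by the products
of `k` elements of the image of `M`. -/
def primDeg : ℕ → Submodule K B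
  | 0 => Subalgebra.toSubmodule ℬ.η.range
  | k + 1 => ℬ.primPart ^ (k + 1)

theorem eta_mul_primPart (z : Env K A) {x : B} (hx : x ∈ ℬ.primPart) :
    ℬ.η z * x ∈ ℬ.primPart := by
  have h : ℬ.primPart ≤ ℬ.primPart.comap (LinearMap.mulLeft K (ℬ.η z)) := by
    conv_lhs => rw [primPart]
    rw [Submodule.span_le]
    rintro _ ⟨p, q, X, rfl⟩
    refine Submodule.subset_span ⟨z * p, q, X, ?_⟩
    simp [mul_assoc]
  exact h hx

theorem eta_mul_primDeg (z : Env K A) (k : ℕ) {x : B} (hx : x ∈ ℬ.primDeg k) :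
    ℬ.η z * x ∈ ℬ.primDeg k := by
  cases k with
  | zero => exact ℬ.η.range.mul_mem (AlgHom.mem_range_self ℬ.η z) hx
  | succ k =>
    rw [primDeg, pow_succ'] at hx ⊢
    refine Submodule.mul_induction_on hx (fun m hm n hn => ?_) (fun x y hx hy => ?_)
    · rw [← mul_assoc]
      exact Submodule.mul_mem_mul (ℬ.eta_mul_primPart z hm) hn
    · rw [mul_add]
      exact add_mem hx hy

/-- The `n`-th term `F_n(B)` of the primitive filtration, as a left `Aᵉ`-module. -/
def primFilt (n : ℕ) : Submodule (Env K A) ℬ.AsModule where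
  carrier := {x | ℬ.toB x ∈ ⨆ k : Fin (n + 1), ℬ.primDeg k}
  add_mem' := fun hx hy => (⨆ k : Fin (n + 1), ℬ.primDeg k).add_mem hx hy
  zero_mem' := (⨆ k : Fin (n + 1), ℬ.primDeg k).zero_mem
  smul_mem' := by
    intro z x hx
    have h : (⨆ k : Fin (n + 1), ℬ.primDeg k) ≤
        (⨆ k : Fin (n + 1), ℬ.primDeg k).comap (LinearMap.mulLeft K (ℬ.η z)) := by
      refine iSup_le fun k x hx => ?_
      exact Submodule.mem_iSup_of_mem k (ℬ.eta_mul_primDeg z k hx)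
    exact h hx

/-- `F_{n-1}(B)`, where `F_{-1}(B) = 0`. -/
def primFiltPred : ℕ → Submodule (Env K A) ℬ.AsModule
  | 0 => ⊥
  | n + 1 => ℬ.primFilt n

/-- The graded component `gr_n(B) = F_n(B) / F_{n-1}(B)`, a left `Aᵉ`-module. -/
abbrev gr (n : ℕ) : Type uB :=
  ℬ.primFilt n ⧸ (ℬ.primFiltPred n).comap (ℬ.primFilt n).subtype

/-- `B` is primitively generated: `B = ⋃ F_n(B)`. -/
def PrimitivelyGenerated : Prop :=
  ∀ x : ℬ.AsModule, ∃ n : ℕ, x ∈ ℬ.primFilt n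

/-- Every `gr_n(B)` is a projective left `Aᵉ`-module. -/
def GradedProjective : Prop :=
  ∀ n : ℕ, Module.Projective (Env K A) (ℬ.gr n)

/-- The four Milnor–Moore type conditions on a subalgebra `L` of `Prim(B)`. -/
structure MilnorMoore (L : LieSubalgebra K ℬ.prim) : Prop where
  /-- `Prim(B) ≅ L ⋉_δ ⟨s - t⟩` as `A`-anchored Lie algebras, through the vector space sum. -/
  cm1 : ∃ (δ : L →ₗ⁅K⁆ LieDerivation K ℬ.stSub ℬ.stSub)
    (hδ : AnchorCompatible (ℬ.anchor.comp ℬ.stSub.incl) (ℬ.anchor.comp L.incl) δ)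
    (e : LieAlgebra.SemiDirectSum ℬ.stSub L δ ≃ₗ⁅K⁆ ℬ.prim),
    (∀ z, ℬ.anchor (e z) = semidirectAnchor _ _ δ hδ z) ∧
      ∀ z, e z = (z.right : ℬ.prim) + (z.left : ℬ.prim)
  /-- `B` is graded projective and primitively generated. -/
  cm2 : ℬ.GradedProjective ∧ ℬ.PrimitivelyGenerated
  /-- `Aᵉ · L` is zero and `η` is injective, or it is nonzero and free over `Aᵉ` on a `K`-basis
  of `L`. -/
  cm3 : (ℬ.envSpan L = ⊥ ∧ Function.Injective ℬ.η) ∨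
    (ℬ.envSpan L ≠ ⊥ ∧ ∃ (ι : Type uB) (b : Module.Basis ι K L)
      (c : Module.Basis ι (Env K A) (ℬ.envSpan L)),
      ∀ i, ℬ.toB (c i : ℬ.AsModule) = ((b i : ℬ.prim) : B))
  /-- `Aᵉ · ⟨s - t⟩ ∩ Aᵉ · L = 0`. -/
  cm4 : ℬ.envSpan ℬ.stSub ⊓ ℬ.envSpan L = ⊥

end LeftBialgebroid

end

end ConnesMoscovici

open ConnesMoscovici

/-! This is a Milnor–Moore theorem over a noncommutative base. Characteristic 0 enters through
powers: in an algebra, products of elements of a commutator-closed subspace `H` are combinations of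
powers `x ^ m` of single elements of `H` (`mul_pow_mem_powSpan`). On powers of a primitive element
`Δ` is the binomial formula, so most identities only have to be checked on `η(z) X ^ m`.

From the conditions to the isomorphism: the map `L → Prim(B)` extends to a bialgebroid morphism
`ofCM` from `A ⊙ U(L) ⊙ A` to `B`. It is onto because `Prim(B) = L + ⟨s - t⟩`, the elements `s(a) -
t(a)` lie in `η(Aᵉ)`, and primitives commute with `η(Aᵉ)` up to `η(Aᵉ)`; hence the primitive
filtration is spanned by the `η(z) X ^ m` (`iSup_primDeg_eq_powFilt`). For injectivity, freeness of
`Aᵉ · L`, (CM4) and projectivity of the graded pieces extend the coordinates on `L` to `Aᵉ`-linear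
maps `B → Aᵉ` (`MilnorMoore.exists_functionals`). Following them by the multiplication `Aᵉ → A`
gives functionals `pᵢ`, and `∂ᵢ = (id ⊗ pᵢ) Δ` behaves like a partial derivative: it lowers degree,
is natural, and satisfies Euler's identity `∑ ∂ᵢ(x) Xᵢ ≡ n x` modulo lower degree
(`euler_mem_powFilt`). A kernel element is then killed by induction on its degree
(`Hom.eq_zero_of_map_eq_zero`).

From the isomorphism to the conditions: `A ⊙ U(L) ⊙ A` is `Aᵉ ⊗ U(L)` as a left `Aᵉ`-module, which
gives freeness, (CM4) and graded projectivity once `L → U(L)` is known to be injective. For `A ≠ 0`,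
a functional `φ` on `A` with `φ(1) = 1` contracts the inner factors of `B ⊗_A B`, so that the
primitive elements are determined by those of `U(L)` (`CM.exists_eq_add_of_mem_prim`).

Both facts on `U(L)`, namely that its primitive elements come from `L` and that `L` embeds
(`ι_injective`), come from the Adams operation `u ↦ ∑ u₁ u₂`, which multiplies `X ^ m` by `2 ^ m`.
No ordered Poincaré–Birkhoff–Witt basis is needed. -/

namespace ConnesMoscovici

/-! ### Symmetrisation: products are combinations of powers. -/

section Powers

variable {K : Type*} {R : Type*} [Field K] [Ring R] [Algebra K R]

/-- The span of the powers `x ^ m`, `m ≤ n`, of the elements of a subspace `H` of an algebra. -/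
def powSpan (H : Submodule K R) (n : ℕ) : Submodule K R :=
  Submodule.span K {z | ∃ x ∈ H, ∃ m ≤ n, z = x ^ m}

theorem pow_mem_powSpan {H : Submodule K R} {x : R} (hx : x ∈ H) {m n : ℕ} (h : m ≤ n) :
    x ^ m ∈ powSpan H n :=
  Submodule.subset_span ⟨x, hx, m, h, rfl⟩

theorem powSpan_mono (H : Submodule K R) {m n : ℕ} (h : m ≤ n) : powSpan H m ≤ powSpan H n := by
  refine Submodule.span_mono ?_
  rintro _ ⟨x, hx, k, hk, rfl⟩
  exact ⟨x, hx, k, hk.trans h, rfl⟩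

/-- The derivative at `s = 0` of `(x + s y) ^ m`. -/
def polar (x y : R) : ℕ → R
  | 0 => 0
  | m + 1 => x * polar x y m + y * x ^ m

theorem polar_one (x y : R) : polar x y 1 = y := by simp [polar]

/-- Only the coefficients of `1` and `s` matter later; the vanishing beyond `m` lets the sum be
lengthened in the induction. -/
theorem exists_pow_add_smul (x y : R) (m : ℕ) : ∃ c : ℕ → R, c 0 = x ^ m ∧ c 1 = polar x y m ∧
    (∀ k, m < k → c k = 0) ∧
    ∀ s : K, (x + s • y) ^ m = ∑ k ∈ Finset.range (m + 1), s ^ k • c k := by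
  induction m with
  | zero =>
    refine ⟨fun k => if k = 0 then 1 else 0, by simp, by simp [polar], ?_, by simp⟩
    intro k hk
    simp [hk.ne']
  | succ m ih =>
    obtain ⟨c, h0, h1, h2, h3⟩ := ih
    -- These are the coefficients of `(x + s y) ∑ s ^ k c k`; the factor `s` in front of `y` shifts
    -- the index by one.
    refine ⟨fun k => x * c k + (match k with | 0 => 0 | k + 1 => y * c k), ?_, ?_, ?_, ?_⟩
    · simp [h0, pow_succ']
    · simp [h0, h1, polar]
    · rintro (_ | k) hk
      · omega
      · simp [h2 k (by omega), h2 (k + 1) (by omega)]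
    · intro s
      rw [pow_succ', h3, add_mul]
      simp only [smul_add, Finset.sum_add_distrib]
      congr 1
      · rw [Finset.sum_range_succ _ (m + 1), h2 (m + 1) (by omega)]
        simp [Finset.mul_sum]
      · rw [Finset.sum_range_succ' _ (m + 1)]
        simp [Finset.mul_sum, smul_smul, pow_succ]

/-- Modulo `W`, every linear functional turns the sum into a polynomial in `s` that vanishes on the
infinite field `K`, so all its coefficients are zero. -/
theorem mem_of_forall_sum_pow_smul_mem [Infinite K] {V : Type*} [AddCommGroup V] [Module K V]
    (W : Submodule K V) (n : ℕ) (c : ℕ → V)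
    (h : ∀ s : K, ∑ k ∈ Finset.range n, s ^ k • c k ∈ W) {k : ℕ} (hk : k < n) : c k ∈ W := by
  rw [← Submodule.Quotient.mk_eq_zero, ← Module.forall_dual_apply_eq_zero_iff K]
  intro f
  let p : Polynomial K := ∑ k ∈ Finset.range n, Polynomial.C (f (W.mkQ (c k))) * Polynomial.X ^ k
  have hp : p = 0 := by
    apply Polynomial.funext
    intro s
    have := congrArg f ((Submodule.Quotient.mk_eq_zero W).2 (h s))
    rw [← Submodule.mkQ_apply] at this
    rw [map_sum, map_sum] at this
    simp only [map_smul, smul_eq_mul] at this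
    simp only [p, Polynomial.eval_finsetSum, Polynomial.eval_mul, Polynomial.eval_C,
      Polynomial.eval_pow, Polynomial.eval_X, Polynomial.eval_zero]
    rw [map_zero] at this
    rw [← this]
    exact Finset.sum_congr rfl fun i _ => mul_comm _ _
  have := congrArg (fun q => Polynomial.coeff q k) hp
  simpa [p, Polynomial.finsetSum_coeff, Polynomial.coeff_C_mul, Polynomial.coeff_X_pow, hk]
    using this

theorem polar_mem [Infinite K] (W : Submodule K R) (x y : R) (m : ℕ)
    (h : ∀ s : K, (x + s • y) ^ m ∈ W) : polar x y m ∈ W := by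
  obtain ⟨c, h0, h1, h2, h3⟩ := exists_pow_add_smul (K := K) x y m
  rw [← h1]
  rcases Nat.eq_zero_or_pos m with rfl | hm
  · rw [h2 1 one_pos]
    exact W.zero_mem
  · exact mem_of_forall_sum_pow_smul_mem W (m + 1) c (fun s => h3 s ▸ h s) (by omega)

variable [CharZero K] {H : Submodule K R} (hH : ∀ x ∈ H, ∀ y ∈ H, x * y - y * x ∈ H)
include hH

/-- The derivative `polar x y (n + 1)` is the sum of all words with one `y` and `n` letters `x`. It
is a combination of powers by polarisation, and moving each `y` to the front changes it only by
commutators of smaller degree, so it is `(n + 1) y x ^ n` up to lower terms. -/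
theorem mul_pow_mem_powSpan (n : ℕ) :
    ∀ x ∈ H, ∀ y ∈ H, y * x ^ n ∈ powSpan H (n + 1) := by
  induction n using Nat.strong_induction_on with
  | _ n ih =>
    have ih' : ∀ k < n, ∀ y ∈ H, ∀ w ∈ powSpan H k, y * w ∈ powSpan H (k + 1) := by
      intro k hk y hy w hw
      have : powSpan H k ≤ (powSpan H (k + 1)).comap (LinearMap.mulLeft K y) := by
        conv_lhs => rw [powSpan]
        rw [Submodule.span_le]
        rintro _ ⟨x, hx, m, hm, rfl⟩
        exact powSpan_mono H (by omega) (ih m (by omega) x hx y hy)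
      exact this hw
    intro x hx y hy
    -- Each induction step moves one `x` past `y`; the commutator lies in `H`, so its product with
    -- `x ^ i` is controlled by the outer induction.
    have key : ∀ i ≤ n, polar x y (i + 1) - ((i + 1 : ℕ) : K) • (y * x ^ i) ∈ powSpan H i := by
      intro i
      induction i with
      | zero => intro _; simp [polar]
      | succ i IH =>
        intro hi
        have h1 := ih' i (by omega) x hx _ (IH (by omega))
        have h2 := ih' i (by omega) _ (hH x hx y hy) _ (pow_mem_powSpan hx (le_refl i))
        have h3 := add_mem h1 (Submodule.smul_mem _ ((i + 1 : ℕ) : K) h2)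
        convert h3 using 1
        rw [polar]
        simp only [mul_sub, sub_mul, mul_smul_comm, smul_sub, pow_succ', Nat.cast_add, Nat.cast_one,
          add_smul, one_smul, mul_assoc, mul_add]
        abel
    have h1 : polar x y (n + 1) ∈ powSpan H (n + 1) :=
      polar_mem _ x y _ fun s => pow_mem_powSpan (H.add_mem hx (H.smul_mem s hy)) le_rfl
    -- It remains to divide by `n + 1`, which characteristic 0 allows.
    have h2 := (Submodule.sub_mem_iff_right _ h1).1 (powSpan_mono H n.le_succ (key n le_rfl))
    rwa [Submodule.smul_mem_iff _ (by exact_mod_cast n.succ_ne_zero)] at h2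

theorem mul_mem_powSpan_succ {n : ℕ} {y w : R} (hy : y ∈ H) (hw : w ∈ powSpan H n) :
    y * w ∈ powSpan H (n + 1) := by
  have : powSpan H n ≤ (powSpan H (n + 1)).comap (LinearMap.mulLeft K y) := by
    conv_lhs => rw [powSpan]
    rw [Submodule.span_le]
    rintro _ ⟨x, hx, m, hm, rfl⟩
    exact powSpan_mono H (by omega) (mul_pow_mem_powSpan hH m x hx y hy)
  exact this hw

theorem pow_mul_mem_powSpan {n : ℕ} {x w : R} (hx : x ∈ H) (hw : w ∈ powSpan H n) (m : ℕ) :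
    x ^ m * w ∈ powSpan H (n + m) := by
  induction m with
  | zero => simpa using hw
  | succ m ih =>
    rw [pow_succ', mul_assoc]
    exact mul_mem_powSpan_succ hH hx ih

theorem mul_mem_powSpan_add {m n : ℕ} {v w : R} (hv : v ∈ powSpan H m) (hw : w ∈ powSpan H n) :
    v * w ∈ powSpan H (m + n) := by
  have : powSpan H m ≤ (powSpan H (m + n)).comap (LinearMap.mulRight K w) := by
    conv_lhs => rw [powSpan]
    rw [Submodule.span_le]
    rintro _ ⟨x, hx, k, hk, rfl⟩
    exact powSpan_mono H (by omega) (pow_mul_mem_powSpan hH hx hw k)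
  exact this hv

end Powers

end ConnesMoscovici

namespace ConnesMoscovici

noncomputable section

/-! ### Separating eigenvalues that are powers of two. -/

section Eigen

variable {K : Type*} [Field K] {V : Type*} [AddCommGroup V] [Module K V]

theorem aeval_apply_of_eq_smul {ψ : Module.End K V} {v : V} {μ : K} (h : ψ v = μ • v)
    (q : Polynomial K) : Polynomial.aeval ψ q v = q.eval μ • v := by
  induction q using Polynomial.induction_on' with
  | add p q hp hq => simp [hp, hq, add_smul]
  | monomial n a =>
    have : ∀ n, (ψ ^ n) v = μ ^ n • v := by
      intro n
      induction n with
      | zero => simp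
      | succ n ih => rw [pow_succ, Module.End.mul_apply, h, map_smul, ih, smul_smul, pow_succ']
    rw [Polynomial.aeval_monomial, Polynomial.eval_monomial, Module.End.mul_apply, this,
      Module.algebraMap_end_apply, smul_smul]

/-- An eigenvector of eigenvalue `2` in a span of eigenvectors of eigenvalues `2 ^ m` lies in the
span of those with `m = 1`. -/
theorem mem_of_eigen_two [CharZero K] {M : Type*} [AddCommGroup M] [Module K M] (ψ : Module.End K V)
    (f : M →ₗ[K] V) (S : Set M) (n : ℕ) (E : Submodule K V)
    (hS : ∀ z ∈ S, ∃ m ≤ n, ψ (f z) = (2 ^ m : K) • f z ∧ (m = 1 → f z ∈ E))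
    {z : M} (hz : z ∈ Submodule.span K S) (h2 : ψ (f z) = (2 : K) • f z) : f z ∈ E := by
  -- The operator `q(ψ)` kills the eigenvalues `2 ^ m` with `m ≠ 1` and multiplies the given vector
  -- by `q(2)`, nonzero because the powers of `2` are distinct in characteristic 0.
  let q : Polynomial K := ∏ m ∈ (Finset.range (n + 1)).erase 1,
    (Polynomial.X - Polynomial.C ((2 : K) ^ m))
  have hq : q.eval 2 ≠ 0 := by
    rw [Polynomial.eval_prod, Finset.prod_ne_zero_iff]
    intro m hm
    have hm1 : m ≠ 1 := (Finset.mem_erase.1 hm).1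
    simp only [Polynomial.eval_sub, Polynomial.eval_X, Polynomial.eval_C, sub_ne_zero]
    intro h
    have h' : ((2 ^ 1 : ℕ) : K) = ((2 ^ m : ℕ) : K) := by push_cast; simpa using h
    exact hm1 (Nat.pow_right_injective le_rfl (Nat.cast_injective h')).symm
  have hle : Submodule.span K S ≤ E.comap ((Polynomial.aeval ψ q).comp f) := by
    rw [Submodule.span_le]
    intro w hw
    obtain ⟨m, hm, h1, h2⟩ := hS w hw
    change Polynomial.aeval ψ q (f w) ∈ E
    rw [aeval_apply_of_eq_smul h1]
    by_cases hm1 : m = 1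
    · exact E.smul_mem _ (h2 hm1)
    · have : q.eval ((2 : K) ^ m) = 0 := by
        rw [Polynomial.eval_prod]
        refine Finset.prod_eq_zero (i := m) (by simp [hm1]; omega) (by simp)
      rw [this, zero_smul]
      exact E.zero_mem
  have h := hle hz
  change Polynomial.aeval ψ q (f z) ∈ E at h
  rw [aeval_apply_of_eq_smul h2] at h
  exact (Submodule.smul_mem_iff E hq).1 h

end Eigen

/-! ### Adams operation and primitive elements of the enveloping algebra. -/

section Enveloping

open UniversalEnvelopingAlgebra (ι)

variable (K : Type uK) {L : Type uL} [Field K] [LieRing L] [LieAlgebra K L]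

/-- The image of `L` in `U(L)`. -/
def ιRange (L : Type uL) [LieRing L] [LieAlgebra K L] :
    Submodule K (UniversalEnvelopingAlgebra K L) :=
  LinearMap.range (ι K : L →ₗ⁅K⁆ UniversalEnvelopingAlgebra K L).toLinearMap

variable {K}

theorem ι_mem_ιRange (X : L) : ι K X ∈ ιRange K L := ⟨X, rfl⟩

theorem ιRange_commutator : ∀ x ∈ ιRange K L, ∀ y ∈ ιRange K L, x * y - y * x ∈ ιRange K L := by
  rintro _ ⟨X, rfl⟩ _ ⟨Y, rfl⟩
  refine ⟨⁅X, Y⁆, ?_⟩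
  exact LieHom.map_lie (ι K : L →ₗ⁅K⁆ UniversalEnvelopingAlgebra K L) X Y

/-- The spanning half of Poincaré–Birkhoff–Witt in symmetrised form: the union of the `powSpan` is
closed under products and contains `L`. -/
theorem exists_mem_powSpan_ιRange [CharZero K] (u : UniversalEnvelopingAlgebra K L) :
    ∃ n, u ∈ powSpan (ιRange K L) n := by
  refine U_induction K (p := fun u => ∃ n, u ∈ powSpan (ιRange K L) n) ?_ ?_ ?_ ?_ u
  · intro c
    refine ⟨0, ?_⟩
    rw [Algebra.algebraMap_eq_smul_one]
    exact Submodule.smul_mem _ _ (pow_mem_powSpan (ιRange K L).zero_mem (m := 0) le_rfl)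
  · intro X
    refine ⟨1, ?_⟩
    simpa using pow_mem_powSpan (ι_mem_ιRange (K := K) X) (le_refl 1)
  · rintro u v ⟨m, hu⟩ ⟨n, hv⟩
    exact ⟨max m n, add_mem (powSpan_mono _ (le_max_left _ _) hu)
      (powSpan_mono _ (le_max_right _ _) hv)⟩
  · rintro u v ⟨m, hu⟩ ⟨n, hv⟩
    exact ⟨m + n, mul_mem_powSpan_add ιRange_commutator hu hv⟩

variable (K L) in
/-- The second Adams operation `u ↦ ∑ u₁ u₂` of `U(L)`. -/
def adamsTwo : Module.End K (UniversalEnvelopingAlgebra K L) :=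
  (LinearMap.mul' K _).comp (comulU K L).toLinearMap

/-- `X ⊗ 1` and `1 ⊗ X` commute, so the binomial theorem applies; after multiplying the two factors,
the binomial coefficients add up to `2 ^ m`. -/
theorem adamsTwo_pow (X : L) (m : ℕ) :
    adamsTwo K L (ι K X ^ m) = (2 ^ m : K) • ι K X ^ m := by
  have hc : Commute (ι K X ⊗ₜ[K] (1 : UniversalEnvelopingAlgebra K L))
      ((1 : UniversalEnvelopingAlgebra K L) ⊗ₜ[K] ι K X) := by
    simp [commute_iff_eq]
  rw [adamsTwo, LinearMap.comp_apply, AlgHom.toLinearMap_apply, map_pow, comulU_ι, hc.add_pow,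
    map_sum]
  have : ∀ k ∈ Finset.range (m + 1), LinearMap.mul' K (UniversalEnvelopingAlgebra K L)
      ((ι K X ⊗ₜ[K] (1 : UniversalEnvelopingAlgebra K L)) ^ k *
        ((1 : UniversalEnvelopingAlgebra K L) ⊗ₜ[K] ι K X) ^ (m - k) *
        (m.choose k : UniversalEnvelopingAlgebra K L ⊗[K] UniversalEnvelopingAlgebra K L)) =
      ((m.choose k : ℕ) : K) • ι K X ^ m := by
    intro k hk
    have hk' : k + (m - k) = m := by simp at hk; omega
    rw [Algebra.TensorProduct.tmul_pow, Algebra.TensorProduct.tmul_pow,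
      Algebra.TensorProduct.tmul_mul_tmul, one_pow, one_pow, mul_one, one_mul,
      ← nsmul_eq_mul', map_nsmul, LinearMap.mul'_apply, ← pow_add, hk', Nat.cast_smul_eq_nsmul]
  rw [Finset.sum_congr rfl this, ← Finset.sum_smul, ← Nat.cast_sum, Nat.sum_range_choose]
  simp

theorem adamsTwo_ι (X : L) : adamsTwo K L (ι K X) = (2 : K) • ι K X := by
  simpa using adamsTwo_pow (K := K) X 1

/-- A primitive element has Adams eigenvalue `2`, whereas the spanning powers `X ^ m` have
eigenvalue `2 ^ m`; only `m = 1` can contribute. -/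
theorem mem_ιRange_of_primitive [CharZero K] {u : UniversalEnvelopingAlgebra K L}
    (h : comulU K L u = u ⊗ₜ 1 + 1 ⊗ₜ u) : u ∈ ιRange K L := by
  obtain ⟨n, hn⟩ := exists_mem_powSpan_ιRange u
  refine mem_of_eigen_two (adamsTwo K L) LinearMap.id _ n (ιRange K L) ?_ hn ?_
  · rintro _ ⟨_, ⟨X, rfl⟩, m, hm, rfl⟩
    refine ⟨m, hm, adamsTwo_pow X m, ?_⟩
    rintro rfl
    simpa using ι_mem_ιRange X
  · simp [adamsTwo, h, two_smul]

/-! ### Ideals of the enveloping algebra seen through dual numbers. -/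

/-- The subspace `{x + ε n | x ∈ 𝔤, n ∈ N}` of the dual numbers over `U(𝔤)`. -/
def dualRange (N : LieIdeal K L) :
    Submodule K (TrivSqZeroExt (UniversalEnvelopingAlgebra K L) (UniversalEnvelopingAlgebra K L)) where
  carrier := {z | ∃ X : L, ∃ Y ∈ N, z = TrivSqZeroExt.inl (ι K X) + TrivSqZeroExt.inr (ι K Y)}
  add_mem' := by
    rintro _ _ ⟨X, Y, hY, rfl⟩ ⟨X', Y', hY', rfl⟩
    refine ⟨X + X', Y + Y', add_mem hY hY', ?_⟩
    simp only [map_add, TrivSqZeroExt.inl_add, TrivSqZeroExt.inr_add]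
    abel
  zero_mem' := ⟨0, 0, N.zero_mem, by simp⟩
  smul_mem' := by
    rintro c _ ⟨X, Y, hY, rfl⟩
    refine ⟨c • X, c • Y, N.smul_mem c hY, ?_⟩
    simp

/-- True because `N` is an ideal and `ε ^ 2 = 0`. It makes the symmetrisation results available in
the dual numbers. -/
theorem dualRange_commutator (N : LieIdeal K L) :
    ∀ x ∈ dualRange N, ∀ y ∈ dualRange N, x * y - y * x ∈ dualRange N := by
  rintro _ ⟨X, Y, hY, rfl⟩ _ ⟨X', Y', hY', rfl⟩
  refine ⟨⁅X, X'⁆, ⁅X, Y'⁆ + ⁅Y, X'⁆,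
    add_mem (lie_mem_right K L N X Y' hY') (lie_mem_left K L N Y X' hY), ?_⟩
  ext
  · simp [-UniversalEnvelopingAlgebra.ι_apply, LieRing.of_associative_ring_bracket]
  · simp [-UniversalEnvelopingAlgebra.ι_apply, LieRing.of_associative_ring_bracket]
    abel

/-- The `u ∈ U(𝔤)` such that `ε u` lies in the subalgebra generated by `𝔤 + ε N`. -/
def dualIdeal (N : LieIdeal K L) [CharZero K] : Submodule K (UniversalEnvelopingAlgebra K L) where
  carrier := {u | ∃ n, TrivSqZeroExt.inr u ∈ powSpan (dualRange N) n}
  add_mem' := by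
    rintro u v ⟨m, hu⟩ ⟨n, hv⟩
    refine ⟨max m n, ?_⟩
    rw [TrivSqZeroExt.inr_add]
    exact add_mem (powSpan_mono _ (le_max_left _ _) hu) (powSpan_mono _ (le_max_right _ _) hv)
  zero_mem' := ⟨0, by simp⟩
  smul_mem' := by
    rintro c u ⟨n, hu⟩
    refine ⟨n, ?_⟩
    rw [TrivSqZeroExt.inr_smul]
    exact Submodule.smul_mem _ _ hu

variable [CharZero K] (N : LieIdeal K L)

/-- Multiplication by `X + ε 0`, an element of `dualRange N`, sends `ε u` to `ε (X u)` and raises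
the degree by at most one. -/
theorem ι_mul_mem_dualIdeal (X : L) {u : UniversalEnvelopingAlgebra K L} (hu : u ∈ dualIdeal N) :
    ι K X * u ∈ dualIdeal N := by
  obtain ⟨n, hu⟩ := hu
  refine ⟨n + 1, ?_⟩
  have h : TrivSqZeroExt.inl (ι K X) ∈ dualRange N := ⟨X, 0, N.zero_mem, by simp⟩
  have := mul_mem_powSpan_succ (dualRange_commutator N) h hu
  rwa [TrivSqZeroExt.inl_mul_inr] at this

/-- The product `(ε Y) u` is `ε (Y u)`, and `u`, viewed without `ε`, is already a combination of
powers of elements of `𝔤`. -/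
theorem ι_mul_mem_dualIdeal_of_mem {Y : L} (hY : Y ∈ N) (u : UniversalEnvelopingAlgebra K L) :
    ι K Y * u ∈ dualIdeal N := by
  obtain ⟨n, hu⟩ := exists_mem_powSpan_ιRange u
  refine ⟨n + 1, ?_⟩
  have h : TrivSqZeroExt.inr (ι K Y) ∈ dualRange N := ⟨0, Y, hY, by simp⟩
  have hu' : TrivSqZeroExt.inl u ∈ powSpan (dualRange N) n := by
    have : powSpan (ιRange K L) n ≤
        (powSpan (dualRange N) n).comap (TrivSqZeroExt.inlAlgHom K _ _).toLinearMap := by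
      conv_lhs => rw [powSpan]
      rw [Submodule.span_le]
      rintro _ ⟨_, ⟨X, rfl⟩, m, hm, rfl⟩
      change TrivSqZeroExt.inlAlgHom K _ _ (ι K X ^ m) ∈ powSpan (dualRange N) n
      rw [map_pow]
      have h : TrivSqZeroExt.inlAlgHom K _ _ (ι K X) ∈ dualRange N :=
        ⟨X, 0, N.zero_mem, by simp [TrivSqZeroExt.inlAlgHom]⟩
      exact pow_mem_powSpan h hm
    exact this hu
  have := mul_mem_powSpan_succ (dualRange_commutator N) h hu'
  rwa [TrivSqZeroExt.inr_mul_inl] at this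

theorem snd_pow_eq_polar {R : Type*} [Ring R] (x y : R) (m : ℕ) :
    ((TrivSqZeroExt.inl x + TrivSqZeroExt.inr y : TrivSqZeroExt R R) ^ m).snd = polar x y m ∧
    ((TrivSqZeroExt.inl x + TrivSqZeroExt.inr y : TrivSqZeroExt R R) ^ m).fst = x ^ m := by
  induction m with
  | zero => simp [polar]
  | succ m ih =>
    rw [pow_succ', TrivSqZeroExt.snd_mul, TrivSqZeroExt.fst_mul, ih.1, ih.2]
    simp [polar, pow_succ']

/-- Differentiate the eigenvalue equation of `(X + s Y) ^ m` at `s = 0`: an eigenspace is a linear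
subspace, so `polar_mem` applies. -/
theorem adamsTwo_polar (X Y : L) (m : ℕ) :
    adamsTwo K L (polar (ι K X) (ι K Y) m) = (2 ^ m : K) • polar (ι K X) (ι K Y) m := by
  have := polar_mem (K := K) (LinearMap.eqLocus (adamsTwo K L) ((2 ^ m : K) • LinearMap.id))
    (ι K X) (ι K Y) m (fun s => by
      have := adamsTwo_pow (K := K) (X + s • Y) m
      simpa using this)
  simpa using this

/-- If `ι Z` vanishes modulo the ideal of `U(𝔤)` generated by `N`, then `Z ∈ N` modulo the kernel
of `ι`. -/
theorem exists_mem_of_ι_mem_dualIdeal {Z : L} (hZ : ι K Z ∈ dualIdeal N) :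
    ∃ Y ∈ N, ι K Z = ι K Y := by
  obtain ⟨n, hn⟩ := hZ
  -- The `ε`-part of `(x + ε n) ^ m` is a derivative of a power, of eigenvalue `2 ^ m`, and `ι Z`
  -- has eigenvalue `2`. The surviving case `m = 1` has `ε`-part `ι n` with `n ∈ N`.
  have := mem_of_eigen_two (adamsTwo K L)
    (TrivSqZeroExt.sndHom (UniversalEnvelopingAlgebra K L) (UniversalEnvelopingAlgebra K L) |>.restrictScalars K) _ n
    (N.toSubmodule.map (ι K : L →ₗ⁅K⁆ UniversalEnvelopingAlgebra K L).toLinearMap) ?_ hn ?_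
  · obtain ⟨Y, hY, h⟩ := this
    exact ⟨Y, hY, h.symm⟩
  · rintro _ ⟨_, ⟨X, Y, hY, rfl⟩, m, hm, rfl⟩
    refine ⟨m, hm, ?_⟩
    have h : ((TrivSqZeroExt.sndHom (UniversalEnvelopingAlgebra K L)
        (UniversalEnvelopingAlgebra K L)).restrictScalars K)
        ((TrivSqZeroExt.inl (ι K X) + TrivSqZeroExt.inr (ι K Y)) ^ m) =
        polar (ι K X) (ι K Y) m := (snd_pow_eq_polar _ _ _).1
    rw [h]
    refine ⟨adamsTwo_polar X Y m, ?_⟩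
    rintro rfl
    rw [polar_one]
    exact ⟨Y, hY, rfl⟩
  · exact adamsTwo_ι Z

end Enveloping
end
end ConnesMoscovici

namespace ConnesMoscovici

noncomputable section

/-! ### Injectivity of a Lie algebra into its enveloping algebra. -/

section Faithful

open UniversalEnvelopingAlgebra (ι)

variable {K : Type uK} [Field K]

/-- The representation `x · (y, c) = ([x, y] + c D x, 0)` of `𝔤` on `𝔤 × K` attached to a
derivation `D`. -/
def derivationRep {𝔤 : Type*} [LieRing 𝔤] [LieAlgebra K 𝔤] (D : 𝔤 →ₗ[K] 𝔤)
    (hD : ∀ x y, D ⁅x, y⁆ = ⁅D x, y⁆ + ⁅x, D y⁆) : 𝔤 →ₗ⁅K⁆ Module.End K (𝔤 × K) where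
  toFun x := LinearMap.inl K 𝔤 K ∘ₗ LinearMap.coprod (LieModule.toEnd K 𝔤 𝔤 x)
    (LinearMap.toSpanSingleton K 𝔤 (D x))
  map_add' x y := by ext <;> simp
  map_smul' c x := by ext <;> simp
  map_lie' := by
    intro x y
    apply LinearMap.ext
    rintro ⟨z, c⟩
    ext
    · simp only [LinearMap.comp_apply, LinearMap.coprod_apply, LinearMap.inl_apply,
        LieModule.toEnd_apply_apply, LinearMap.toSpanSingleton_apply, hD,
        LieRing.of_associative_ring_bracket, LinearMap.sub_apply, Module.End.mul_apply, zero_smul,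
        add_zero, lie_add, lie_smul, lie_lie, Prod.mk_sub_mk, smul_add]
      rw [← lie_skew (D x) y]
      simp only [smul_neg]
      abel
    · simp [LieRing.of_associative_ring_bracket]

/-- An element that vanishes in the enveloping algebra acts by zero in every representation; in
`derivationRep` it sends `(0, 1)` to `(D x, 0)`. -/
theorem derivation_eq_zero_of_ι_eq_zero {𝔤 : Type*} [LieRing 𝔤] [LieAlgebra K 𝔤] (D : 𝔤 →ₗ[K] 𝔤)
    (hD : ∀ x y, D ⁅x, y⁆ = ⁅D x, y⁆ + ⁅x, D y⁆) {x : 𝔤} (hx : ι K x = 0) : D x = 0 := by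
  have h : derivationRep D hD x = 0 := by
    rw [← UniversalEnvelopingAlgebra.lift_ι_apply K (derivationRep D hD) x, hx, map_zero]
  simpa [derivationRep] using LinearMap.congr_fun h (0, 1)

variable {L : Type uL} [LieRing L] [LieAlgebra K L]

/-- The Lie algebra `K[X] ⊗ L`. -/
def PolyLie (K : Type uK) [Field K] (L : Type uL) [LieRing L] [LieAlgebra K L] : Type (max uK uL) :=
  Polynomial K ⊗[K] L

instance : LieRing (PolyLie K L) := inferInstanceAs (LieRing (Polynomial K ⊗[K] L))

instance : LieAlgebra K (PolyLie K L) := inferInstanceAs (LieAlgebra K (Polynomial K ⊗[K] L))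

namespace PolyLie

/-- The pure tensors, as a bilinear map. -/
def mk (K : Type uK) [Field K] (L : Type uL) [LieRing L] [LieAlgebra K L] :
    Polynomial K →ₗ[K] L →ₗ[K] PolyLie K L :=
  TensorProduct.mk K (Polynomial K) L

theorem mk_lie_mk (p q : Polynomial K) (x y : L) :
    ⁅mk K L p x, mk K L q y⁆ = mk K L (p * q) ⁅x, y⁆ :=
  LieAlgebra.ExtendScalars.bracket_tmul K (Polynomial K) L L p q x y

theorem induction {p : PolyLie K L → Prop} (h0 : p 0) (hmk : ∀ q x, p (mk K L q x))
    (hadd : ∀ x y, p x → p y → p (x + y)) (x : PolyLie K L) : p x :=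
  TensorProduct.induction_on (motive := p) x h0 hmk hadd

theorem hom_ext {M : Type*} [AddCommGroup M] [Module K M] {f g : PolyLie K L →ₗ[K] M}
    (h : ∀ p x, f (mk K L p x) = g (mk K L p x)) : f = g :=
  TensorProduct.ext' h

end PolyLie

/-- The derivation `d/dX` of `K[X] ⊗ L`. -/
def polyDeriv (K : Type uK) [Field K] (L : Type uL) [LieRing L] [LieAlgebra K L] :
    PolyLie K L →ₗ[K] PolyLie K L :=
  LinearMap.rTensor L Polynomial.derivative

theorem polyDeriv_mk (p : Polynomial K) (x : L) :
    polyDeriv K L (PolyLie.mk K L p x) = PolyLie.mk K L (Polynomial.derivative p) x := rfl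

theorem polyDeriv_lie (x y : PolyLie K L) :
    polyDeriv K L ⁅x, y⁆ = ⁅polyDeriv K L x, y⁆ + ⁅x, polyDeriv K L y⁆ := by
  induction x using PolyLie.induction with
  | h0 => simp
  | hadd x x' hx hx' => simp only [add_lie, map_add, hx, hx']; abel
  | hmk p a =>
    induction y using PolyLie.induction with
    | h0 => simp
    | hadd y y' hy hy' => simp only [lie_add, map_add, hy, hy']; abel
    | hmk q b =>
      simp only [polyDeriv_mk, PolyLie.mk_lie_mk, Polynomial.derivative_mul, map_add,
        LinearMap.add_apply]

/-- Evaluation at `s`, as a linear map `K[X] ⊗ L → L`. -/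
def polyEval (L : Type uL) [LieRing L] [LieAlgebra K L] (s : K) : PolyLie K L →ₗ[K] L :=
  TensorProduct.lift (LinearMap.lsmul K L ∘ₗ (Polynomial.aeval s).toLinearMap)

theorem polyEval_mk (s : K) (p : Polynomial K) (x : L) :
    polyEval L s (PolyLie.mk K L p x) = p.eval s • x := by
  change Polynomial.aeval s p • x = _
  rw [Polynomial.coe_aeval_eq_eval]

theorem polyEval_lie (s : K) (x y : PolyLie K L) :
    polyEval L s ⁅x, y⁆ = ⁅polyEval L s x, polyEval L s y⁆ := by
  induction x using PolyLie.induction with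
  | h0 => simp
  | hadd x x' hx hx' => simp only [add_lie, map_add, hx, hx']
  | hmk p a =>
    induction y using PolyLie.induction with
    | h0 => simp
    | hadd y y' hy hy' => simp only [lie_add, map_add, hy, hy']
    | hmk q b => simp [polyEval_mk, PolyLie.mk_lie_mk, smul_smul, mul_comm]

/-- Integrate the derivative from `0` to `1`; the denominators of the integral require
characteristic 0. -/
theorem polyEval_eq_of_polyDeriv_eq_zero [CharZero K] {x : PolyLie K L}
    (hx : polyDeriv K L x = 0) : polyEval L (1 : K) x = polyEval L (0 : K) x := by
  -- This is the integral over `[0, 1]`: `X ^ n ↦ 1 / (n + 1)`.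
  let J : Polynomial K →ₗ[K] K := Polynomial.lsum fun n => ((n + 1 : K)⁻¹) • LinearMap.id
  have hJ : ∀ p : Polynomial K, J (Polynomial.derivative p) = p.eval 1 - p.eval 0 := by
    intro p
    induction p using Polynomial.induction_on' with
    | add p q hp hq => simp only [map_add, hp, hq, Polynomial.eval_add]; ring
    | monomial n a =>
      rw [Polynomial.derivative_monomial]
      rcases n with _ | n
      · simp
      · have : (n + 1 : K) ≠ 0 := by exact_mod_cast n.succ_ne_zero
        simp [J, Polynomial.lsum_apply, Polynomial.sum_monomial_index]
        field_simp
  let J' : PolyLie K L →ₗ[K] L := TensorProduct.lift (LinearMap.lsmul K L ∘ₗ J)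
  have h : J'.comp (polyDeriv K L) = polyEval L 1 - polyEval L 0 := by
    apply PolyLie.hom_ext
    intro p x
    have : J' (PolyLie.mk K L (Polynomial.derivative p) x) = J (Polynomial.derivative p) • x := rfl
    rw [LinearMap.comp_apply, polyDeriv_mk, this, hJ, LinearMap.sub_apply, polyEval_mk,
      polyEval_mk, sub_smul]
  have := LinearMap.congr_fun h x
  rw [LinearMap.comp_apply, hx, map_zero] at this
  exact sub_eq_zero.1 this.symm

/-- The ideal `X (X - 1) K[X] ⊗ L` of `K[X] ⊗ L`. -/
def evalIdeal (K : Type uK) [Field K] (L : Type uL) [LieRing L] [LieAlgebra K L] :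
    LieIdeal K (PolyLie K L) where
  __ := LinearMap.ker (polyEval L (0 : K)) ⊓ LinearMap.ker (polyEval L (1 : K))
  lie_mem := by
    rintro x y ⟨h0, h1⟩
    exact ⟨by simp_all [polyEval_lie], by simp_all [polyEval_lie]⟩

theorem mem_evalIdeal {x : PolyLie K L} :
    x ∈ evalIdeal K L ↔ polyEval L (0 : K) x = 0 ∧ polyEval L (1 : K) x = 0 := Iff.rfl

/-- The difference is `(X ^ 2 - X) ⊗ ⁅x, y⁆`. So `x ↦ X ⊗ x` is a Lie map modulo `evalIdeal`, which
is what makes `loopRep` a representation. -/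
theorem X_mk_lie (x y : L) : ⁅PolyLie.mk K L Polynomial.X x, PolyLie.mk K L Polynomial.X y⁆ -
    PolyLie.mk K L Polynomial.X ⁅x, y⁆ ∈ evalIdeal K L := by
  rw [mem_evalIdeal, PolyLie.mk_lie_mk]
  simp [polyEval_mk]

variable [CharZero K]

/-- The left action of `U(𝔤)` on its quotient by `dualIdeal N`. -/
def quotRep {𝔤 : Type*} [LieRing 𝔤] [LieAlgebra K 𝔤] (N : LieIdeal K 𝔤) (x : 𝔤) :
    Module.End K (UniversalEnvelopingAlgebra K 𝔤 ⧸ dualIdeal N) :=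
  (dualIdeal N).mapQ (dualIdeal N) (LinearMap.mulLeft K (ι K x))
    (fun _ hu => ι_mul_mem_dualIdeal N x hu)

theorem quotRep_mk {𝔤 : Type*} [LieRing 𝔤] [LieAlgebra K 𝔤] (N : LieIdeal K 𝔤) (x : 𝔤)
    (u : UniversalEnvelopingAlgebra K 𝔤) :
    quotRep N x ((dualIdeal N).mkQ u) = (dualIdeal N).mkQ (ι K x * u) := rfl

/-- The representation of `L` on a quotient of `U(K[X] ⊗ L)` in which `x` acts as `X ⊗ x`. -/
def loopRep (K : Type uK) [Field K] [CharZero K] (L : Type uL) [LieRing L] [LieAlgebra K L] :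
    L →ₗ⁅K⁆ Module.End K (UniversalEnvelopingAlgebra K (PolyLie K L) ⧸ dualIdeal (evalIdeal K L)) where
  toFun x := quotRep (evalIdeal K L) (PolyLie.mk K L Polynomial.X x)
  map_add' x y := by
    apply Submodule.linearMap_qext
    apply LinearMap.ext
    intro u
    simp only [LinearMap.comp_apply, LinearMap.add_apply, quotRep_mk, map_add, add_mul]
  map_smul' c x := by
    apply Submodule.linearMap_qext
    apply LinearMap.ext
    intro u
    simp only [LinearMap.comp_apply, LinearMap.smul_apply, quotRep_mk,
      map_smul, smul_mul_assoc, RingHom.id_apply]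
  map_lie' := by
    intro x y
    apply Submodule.linearMap_qext
    apply LinearMap.ext
    intro u
    simp only [LinearMap.comp_apply, quotRep_mk, LieRing.of_associative_ring_bracket,
      LinearMap.sub_apply, Module.End.mul_apply]
    rw [← map_sub, ← mul_assoc, ← mul_assoc, ← sub_mul, ← LieRing.of_associative_ring_bracket,
      ← LieHom.map_lie, eq_comm, ← sub_eq_zero, ← map_sub, ← sub_mul, ← map_sub,
      Submodule.mkQ_apply, Submodule.Quotient.mk_eq_zero]
    exact ι_mul_mem_dualIdeal_of_mem _ (X_mk_lie x y) u

/-- A Lie algebra over a field of characteristic `0` embeds into its enveloping algebra. -/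
theorem ι_injective : Function.Injective (ι K : L →ₗ⁅K⁆ UniversalEnvelopingAlgebra K L) := by
  rw [injective_iff_map_eq_zero]
  intro c hc
  have h : loopRep K L c = 0 := by
    rw [← UniversalEnvelopingAlgebra.lift_ι_apply K (loopRep K L) c, hc, map_zero]
  -- Since `ι c = 0`, the operator of `X ⊗ c` is zero; its value on the class of `1` puts `ι (X ⊗
  -- c)` in the ideal.
  have h1 : (dualIdeal (evalIdeal K L)).mkQ (ι K (PolyLie.mk K L Polynomial.X c) * 1) = 0 :=
    LinearMap.congr_fun h ((dualIdeal (evalIdeal K L)).mkQ 1)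
  rw [mul_one, Submodule.mkQ_apply, Submodule.Quotient.mk_eq_zero] at h1
  obtain ⟨Y, hY, hZ⟩ := exists_mem_of_ι_mem_dualIdeal _ h1
  have h2 : ι K (PolyLie.mk K L Polynomial.X c - Y) = 0 := by rw [map_sub, hZ, sub_self]
  -- `X ⊗ c - Y` is in the kernel of `ι`, hence killed by `d/dX`, hence has equal values at `0` and
  -- `1`. As `Y` vanishes at both points, these values are `0` and `c`.
  have h3 := polyEval_eq_of_polyDeriv_eq_zero
    (derivation_eq_zero_of_ι_eq_zero (polyDeriv K L) polyDeriv_lie h2)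
  rw [mem_evalIdeal] at hY
  simpa only [map_sub, hY.1, hY.2, polyEval_mk, Polynomial.eval_X, zero_smul, one_smul,
    sub_zero] using h3

end Faithful
end
end ConnesMoscovici

namespace ConnesMoscovici

noncomputable section

/-! ### Powers of primitive elements and the primitive filtration. -/

namespace LeftBialgebroid

variable {K : Type uK} {A : Type uA} {B : Type uB} [Field K] [Ring A] [Algebra K A] [Ring B]
  [Algebra K B] (ℬ : LeftBialgebroid K A B)

/-- Apply `B ⊗_A ε` to the Takeuchi condition for `Δ(X)`. The derivation that governs commutation
with the target is the same as for the source. -/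
theorem prim_mul_tgt {X : B} (hX : X ∈ ℬ.prim) (a : A) :
    X * tgt ℬ.η (op a) = tgt ℬ.η (op a) * X + tgt ℬ.η (op (ℬ.counit (X * src ℬ.η a))) := by
  have h := (mem_takeuchi ℬ.η).1 (ℬ.comul_mem X) a
  have h2 := congrArg (tensCounit ℬ.η ℬ.counit ℬ.counit_src) h
  rw [ℬ.mem_prim.1 hX] at h2
  simpa only [map_add, tensMulR_tens, tensCounit_tens, one_mul, mul_one, ℬ.counit_one, map_one,
    ℬ.counit_src_one, ℬ.counit_prim hX, map_zero, zero_mul, op_zero, op_one, add_zero] using h2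

/-- The commutator of a primitive element with `η(Aᵉ)` stays in `η(Aᵉ)`. Hence coefficients can be
collected on the left at the cost of lower degree. -/
theorem prim_mul_eta {X : B} (hX : X ∈ ℬ.prim) (z : Env K A) :
    ∃ w : Env K A, X * ℬ.η z = ℬ.η z * X + ℬ.η w := by
  induction z using TensorProduct.induction_on with
  | zero => exact ⟨0, by simp⟩
  | add z z' hz hz' =>
    obtain ⟨w, hw⟩ := hz
    obtain ⟨w', hw'⟩ := hz'
    refine ⟨w + w', ?_⟩
    rw [map_add, map_add, mul_add, add_mul, hw, hw']
    abel
  | tmul a b =>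
    obtain ⟨c, hc⟩ : ∃ c, X * src ℬ.η a = src ℬ.η a * X + src ℬ.η c := ⟨_, ℬ.prim_mul_src hX a⟩
    obtain ⟨d, hd⟩ : ∃ d, X * tgt ℬ.η b = tgt ℬ.η b * X + tgt ℬ.η d :=
      ⟨_, ℬ.prim_mul_tgt hX b.unop⟩
    refine ⟨a ⊗ₜ d + c ⊗ₜ b, ?_⟩
    rw [map_add, eta_tmul, eta_tmul, eta_tmul, ← mul_assoc, hc, add_mul, mul_assoc, hd,
      mul_add, mul_assoc, add_assoc]

/-- `Δ(X ^ m) = ∑ (m choose k) X ^ k ⊗ X ^ (m - k)` for a primitive element `X`. -/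
theorem comul_pow {X : B} (hX : X ∈ ℬ.prim) (m : ℕ) :
    ℬ.comul (X ^ m) =
      ∑ k ∈ Finset.range (m + 1), (m.choose k : ℕ) • tens ℬ.η (X ^ k) (X ^ (m - k)) := by
  rw [← Finset.Nat.sum_antidiagonal_eq_sum_range_succ
    (fun k l => (m.choose k : ℕ) • tens ℬ.η (X ^ k) (X ^ l))]
  induction m with
  | zero => simp [ℬ.comul_one]
  | succ m ih =>
    rw [Finset.sum_antidiagonal_choose_succ_nsmul (fun k l => tens ℬ.η (X ^ k) (X ^ l)),
      pow_succ', ℬ.comul_mul, ih, map_sum, ← Finset.sum_add_distrib]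
    refine Finset.sum_congr rfl fun p hp => ?_
    -- Pascal's rule in this form carries the second index in one of its two sums; the symmetry of
    -- binomial coefficients reconciles them.
    have hp' : m.choose p.2 = m.choose p.1 := by
      rw [Finset.HasAntidiagonal.mem_antidiagonal] at hp
      exact Nat.choose_symm_of_eq_add (by omega)
    rw [map_nsmul, ℬ.takMul_comul_prim hX, hp', ← smul_add, pow_succ', pow_succ', add_comm]

theorem counit_pow {X : B} (hX : X ∈ ℬ.prim) (m : ℕ) (hm : m ≠ 0) : ℬ.counit (X ^ m) = 0 := by
  induction m with
  | zero => exact absurd rfl hm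
  | succ m ih =>
    rcases Nat.eq_zero_or_pos m with rfl | h
    · simpa using ℬ.counit_prim hX
    · rw [pow_succ', ← ℬ.counit_mul_src, ih h.ne', map_zero, mul_zero, map_zero]

theorem counit_eta_mul_prim {X : B} (hX : ℬ.counit X = 0) (z : Env K A) :
    ℬ.counit (ℬ.η z * X) = 0 := by
  induction z using TensorProduct.induction_on with
  | zero => simp
  | add z z' hz hz' => rw [map_add, add_mul, map_add, hz, hz', add_zero]
  | tmul a b =>
    have := ℬ.counit_tgt b.unop X
    rw [op_unop] at this
    rw [eta_tmul, mul_assoc, ℬ.counit_src, this, hX, zero_mul, mul_zero]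

variable {L : Type uL} [LieRing L] [LieAlgebra K L] (j : L →ₗ⁅K⁆ ℬ.prim)

/-- The image in `B` of `j : L → Prim(B)`. -/
def primRange : Submodule K B :=
  LinearMap.range (ℬ.prim.incl.comp j).toLinearMap

variable {ℬ}

theorem mem_primRange (X : L) : (j X : B) ∈ ℬ.primRange j := ⟨X, rfl⟩

theorem primRange_commutator :
    ∀ x ∈ ℬ.primRange j, ∀ y ∈ ℬ.primRange j, x * y - y * x ∈ ℬ.primRange j := by
  rintro _ ⟨X, rfl⟩ _ ⟨Y, rfl⟩
  exact ⟨⁅X, Y⁆, LieHom.map_lie (ℬ.prim.incl.comp j) X Y⟩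

variable (ℬ)

/-- The span of the elements `η(z) j(X) ^ m`, `m ≤ n`. -/
def powFilt (n : ℕ) : Submodule K B :=
  Submodule.span K {x | ∃ (z : Env K A) (X : L) (m : ℕ), m ≤ n ∧ x = ℬ.η z * (j X : B) ^ m}

variable {ℬ}

theorem eta_mul_pow_mem (z : Env K A) (X : L) {m n : ℕ} (h : m ≤ n) :
    ℬ.η z * (j X : B) ^ m ∈ ℬ.powFilt j n :=
  Submodule.subset_span ⟨z, X, m, h, rfl⟩

theorem powFilt_mono {m n : ℕ} (h : m ≤ n) : ℬ.powFilt j m ≤ ℬ.powFilt j n := by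
  refine Submodule.span_mono ?_
  rintro _ ⟨z, X, k, hk, rfl⟩
  exact ⟨z, X, k, hk.trans h, rfl⟩

theorem eta_mem_powFilt (z : Env K A) (n : ℕ) : ℬ.η z ∈ ℬ.powFilt j n := by
  simpa using eta_mul_pow_mem j z 0 (Nat.zero_le n)

theorem powFilt_zero {x : B} : x ∈ ℬ.powFilt j 0 ↔ ∃ z, x = ℬ.η z := by
  constructor
  · intro hx
    have : ℬ.powFilt j 0 ≤ LinearMap.range ℬ.η.toLinearMap := by
      rw [powFilt, Submodule.span_le]
      rintro _ ⟨z, X, m, hm, rfl⟩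
      obtain rfl : m = 0 := by omega
      exact ⟨z, by simp⟩
    obtain ⟨z, hz⟩ := this hx
    exact ⟨z, hz.symm⟩
  · rintro ⟨z, rfl⟩
    exact eta_mem_powFilt j z 0

theorem eta_mul_mem_powFilt (z : Env K A) {n : ℕ} {x : B} (hx : x ∈ ℬ.powFilt j n) :
    ℬ.η z * x ∈ ℬ.powFilt j n := by
  have : ℬ.powFilt j n ≤ (ℬ.powFilt j n).comap (LinearMap.mulLeft K (ℬ.η z)) := by
    conv_lhs => rw [powFilt]
    rw [Submodule.span_le]
    rintro _ ⟨w, X, m, hm, rfl⟩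
    change ℬ.η z * _ ∈ ℬ.powFilt j n
    rw [← mul_assoc, ← map_mul]
    exact eta_mul_pow_mem j _ X hm
  exact this hx

theorem powSpan_le_powFilt (n : ℕ) : powSpan (ℬ.primRange j) n ≤ ℬ.powFilt j n := by
  rw [powSpan, Submodule.span_le]
  rintro _ ⟨_, ⟨X, rfl⟩, m, hm, rfl⟩
  simpa using eta_mul_pow_mem j 1 X hm

variable [CharZero K]

/-- Write `Y η(z) X ^ m = η(z) Y X ^ m + η(w) X ^ m`; symmetrisation turns `Y X ^ m` back into
powers. -/
theorem prim_mul_mem_powFilt (Y : L) {n : ℕ} {x : B} (hx : x ∈ ℬ.powFilt j n) :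
    (j Y : B) * x ∈ ℬ.powFilt j (n + 1) := by
  have : ℬ.powFilt j n ≤ (ℬ.powFilt j (n + 1)).comap (LinearMap.mulLeft K (j Y : B)) := by
    conv_lhs => rw [powFilt]
    rw [Submodule.span_le]
    rintro _ ⟨z, X, m, hm, rfl⟩
    change (j Y : B) * _ ∈ ℬ.powFilt j (n + 1)
    obtain ⟨w, hw⟩ := ℬ.prim_mul_eta (j Y).2 z
    rw [← mul_assoc, hw, add_mul, mul_assoc]
    refine add_mem (eta_mul_mem_powFilt j _ (powFilt_mono j (by omega : m + 1 ≤ n + 1)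
      (powSpan_le_powFilt j _ ?_))) (eta_mul_pow_mem j _ _ (by omega))
    exact mul_mem_powSpan_succ (primRange_commutator j) (mem_primRange j Y)
      (pow_mem_powSpan (mem_primRange j X) le_rfl)
  exact this hx

theorem eta_mul_pow_mul_mem_powFilt (z : Env K A) (X Y : L) {m n : ℕ} (h : m + 1 ≤ n) :
    ℬ.η z * ((j X : B) ^ m * (j Y : B)) ∈ ℬ.powFilt j n := by
  refine eta_mul_mem_powFilt j _ (powFilt_mono j h (powSpan_le_powFilt j _ ?_))
  refine mul_mem_powSpan_add (primRange_commutator j)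
      (pow_mem_powSpan (mem_primRange j X) le_rfl) ?_
  simpa using pow_mem_powSpan (mem_primRange j Y) (le_refl 1)

/-- If `Prim(B)` is `j(L) + ⟨s - t⟩`, the primitive filtration is spanned by the powers of the
elements of `j(L)`. -/
theorem iSup_primDeg_eq_powFilt
    (hj : ∀ X : ℬ.prim, ∃ (Y : L) (a : A), (X : B) = j Y + (src ℬ.η a - tgt ℬ.η (op a))) (n : ℕ) :
    ⨆ k : Fin (n + 1), ℬ.primDeg k = ℬ.powFilt j n := by
  have hpart : ∀ n, ℬ.primPart * ℬ.powFilt j n ≤ ℬ.powFilt j (n + 1) := by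
    intro n
    rw [Submodule.mul_le]
    intro x hx y hy
    have : ℬ.primPart ≤ (ℬ.powFilt j (n + 1)).comap (LinearMap.mulRight K y) := by
      rw [primPart, Submodule.span_le]
      rintro _ ⟨p, q, X, rfl⟩
      change _ * y ∈ ℬ.powFilt j (n + 1)
      obtain ⟨Y, a, hY⟩ := hj X
      -- The component in `⟨s - t⟩` lies in `η(Aᵉ)` and so adds nothing to the degree: every
      -- primitive factor can be replaced by one from `j(L)`.
      have e : src ℬ.η a - tgt ℬ.η (op a) = ℬ.η (a ⊗ₜ 1 - 1 ⊗ₜ op a) := by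
        simp [eta_tmul]
      rw [mul_assoc, mul_assoc, hY, add_mul, e]
      have hy' := eta_mul_mem_powFilt j q hy
      exact eta_mul_mem_powFilt j _ (add_mem (prim_mul_mem_powFilt j Y hy')
        (eta_mul_mem_powFilt j _ (powFilt_mono j n.le_succ hy')))
    exact this hx
  have hpow : ∀ n, ℬ.primPart ^ n ≤ ℬ.powFilt j n := by
    intro n
    induction n with
    | zero =>
      rw [pow_zero, Submodule.one_le]
      simpa using eta_mem_powFilt j 1 0
    | succ n ih =>
      rw [pow_succ']
      exact (mul_le_mul_right ih _).trans (hpart n)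
  apply le_antisymm
  · refine iSup_le fun k => ?_
    refine le_trans ?_ (powFilt_mono j (Nat.le_of_lt_succ k.2))
    rcases (k : ℕ) with _ | k
    · rintro _ ⟨z, rfl⟩
      exact eta_mem_powFilt j z 0
    · exact hpow (k + 1)
  · rw [powFilt, Submodule.span_le]
    rintro _ ⟨z, X, m, hm, rfl⟩
    refine Submodule.mem_iSup_of_mem (⟨m, by omega⟩ : Fin (n + 1)) ?_
    rcases m with _ | m
    · exact ⟨z, by simp⟩
    · change _ ∈ ℬ.primPart ^ (m + 1)
      have h : ∀ z, ℬ.η z * (j X : B) ∈ ℬ.primPart := fun z =>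
        Submodule.subset_span ⟨z, 1, j X, by simp⟩
      rw [pow_succ', pow_succ', ← mul_assoc]
      refine Submodule.mul_mem_mul (h z) (Submodule.pow_mem_pow _ ?_ m)
      simpa using h 1

theorem mem_primFilt_iff
    (hj : ∀ X : ℬ.prim, ∃ (Y : L) (a : A), (X : B) = j Y + (src ℬ.η a - tgt ℬ.η (op a))) {n : ℕ}
    {x : ℬ.AsModule} : x ∈ ℬ.primFilt n ↔ ℬ.toB x ∈ ℬ.powFilt j n := by
  rw [← iSup_primDeg_eq_powFilt j hj]
  rfl

end LeftBialgebroid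
end
end ConnesMoscovici

namespace ConnesMoscovici

noncomputable section

open UniversalEnvelopingAlgebra (ι)

/-! ### Generators and powers in the Connes–Moscovici bialgebroid. -/

namespace CM

variable {K : Type uK} {A : Type uA} {L : Type uL} [Field K] [Ring A] [Algebra K A]
  [LieRing L] [LieAlgebra K L] (ω : L →ₗ⁅K⁆ Der K A)

/-- The algebra map `u ↦ 1 ⊗ u ⊗ 1`. -/
def mid : UniversalEnvelopingAlgebra K L →ₐ[K] CM ω :=
  AlgHom.ofLinearMap ((pure₃ ω 1).flip 1) rfl (by
    intro u v
    change pure ω 1 (u * v) 1 = pure ω 1 u 1 * pure ω 1 v 1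
    simp [pure_mul, mulL_one, mulR_one, diag_pure_one])

theorem mid_apply (u : UniversalEnvelopingAlgebra K L) : mid ω u = pure ω 1 u 1 := rfl

theorem pure_eq (a : A) (u : UniversalEnvelopingAlgebra K L) (b : A) :
    pure ω a u b = src (eta ω) a * (tgt (eta ω) (op b) * mid ω u) := by
  rw [src_eta_mul, tgt_eta_mul]
  simp [mid_apply]

theorem induction {p : CM ω → Prop} (hsrc : ∀ a, p (src (eta ω) a))
    (htgt : ∀ a, p (tgt (eta ω) (op a))) (hι : ∀ X, p (mid ω (ι K X)))
    (hadd : ∀ x y, p x → p y → p (x + y)) (hmul : ∀ x y, p x → p y → p (x * y)) (x : CM ω) :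
    p x := by
  have hmid : ∀ u, p (mid ω u) := by
    refine U_induction K ?_ hι ?_ ?_
    · intro c
      rw [AlgHom.commutes, ← AlgHom.commutes (src (eta ω))]
      exact hsrc _
    · intro u v hu hv
      rw [map_add]
      exact hadd _ _ hu hv
    · intro u v hu hv
      rw [map_mul]
      exact hmul _ _ hu hv
  have hpure : ∀ a u b, p (pure ω a u b) := by
    intro a u b
    rw [pure_eq]
    exact hmul _ _ (hsrc a) (hmul _ _ (htgt b) (hmid u))
  have hzero : p 0 := by
    have := hsrc 0
    rwa [map_zero] at this
  have hx : ∀ x : A ⊗[K] (UniversalEnvelopingAlgebra K L ⊗[K] A), p (x : CM ω) := by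
    intro x
    induction x using TensorProduct.induction_on with
    | zero => exact hzero
    | add x y hx hy => exact hadd _ _ hx hy
    | tmul a w =>
      induction w using TensorProduct.induction_on with
      | zero => rw [TensorProduct.tmul_zero]; exact hzero
      | add x y hx hy => rw [TensorProduct.tmul_add]; exact hadd _ _ hx hy
      | tmul u b => exact hpure a u b
  exact hx x

theorem mid_ι_mem_prim (X : L) : mid ω (ι K X) ∈ (connesMoscovici ω).prim := by
  rw [LeftBialgebroid.mem_prim]
  change comul ω (pure ω 1 (ι K X) 1) = tens (eta ω) (pure ω 1 (ι K X) 1) 1 +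
    tens (eta ω) 1 (pure ω 1 (ι K X) 1)
  rw [comul_pure, comulU_ι, map_add, comulPair_tmul, comulPair_tmul, ← one_def]

/-- The Lie algebra map `X ↦ 1 ⊗ X ⊗ 1` from `L` to the primitive elements. -/
def prim : L →ₗ⁅K⁆ (connesMoscovici ω).prim where
  toFun X := ⟨mid ω (ι K X), mid_ι_mem_prim ω X⟩
  map_add' X Y := Subtype.ext (by simp only [map_add]; rfl)
  map_smul' c X := Subtype.ext (by simp only [map_smul]; rfl)
  map_lie' := by
    intro X Y
    refine Subtype.ext ?_
    simp only [LieHom.map_lie, LieRing.of_associative_ring_bracket, map_sub, map_mul]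
    rfl

theorem coe_prim (X : L) : (prim ω X : CM ω) = mid ω (ι K X) := rfl

/-- This identifies the anchor of the primitive element attached to `X` with `ω X`. -/
theorem counit_mid_ι_mul_src (X : L) (a : A) :
    counit ω (mid ω (ι K X) * src (eta ω) a) = (ω X : Module.End K A) a := by
  rw [mid_apply, counit_pure_mul, src_eta, counit_pure, actU_ι]
  simp

variable [CharZero K]

theorem exists_mem_powFilt (x : CM ω) : ∃ n, x ∈ (connesMoscovici ω).powFilt (prim ω) n := by
  have hmid : ∀ u, ∃ n, mid ω u ∈ (connesMoscovici ω).powFilt (prim ω) n := by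
    intro u
    obtain ⟨n, hn⟩ := exists_mem_powSpan_ιRange u
    refine ⟨n, ?_⟩
    have : powSpan (ιRange K L) n ≤
        ((connesMoscovici ω).powFilt (prim ω) n).comap (mid ω).toLinearMap := by
      rw [powSpan, Submodule.span_le]
      rintro _ ⟨_, ⟨X, rfl⟩, m, hm, rfl⟩
      have := LeftBialgebroid.eta_mul_pow_mem (prim ω) 1 X hm
      rw [map_one, one_mul, coe_prim, ← map_pow] at this
      exact this
    exact this hn
  have hpure : ∀ a u b, ∃ n, pure ω a u b ∈ (connesMoscovici ω).powFilt (prim ω) n := by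
    intro a u b
    obtain ⟨n, hn⟩ := hmid u
    refine ⟨n, ?_⟩
    rw [pure_eq, ← mul_assoc, ← eta_tmul]
    exact LeftBialgebroid.eta_mul_mem_powFilt (prim ω) _ hn
  have hadd : ∀ x y : CM ω, (∃ n, x ∈ (connesMoscovici ω).powFilt (prim ω) n) →
      (∃ n, y ∈ (connesMoscovici ω).powFilt (prim ω) n) →
      ∃ n, x + y ∈ (connesMoscovici ω).powFilt (prim ω) n := by
    rintro x y ⟨m, hx⟩ ⟨n, hy⟩
    exact ⟨max m n, add_mem (LeftBialgebroid.powFilt_mono _ (le_max_left _ _) hx)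
      (LeftBialgebroid.powFilt_mono _ (le_max_right _ _) hy)⟩
  have hx : ∀ x : A ⊗[K] (UniversalEnvelopingAlgebra K L ⊗[K] A),
      ∃ n, (x : CM ω) ∈ (connesMoscovici ω).powFilt (prim ω) n := by
    intro x
    induction x using TensorProduct.induction_on with
    | zero => exact ⟨0, zero_mem _⟩
    | add x y hx hy => exact hadd _ _ hx hy
    | tmul a w =>
      induction w using TensorProduct.induction_on with
      | zero => rw [TensorProduct.tmul_zero]; exact ⟨0, zero_mem _⟩
      | add x y hx hy => rw [TensorProduct.tmul_add]; exact hadd _ _ hx hy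
      | tmul u b => exact hpure a u b
  exact hx x

/-- A linear map out of `A ⊙ U(L) ⊙ A` is determined by its values on the `s(a) t(b) X ^ m`. -/
theorem hom_ext_pow {M : Type*} [AddCommGroup M] [Module K M] {f g : CM ω →ₗ[K] M}
    (h : ∀ (a b : A) (X : L) (m : ℕ),
      f (src (connesMoscovici ω).η a * (tgt (connesMoscovici ω).η (op b) * mid ω (ι K X) ^ m)) =
      g (src (connesMoscovici ω).η a * (tgt (connesMoscovici ω).η (op b) * mid ω (ι K X) ^ m))) :
    f = g := by
  apply hom_ext
  intro a u b
  obtain ⟨n, hn⟩ := exists_mem_powSpan_ιRange u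
  have : powSpan (ιRange K L) n ≤ LinearMap.eqLocus (f ∘ₗ (pure₃ ω a).flip b)
      (g ∘ₗ (pure₃ ω a).flip b) := by
    rw [powSpan, Submodule.span_le]
    rintro _ ⟨_, ⟨X, rfl⟩, m, hm, rfl⟩
    have := h a b X m
    rw [← map_pow] at this
    change f (src (eta ω) a * (tgt (eta ω) (op b) * mid ω _)) =
      g (src (eta ω) a * (tgt (eta ω) (op b) * mid ω _)) at this
    rw [← pure_eq] at this
    exact this
  exact this hn

end CM

/-! ### The morphism from the Connes–Moscovici bialgebroid induced by `j`. -/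

namespace LeftBialgebroid

variable {K : Type uK} {A : Type uA} {B : Type uB} {C : Type uC} [Field K] [Ring A] [Algebra K A]
  [Ring B] [Algebra K B] [Ring C] [Algebra K C]

/-- The inverse of a bijective morphism. -/
theorem Hom.isomorphic {ℬ : LeftBialgebroid K A B} {𝒞 : LeftBialgebroid K A C} (f : Hom ℬ 𝒞)
    (hf : Function.Bijective f.toAlgHom) : 𝒞.Isomorphic ℬ := by
  let e := AlgEquiv.ofBijective f.toAlgHom hf
  have hl : ∀ x, e.symm (f.toAlgHom x) = x := fun x => e.symm_apply_apply x
  have hr : ∀ y, f.toAlgHom (e.symm y) = y := fun y => e.apply_symm_apply y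
  have hs : ∀ a, e.symm.toAlgHom (src 𝒞.η a) = src ℬ.η a := by
    intro a; rw [← f.map_src]; exact hl _
  have ht : ∀ a, e.symm.toAlgHom (tgt 𝒞.η (op a)) = tgt ℬ.η (op a) := by
    intro a; rw [← f.map_tgt]; exact hl _
  refine ⟨⟨e.symm.toAlgHom, hs, ht, ?_, ?_⟩, f, hr, hl⟩
  · intro y
    change ℬ.counit (e.symm y) = _
    rw [← f.map_counit, hr]
  · intro y
    have h : (tensMap 𝒞.η ℬ.η e.symm.toAlgHom hs ht).comp
        (tensMap ℬ.η 𝒞.η f.toAlgHom f.map_src f.map_tgt) = LinearMap.id := by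
      apply tens_hom_ext
      intro x y
      simp only [LinearMap.comp_apply, tensMap_tens, LinearMap.id_apply]
      exact congrArg₂ (fun u v => tens ℬ.η u v) (hl x) (hl y)
    change tensMap _ _ e.symm.toAlgHom hs ht _ = ℬ.comul (e.symm y)
    have h2 := f.map_comul (e.symm y)
    rw [hr] at h2
    rw [← h2]
    exact LinearMap.congr_fun h _

variable (ℬ : LeftBialgebroid K A B) {L : Type uL} [LieRing L] [LieAlgebra K L]
  {ω : L →ₗ⁅K⁆ Der K A} (j : L →ₗ⁅K⁆ ℬ.prim)

/-- The algebra map `U(L) → B` extending `j`. -/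
def envMap : UniversalEnvelopingAlgebra K L →ₐ[K] B :=
  UniversalEnvelopingAlgebra.lift K (ℬ.prim.incl.comp j)

theorem envMap_ι (X : L) : ℬ.envMap j (ι K X) = j X :=
  UniversalEnvelopingAlgebra.lift_ι_apply K _ X

variable (ω) in
/-- The linear map `a ⊗ u ⊗ b ↦ s(a) t(b) u`. -/
def ofCMLin : CM ω →ₗ[K] B :=
  CM.lift₃ ω (LinearMap.mk₂ K
    (fun a u => LinearMap.mulLeft K (src ℬ.η a) ∘ₗ LinearMap.mulRight K (ℬ.envMap j u) ∘ₗ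
      (tgt ℬ.η).toLinearMap ∘ₗ (opLinearEquiv K).toLinearMap)
    (by intros; ext; simp [add_mul]) (by intros; ext; simp)
    (by intros; ext; simp [mul_add]) (by intros; ext; simp))

theorem ofCMLin_pure (a : A) (u : UniversalEnvelopingAlgebra K L) (b : A) :
    ℬ.ofCMLin ω j (CM.pure ω a u b) = src ℬ.η a * (tgt ℬ.η (op b) * ℬ.envMap j u) := rfl

variable {ℬ j} (hj : ∀ X, ℬ.anchor (j X) = ω X)

include hj

/-- It is enough to treat left multiplication by `s(a)`, `t(a)` and `X ∈ L`. For `X`, the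
commutation of `j X` with source and target in `B`, with anchor `ω X` by `hj`, matches the three
terms of the diagonal action. -/
theorem ofCMLin_mul (x : CM ω) :
    ∀ y, ℬ.ofCMLin ω j (x * y) = ℬ.ofCMLin ω j x * ℬ.ofCMLin ω j y := by
  have hsrc : ∀ a, ∀ y, ℬ.ofCMLin ω j (src (CM.eta ω) a * y) = src ℬ.η a * ℬ.ofCMLin ω j y := by
    intro a y
    rw [CM.src_eta_mul]
    have : ℬ.ofCMLin ω j ∘ₗ CM.mulL ω a = LinearMap.mulLeft K (src ℬ.η a) ∘ₗ ℬ.ofCMLin ω j :=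
      CM.hom_ext (by
        intro a' u b
        simp [ofCMLin_pure, mul_assoc])
    exact LinearMap.congr_fun this y
  have htgt : ∀ a, ∀ y, ℬ.ofCMLin ω j (tgt (CM.eta ω) (op a) * y) =
      tgt ℬ.η (op a) * ℬ.ofCMLin ω j y := by
    intro a y
    rw [CM.tgt_eta_mul]
    have : ℬ.ofCMLin ω j ∘ₗ CM.mulR ω a =
        LinearMap.mulLeft K (tgt ℬ.η (op a)) ∘ₗ ℬ.ofCMLin ω j :=
      CM.hom_ext (by
        intro a' u b
        simp only [LinearMap.comp_apply, CM.mulR_pure, ofCMLin_pure, LinearMap.mulLeft_apply,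
          op_mul, map_mul]
        rw [← mul_assoc (tgt ℬ.η (op a)) (src ℬ.η a'), ← src_mul_tgt]
        simp only [mul_assoc])
    exact LinearMap.congr_fun this y
  have hι : ∀ X, ∀ y, ℬ.ofCMLin ω j (CM.mid ω (ι K X) * y) = (j X : B) * ℬ.ofCMLin ω j y := by
    intro X y
    rw [CM.mid_apply, CM.pure_ι_mul]
    have : ℬ.ofCMLin ω j ∘ₗ CM.diag ω (ι K X) =
        LinearMap.mulLeft K (j X : B) ∘ₗ ℬ.ofCMLin ω j :=
      CM.hom_ext (by
        intro a u b
        have hs := ℬ.prim_mul_src (j X).2 a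
        have ht := ℬ.prim_mul_tgt (j X).2 b
        rw [← ℬ.anchor_apply, hj] at hs ht
        simp only [LinearMap.comp_apply, CM.diag_ι, map_add, ofCMLin_pure, map_mul, envMap_ι,
          LinearMap.mulLeft_apply]
        rw [← mul_assoc (j X : B), hs, add_mul, mul_assoc (src ℬ.η a), ← mul_assoc (j X : B), ht]
        noncomm_ring)
    exact LinearMap.congr_fun this y
  have hone : ℬ.ofCMLin ω j 1 = 1 := by
    rw [CM.one_def, ofCMLin_pure]
    simp
  refine CM.induction ω (p := fun x =>
    ∀ y, ℬ.ofCMLin ω j (x * y) = ℬ.ofCMLin ω j x * ℬ.ofCMLin ω j y) ?_ ?_ ?_ ?_ ?_ x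
  · intro a y
    have := hsrc a 1
    rw [mul_one, hone, mul_one] at this
    rw [hsrc, this]
  · intro a y
    have := htgt a 1
    rw [mul_one, hone, mul_one] at this
    rw [htgt, this]
  · intro X y
    have := hι X 1
    rw [mul_one, hone, mul_one] at this
    rw [hι, this]
  · intro x x' hx hx' y
    rw [add_mul, map_add, hx, hx', map_add, add_mul]
  · intro x x' hx hx' y
    rw [mul_assoc, hx, hx', hx, mul_assoc]

/-- The algebra map `A ⊙ U(L) ⊙ A → B` induced by a map of anchored Lie algebras
`L → Prim(B)`. -/
def ofCMAlgHom : CM ω →ₐ[K] B :=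
  AlgHom.ofLinearMap (ℬ.ofCMLin ω j) (by rw [CM.one_def, ofCMLin_pure]; simp)
    (fun x y => ofCMLin_mul hj x y)

theorem ofCMAlgHom_apply (x : CM ω) : ofCMAlgHom hj x = ℬ.ofCMLin ω j x := rfl

theorem ofCMAlgHom_src (a : A) : ofCMAlgHom hj (src (connesMoscovici ω).η a) = src ℬ.η a := by
  change ofCMAlgHom hj (src (CM.eta ω) a) = _
  rw [CM.src_eta, ofCMAlgHom_apply, ofCMLin_pure]
  simp

theorem ofCMAlgHom_tgt (a : A) :
    ofCMAlgHom hj (tgt (connesMoscovici ω).η (op a)) = tgt ℬ.η (op a) := by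
  change ofCMAlgHom hj (tgt (CM.eta ω) (op a)) = _
  rw [CM.tgt_eta, ofCMAlgHom_apply, ofCMLin_pure]
  simp

theorem ofCMAlgHom_mid_ι (X : L) : ofCMAlgHom hj (CM.mid ω (ι K X)) = j X := by
  rw [CM.mid_apply, ofCMAlgHom_apply, ofCMLin_pure, envMap_ι]
  simp

variable [CharZero K]

variable (ω) in
/-- The morphism of bialgebroids `A ⊙ U(L) ⊙ A → B` induced by a map of anchored Lie algebras
`L → Prim(B)`. -/
def ofCM : Hom (connesMoscovici ω) ℬ where
  toAlgHom := ofCMAlgHom hj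
  map_src := ofCMAlgHom_src hj
  map_tgt := ofCMAlgHom_tgt hj
  map_counit := by
    -- On `s(a) t(b) X ^ m` both counits vanish for `m ≠ 0` and give `a b` for `m = 0`.
    have : ℬ.counit ∘ₗ (ofCMAlgHom hj).toLinearMap = (connesMoscovici ω).counit := by
      apply CM.hom_ext_pow
      intro a b X m
      rw [LinearMap.comp_apply, AlgHom.toLinearMap_apply, map_mul (ofCMAlgHom hj),
        map_mul (ofCMAlgHom hj), map_pow,
        ofCMAlgHom_src, ofCMAlgHom_tgt, ofCMAlgHom_mid_ι, ℬ.counit_src, ℬ.counit_tgt,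
        (connesMoscovici ω).counit_src, (connesMoscovici ω).counit_tgt]
      rcases eq_or_ne m 0 with rfl | hm
      · rw [pow_zero, pow_zero, ℬ.counit_one, (connesMoscovici ω).counit_one]
      · rw [ℬ.counit_pow (j X).2 m hm,
          (connesMoscovici ω).counit_pow (CM.mid_ι_mem_prim ω X) m hm]
    exact LinearMap.congr_fun this
  map_comul := by
    have h1 : ∀ a, (tensMap (connesMoscovici ω).η ℬ.η _ (ofCMAlgHom_src hj) (ofCMAlgHom_tgt hj)).comp
          (tensActL (connesMoscovici ω).η a) = (tensActL ℬ.η a).comp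
          (tensMap (connesMoscovici ω).η ℬ.η _ (ofCMAlgHom_src hj) (ofCMAlgHom_tgt hj)) :=
      fun a => tens_hom_ext _ (by
        intro x y
        simp only [LinearMap.comp_apply, tensActL_tens, tensMap_tens, map_mul, ofCMAlgHom_src])
    have h2 : ∀ a, (tensMap (connesMoscovici ω).η ℬ.η _ (ofCMAlgHom_src hj) (ofCMAlgHom_tgt hj)).comp
          (tensActR (connesMoscovici ω).η a) = (tensActR ℬ.η a).comp
          (tensMap (connesMoscovici ω).η ℬ.η _ (ofCMAlgHom_src hj) (ofCMAlgHom_tgt hj)) :=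
      fun a => tens_hom_ext _ (by
        intro x y
        simp only [LinearMap.comp_apply, tensActR_tens, tensMap_tens, map_mul, ofCMAlgHom_tgt])
    -- `h1` and `h2` remove `s(a)` and `t(b)`; on `X ^ m` both sides have the same binomial
    -- expansion.
    have : (tensMap (connesMoscovici ω).η ℬ.η _ (ofCMAlgHom_src hj) (ofCMAlgHom_tgt hj)).comp
        (connesMoscovici ω).comul = ℬ.comul ∘ₗ (ofCMAlgHom hj).toLinearMap := by
      apply CM.hom_ext_pow
      intro a b X m
      rw [LinearMap.comp_apply, LinearMap.comp_apply, AlgHom.toLinearMap_apply,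
        map_mul (ofCMAlgHom hj), map_mul (ofCMAlgHom hj),
        map_pow, ofCMAlgHom_src, ofCMAlgHom_tgt, ofCMAlgHom_mid_ι, ℬ.comul_src, ℬ.comul_tgt,
        ℬ.comul_pow (j X).2, (connesMoscovici ω).comul_src, (connesMoscovici ω).comul_tgt,
        (connesMoscovici ω).comul_pow (CM.mid_ι_mem_prim ω X), ← LinearMap.comp_apply, h1,
        LinearMap.comp_apply, ← LinearMap.comp_apply (tensMap _ _ _ _ _), h2,
        LinearMap.comp_apply, map_sum]
      congr 2
      refine Finset.sum_congr rfl fun k _ => ?_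
      rw [map_nsmul, tensMap_tens, map_pow (ofCMAlgHom hj), map_pow (ofCMAlgHom hj), ofCMAlgHom_mid_ι]
    exact LinearMap.congr_fun this

end LeftBialgebroid
end
end ConnesMoscovici

namespace ConnesMoscovici

noncomputable section

open UniversalEnvelopingAlgebra (ι)

/-! ### Extending linear maps along a filtration with projective quotients. -/

section Extension

variable {R M Q : Type*} [Ring R] [AddCommGroup M] [Module R M] [AddCommGroup Q] [Module R Q]

/-- Projectivity splits `P → P / N`; the splitting gives a retraction of `P` onto `N`, with which
`f` is composed. -/
theorem exists_extend_of_projective {N P : Submodule R M} (h : N ≤ P)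
    (hP : Module.Projective R (P ⧸ N.comap P.subtype)) (f : N →ₗ[R] Q) :
    ∃ g : P →ₗ[R] Q, ∀ x : N, g ⟨x, h x.2⟩ = f x := by
  obtain ⟨σ, hσ⟩ := Module.projective_lifting_property (N.comap P.subtype).mkQ LinearMap.id
    (Submodule.mkQ_surjective _)
  have hmem : ∀ x : P, ((x - σ ((N.comap P.subtype).mkQ x) : P) : M) ∈ N := by
    intro x
    change x - σ ((N.comap P.subtype).mkQ x) ∈ N.comap P.subtype
    rw [← Submodule.Quotient.mk_eq_zero, ← Submodule.mkQ_apply, map_sub, sub_eq_zero]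
    exact (LinearMap.congr_fun hσ _).symm
  let r : P →ₗ[R] N := LinearMap.codRestrict N
    (P.subtype ∘ₗ (LinearMap.id - σ ∘ₗ (N.comap P.subtype).mkQ)) hmem
  refine ⟨f ∘ₗ r, fun x => congrArg f (Subtype.ext ?_)⟩
  have h0 : (N.comap P.subtype).mkQ ⟨x, h x.2⟩ = 0 :=
    (Submodule.Quotient.mk_eq_zero _).2 x.2
  change ((⟨x, h x.2⟩ - σ ((N.comap P.subtype).mkQ ⟨x, h x.2⟩) : P) : M) = x
  rw [h0, map_zero, sub_zero]

/-- A linear map on the first term of an exhaustive filtration with projective quotients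
extends to the whole module. -/
theorem exists_extend_of_filtration (F : ℕ → Submodule R M) (hF : Monotone F)
    (hp : ∀ n, Module.Projective R (F (n + 1) ⧸ (F n).comap (F (n + 1)).subtype))
    (hx : ∀ x, ∃ n, x ∈ F n) (f : F 1 →ₗ[R] Q) : ∃ g : M →ₗ[R] Q, ∀ x : F 1, g x = f x := by
  choose e he using fun n (g : F (n + 1) →ₗ[R] Q) =>
    exists_extend_of_projective (hF (n + 1).le_succ) (hp (n + 1)) g
  -- `s n` is defined on `F (n + 1)`, since the extension starts at `F 1`; only the quotients from
  -- `F 2 / F 1` upwards are used.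
  let s : ∀ n, F (n + 1) →ₗ[R] Q := fun n => Nat.rec f (fun n g => e n g) n
  have hs : ∀ n k x (hx : x ∈ F (n + 1)) (hx' : x ∈ F (n + k + 1)),
      s (n + k) ⟨x, hx'⟩ = s n ⟨x, hx⟩ := by
    intro n k
    induction k with
    | zero => intro x hx hx'; rfl
    | succ k ih =>
      intro x hx hx'
      have hx'' : x ∈ F (n + k + 1) := hF (by omega) hx
      exact (he (n + k) (s (n + k)) ⟨x, hx''⟩).trans (ih x hx hx'')
  have hs' : ∀ m n x (hx : x ∈ F (m + 1)) (hx' : x ∈ F (n + 1)), s m ⟨x, hx⟩ = s n ⟨x, hx'⟩ := by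
    intro m n x hx hx'
    rcases le_total m n with h | h
    · obtain ⟨k, rfl⟩ := Nat.exists_eq_add_of_le h
      exact (hs m k x hx hx').symm
    · obtain ⟨k, rfl⟩ := Nat.exists_eq_add_of_le h
      exact hs n k x hx' hx
  have hx1 : ∀ x, ∃ n, x ∈ F (n + 1) := fun x => (hx x).imp fun n hn => hF n.le_succ hn
  choose d hd using hx1
  -- The value at `x` is read off at a chosen level; by `hs'` it does not depend on the choice, so
  -- linearity may be checked at a common level.
  refine ⟨⟨⟨fun x => s (d x) ⟨x, hd x⟩, fun x y => ?_⟩, fun c x => ?_⟩, fun x => ?_⟩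
  · have h1 : x ∈ F (max (d x) (d y) + 1) := hF (by omega) (hd x)
    have h2 : y ∈ F (max (d x) (d y) + 1) := hF (by omega) (hd y)
    change _ = s (d x) ⟨x, hd x⟩ + s (d y) ⟨y, hd y⟩
    rw [hs' _ _ x (hd x) h1, hs' _ _ y (hd y) h2, hs' _ _ _ (hd (x + y)) (add_mem h1 h2), ← map_add]
    rfl
  · change s (d (c • x)) ⟨c • x, hd (c • x)⟩ = c • s (d x) ⟨x, hd x⟩
    rw [hs' _ _ _ (hd (c • x)) (Submodule.smul_mem _ c (hd x)), ← map_smul]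
    rfl
  · exact hs' _ 0 x (hd x) x.2

end Extension

variable {K : Type uK} {A : Type uA} {B : Type uB} {C : Type uC} [Field K] [Ring A] [Algebra K A]
  [Ring B] [Algebra K B] [Ring C] [Algebra K C]

variable (K A) in
/-- The multiplication `a ⊗ b ↦ a b` of `A`, as a map `Aᵉ → A`. -/
def envMul : Env K A →ₗ[K] A :=
  TensorProduct.lift ((LinearMap.mul K A).compl₂ (opLinearEquiv K).symm.toLinearMap)

theorem envMul_tmul (a : A) (b : Aᵐᵒᵖ) : envMul K A (a ⊗ₜ b) = a * b.unop := rfl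

theorem envMul_left (a : A) (z : Env K A) : envMul K A (a ⊗ₜ 1 * z) = a * envMul K A z := by
  induction z using TensorProduct.induction_on with
  | zero => simp
  | add z z' hz hz' => rw [mul_add, map_add, hz, hz', map_add, mul_add]
  | tmul c d => simp [envMul_tmul, mul_assoc]

theorem envMul_right (b : A) (z : Env K A) : envMul K A (1 ⊗ₜ op b * z) = envMul K A z * b := by
  induction z using TensorProduct.induction_on with
  | zero => simp
  | add z z' hz hz' => rw [mul_add, map_add, hz, hz', map_add, add_mul]
  | tmul c d => simp [envMul_tmul, mul_assoc]

/-! ### Partial derivatives, Euler's identity and injectivity. -/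

namespace LeftBialgebroid

variable (ℬ : LeftBialgebroid K A B) {𝒞 : LeftBialgebroid K A C}

/-- A map of `A`-bimodules `B → A`. -/
structure BimoduleFunctional where
  /-- the underlying linear map -/
  toLin : B →ₗ[K] A
  map_src : ∀ (a : A) (x : B), toLin (src ℬ.η a * x) = a * toLin x
  map_tgt : ∀ (a : A) (x : B), toLin (tgt ℬ.η (op a) * x) = toLin x * a

variable {ℬ}

theorem Hom.map_eta (f : Hom ℬ 𝒞) (z : Env K A) : f.toAlgHom (ℬ.η z) = 𝒞.η z := by
  induction z using TensorProduct.induction_on with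
  | zero => simp
  | add z z' hz hz' => rw [map_add, map_add, map_add, hz, hz']
  | tmul a b => rw [eta_tmul, eta_tmul, map_mul, f.map_src, ← op_unop b, f.map_tgt]

namespace BimoduleFunctional

variable (p : BimoduleFunctional ℬ)

/-- The operator `x ↦ ∑ t(p(x₂)) x₁` on `B`. -/
def deriv : B →ₗ[K] B := tensCounit ℬ.η p.toLin p.map_src ∘ₗ ℬ.comul

theorem deriv_src (a : A) (x : B) : p.deriv (src ℬ.η a * x) = src ℬ.η a * p.deriv x := by
  have : tensCounit ℬ.η p.toLin p.map_src ∘ₗ tensActL ℬ.η a =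
      LinearMap.mulLeft K (src ℬ.η a) ∘ₗ tensCounit ℬ.η p.toLin p.map_src :=
    tens_hom_ext _ (by
      intro x y
      simp [← mul_assoc, src_mul_tgt])
  rw [deriv, LinearMap.comp_apply, ℬ.comul_src]
  exact LinearMap.congr_fun this _

theorem deriv_tgt (a : A) (x : B) :
    p.deriv (tgt ℬ.η (op a) * x) = tgt ℬ.η (op a) * p.deriv x := by
  have : tensCounit ℬ.η p.toLin p.map_src ∘ₗ tensActR ℬ.η a =
      LinearMap.mulLeft K (tgt ℬ.η (op a)) ∘ₗ tensCounit ℬ.η p.toLin p.map_src :=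
    tens_hom_ext _ (by
      intro x y
      simp [p.map_tgt, mul_assoc])
  rw [deriv, LinearMap.comp_apply, ℬ.comul_tgt]
  exact LinearMap.congr_fun this _

theorem deriv_eta (z : Env K A) (x : B) : p.deriv (ℬ.η z * x) = ℬ.η z * p.deriv x := by
  induction z using TensorProduct.induction_on with
  | zero => simp
  | add z z' hz hz' => rw [map_add, add_mul, map_add, hz, hz', add_mul]
  | tmul a b =>
    rw [eta_tmul, mul_assoc, p.deriv_src, ← op_unop b, p.deriv_tgt, ← mul_assoc]

theorem deriv_pow {X : B} (hX : X ∈ ℬ.prim) (m : ℕ) : p.deriv (X ^ m) =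
    ∑ k ∈ Finset.range (m + 1), m.choose k • (tgt ℬ.η (op (p.toLin (X ^ (m - k)))) * X ^ k) := by
  rw [deriv, LinearMap.comp_apply, ℬ.comul_pow hX, map_sum]
  refine Finset.sum_congr rfl fun k _ => ?_
  rw [map_nsmul, tensCounit_tens]

/-- The restriction of a bimodule functional along a morphism. -/
def comap (f : Hom 𝒞 ℬ) : BimoduleFunctional 𝒞 where
  toLin := p.toLin ∘ₗ f.toAlgHom.toLinearMap
  map_src a x := by simp [f.map_src, p.map_src]
  map_tgt a x := by simp [f.map_tgt, p.map_tgt]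

theorem comap_apply (f : Hom 𝒞 ℬ) (x : C) : (p.comap f).toLin x = p.toLin (f.toAlgHom x) := rfl

/-- Since `f` respects `Δ`, it intertwines the two operators; in particular the kernel of `f` is
stable under the pulled-back one. -/
theorem deriv_map (f : Hom 𝒞 ℬ) (x : C) :
    p.deriv (f.toAlgHom x) = f.toAlgHom ((p.comap f).deriv x) := by
  have : tensCounit ℬ.η p.toLin p.map_src ∘ₗ tensMap 𝒞.η ℬ.η f.toAlgHom f.map_src f.map_tgt =
      f.toAlgHom.toLinearMap ∘ₗ tensCounit 𝒞.η (p.comap f).toLin (p.comap f).map_src :=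
    tens_hom_ext _ (by
      intro x y
      simp [comap_apply, f.map_tgt])
  rw [deriv, LinearMap.comp_apply, ← f.map_comul]
  exact LinearMap.congr_fun this _

variable {L : Type uL} [LieRing L] [LieAlgebra K L] (j : L →ₗ⁅K⁆ ℬ.prim)

/-- In the binomial sum for `X ^ m` the top term `k = m` has coefficient `p(1) = 0`, so the degree
drops. -/
theorem deriv_mem_powFilt (hp : p.toLin 1 = 0) {n : ℕ} {x : B} (hx : x ∈ ℬ.powFilt j (n + 1)) :
    p.deriv x ∈ ℬ.powFilt j n := by
  have : ℬ.powFilt j (n + 1) ≤ (ℬ.powFilt j n).comap p.deriv := by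
    conv_lhs => rw [powFilt]
    rw [Submodule.span_le]
    rintro _ ⟨z, X, m, hm, rfl⟩
    change p.deriv _ ∈ ℬ.powFilt j n
    rw [deriv_eta, deriv_pow _ (j X).2]
    refine eta_mul_mem_powFilt j z (Submodule.sum_mem _ fun k hk => ?_)
    rcases eq_or_ne k m with rfl | hkm
    · simp [hp]
    · have hk' : k < m + 1 := by simpa using hk
      have : tgt ℬ.η (op (p.toLin ((j X : B) ^ (m - k)))) =
        ℬ.η (1 ⊗ₜ op (p.toLin ((j X : B) ^ (m - k)))) := rfl
      rw [this, ← Nat.cast_smul_eq_nsmul K]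
      exact Submodule.smul_mem _ _ (eta_mul_pow_mem j _ X (by omega))
  exact this hx

variable [CharZero K]

theorem deriv_pow_mul_mem_powFilt (hp : p.toLin 1 = 0) (z : Env K A) (X Y : L) {m n : ℕ}
    (h : m ≤ n) : p.deriv (ℬ.η z * (j X : B) ^ m) * (j Y : B) ∈ ℬ.powFilt j n := by
  rw [deriv_eta, deriv_pow _ (j X).2, mul_assoc, Finset.sum_mul]
  refine eta_mul_mem_powFilt j z (Submodule.sum_mem _ fun k hk => ?_)
  rcases eq_or_ne k m with rfl | hkm
  · simp [hp]
  · have hk' : k < m + 1 := by simpa using hk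
    have : tgt ℬ.η (op (p.toLin ((j X : B) ^ (m - k)))) =
      ℬ.η (1 ⊗ₜ op (p.toLin ((j X : B) ^ (m - k)))) := rfl
    rw [this, ← Nat.cast_smul_eq_nsmul K, smul_mul_assoc, mul_assoc]
    exact Submodule.smul_mem _ _ (eta_mul_pow_mul_mem_powFilt j _ X Y (by omega))

/-- Only the term `k = n` of the binomial sum reaches degree `n`; it is `(n + 1) c X ^ n`, with `c`
central because it comes from `K`. The remaining terms, multiplied by `Y`, still have degree at most
`n`. -/
theorem deriv_pow_succ_mul_sub_mem (hp : p.toLin 1 = 0) (X Y : L) (n : ℕ) {c : K}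
    (hc : p.toLin (j X : B) = algebraMap K A c) :
    p.deriv ((j X : B) ^ (n + 1)) * (j Y : B) -
      ((n + 1 : ℕ) : K) • ((j X : B) ^ n * (c • (j Y : B))) ∈ ℬ.powFilt j n := by
  rw [deriv_pow _ (j X).2, Finset.sum_range_succ, Finset.sum_range_succ, Nat.sub_self,
    Nat.add_sub_cancel_left, pow_zero, pow_one, hp, hc]
  have e : tgt ℬ.η (op (algebraMap K A c)) = algebraMap K B c := by
    rw [← AlgHom.commutes (tgt ℬ.η) c]
    rfl
  have e2 : (n + 1).choose n • (algebraMap K B c * (j X : B) ^ n) * (j Y : B) =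
      ((n + 1 : ℕ) : K) • ((j X : B) ^ n * (c • (j Y : B))) := by
    rw [Nat.choose_succ_self_right, ← Nat.cast_smul_eq_nsmul K, smul_mul_assoc,
      ← Algebra.smul_def, smul_mul_assoc, mul_smul_comm]
  rw [e, op_zero, map_zero, zero_mul, smul_zero, add_zero, add_mul, e2, add_sub_cancel_right,
    Finset.sum_mul]
  refine Submodule.sum_mem _ fun k hk => ?_
  have hk' : k < n := by simpa using hk
  have : tgt ℬ.η (op (p.toLin ((j X : B) ^ (n + 1 - k)))) =
    ℬ.η (1 ⊗ₜ op (p.toLin ((j X : B) ^ (n + 1 - k)))) := rfl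
  rw [this, ← Nat.cast_smul_eq_nsmul K, smul_mul_assoc, mul_assoc]
  exact Submodule.smul_mem _ _ (eta_mul_pow_mul_mem_powFilt j _ X Y (by omega))

end BimoduleFunctional

variable [CharZero K] {L : Type uL} [LieRing L] [LieAlgebra K L]

/-- Euler's identity `∑ ∂ᵢ(x) Xᵢ ≡ n x` modulo terms of degree less than `n`. -/
theorem euler_mem_powFilt (j : L →ₗ⁅K⁆ ℬ.prim) {I : Type*} (b : Module.Basis I K L)
    (p : I → BimoduleFunctional ℬ) (h1 : ∀ i, (p i).toLin 1 = 0)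
    (hp : ∀ i X, (p i).toLin (j X : B) = algebraMap K A (b.repr X i)) (n : ℕ) {x : B}
    (hx : x ∈ ℬ.powFilt j (n + 1)) :
    ∃ s : Finset I, ∀ t, s ⊆ t →
      ∑ i ∈ t, (p i).deriv x * (j (b i) : B) - ((n + 1 : ℕ) : K) • x ∈ ℬ.powFilt j n := by
  -- The basis may be infinite, so the sum runs over any finite set containing a large enough `s`;
  -- for a sum of two elements the union of their sets works.
  classical
  rw [powFilt] at hx
  induction hx using Submodule.span_induction with
  | zero => exact ⟨∅, fun t _ => by simp⟩
  | add x y _ _ hx hy =>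
    obtain ⟨s, hs⟩ := hx
    obtain ⟨s', hs'⟩ := hy
    refine ⟨s ∪ s', fun t ht => ?_⟩
    convert add_mem (hs t (Finset.union_subset_left ht)) (hs' t (Finset.union_subset_right ht))
      using 1
    simp only [map_add, add_mul, Finset.sum_add_distrib, smul_add]
    abel
  | smul c x _ hx =>
    obtain ⟨s, hs⟩ := hx
    refine ⟨s, fun t ht => ?_⟩
    convert Submodule.smul_mem _ c (hs t ht) using 1
    simp only [map_smul, smul_mul_assoc, smul_sub, Finset.smul_sum, smul_comm c]
  | mem x hx =>
    obtain ⟨z, X, m, hm, rfl⟩ := hx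
    rcases Nat.lt_or_ge m (n + 1) with h | h
    · refine ⟨∅, fun t _ => sub_mem (Submodule.sum_mem _ fun i _ =>
        (p i).deriv_pow_mul_mem_powFilt j (h1 i) z X (b i) (by omega))
        (Submodule.smul_mem _ _ (eta_mul_pow_mem j z X (by omega)))⟩
    · obtain rfl : m = n + 1 := by omega
      refine ⟨(b.repr X).support, fun t ht => ?_⟩
      -- The leading terms add up to `(n + 1) X ^ n ∑ cᵢ Xᵢ = (n + 1) X ^ (n + 1)`, where the `cᵢ`
      -- are the coordinates of `X`.
      have hX : (j X : B) = ∑ i ∈ t, b.repr X i • (j (b i) : B) := by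
        have h := b.linearCombination_repr X
        rw [Finsupp.linearCombination_apply, Finsupp.sum_of_support_subset _ ht _ (by simp)] at h
        conv_lhs => rw [← h]
        simp
      have hmem := eta_mul_mem_powFilt j z (Submodule.sum_mem _ fun i (_ : i ∈ t) =>
        (p i).deriv_pow_succ_mul_sub_mem j (h1 i) X (b i) n (hp i X))
      convert hmem using 1
      rw [Finset.sum_sub_distrib, ← Finset.smul_sum, ← Finset.mul_sum, ← hX, ← pow_succ, mul_sub,
        Finset.mul_sum, mul_smul_comm]
      simp only [BimoduleFunctional.deriv_eta, mul_assoc]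

/-- A morphism out of a bialgebroid generated by primitive elements is injective as soon as it is
so on `Aᵉ` and the functionals dual to a basis of these primitive elements extend. -/
theorem Hom.eq_zero_of_map_eq_zero (f : Hom 𝒞 ℬ) (hη : Function.Injective ℬ.η)
    (j : L →ₗ⁅K⁆ 𝒞.prim) {I : Type*} (b : Module.Basis I K L) (p : I → BimoduleFunctional ℬ)
    (h1 : ∀ i, (p i).toLin 1 = 0)
    (hp : ∀ i X, (p i).toLin (f.toAlgHom (j X : C)) = algebraMap K A (b.repr X i)) (n : ℕ) :
    ∀ x ∈ 𝒞.powFilt j n, f.toAlgHom x = 0 → x = 0 := by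
  induction n with
  | zero =>
    intro x hx h
    obtain ⟨z, rfl⟩ := (powFilt_zero j).1 hx
    rw [f.map_eta] at h
    rw [hη (h.trans (map_zero _).symm), map_zero]
  | succ n ih =>
    intro x hx h
    have h1' : ∀ i, ((p i).comap f).toLin 1 = 0 := fun i => by
      rw [BimoduleFunctional.comap_apply, map_one, h1]
    -- Each derivative of `x` is in the kernel by naturality and has degree at most `n`, so it
    -- vanishes by induction.
    have hd : ∀ i, ((p i).comap f).deriv x = 0 := by
      intro i
      refine ih _ (BimoduleFunctional.deriv_mem_powFilt _ j (h1' i) hx) ?_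
      rw [← BimoduleFunctional.deriv_map, h, map_zero]
    obtain ⟨s, hs⟩ := euler_mem_powFilt j b (fun i => (p i).comap f) h1' hp n hx
    -- Euler's identity now leaves only `(n + 1) x`, which puts `x` itself in degree `n`.
    have := hs s subset_rfl
    simp only [hd, zero_mul, Finset.sum_const_zero, zero_sub] at this
    rw [Submodule.neg_mem_iff, Submodule.smul_mem_iff _ (by exact_mod_cast n.succ_ne_zero)] at this
    exact ih x this h

end LeftBialgebroid
end
end ConnesMoscovici

namespace ConnesMoscovici

noncomputable section

open UniversalEnvelopingAlgebra (ι)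

/-! ### From the conditions to the isomorphism. -/

namespace LeftBialgebroid

variable {K : Type uK} {A : Type uA} {B : Type uB} [Field K] [Ring A] [Algebra K A]
  [Ring B] [Algebra K B] (ℬ : LeftBialgebroid K A B)

/-- The element of the `Aᵉ`-module `B` given by an element of `B`. -/
def ofB (x : B) : ℬ.AsModule := x

theorem ofB_add (x y : B) : ℬ.ofB (x + y) = ℬ.ofB x + ℬ.ofB y := rfl

theorem ofB_eta_mul (z : Env K A) (x : B) : ℬ.ofB (ℬ.η z * x) = z • ℬ.ofB x := rfl

theorem ofB_eta (z : Env K A) : ℬ.ofB (ℬ.η z) = z • ℬ.ofB 1 := by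
  rw [← ofB_eta_mul, mul_one]

theorem ofB_smul (c : K) (x : B) : ℬ.ofB (c • x) = algebraMap K (Env K A) c • ℬ.ofB x := by
  rw [← ofB_eta_mul, AlgHom.commutes, Algebra.smul_def]

theorem ofB_mem_envSpan {S : Set ℬ.prim} {X : ℬ.prim} (hX : X ∈ S) : ℬ.ofB X ∈ ℬ.envSpan S :=
  Submodule.subset_span ⟨X, hX, rfl⟩

theorem counit_envSpan {S : Set ℬ.prim} {x : ℬ.AsModule} (hx : x ∈ ℬ.envSpan S) :
    ℬ.counit (ℬ.toB x) = 0 := by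
  rw [envSpan] at hx
  induction hx using Submodule.span_induction with
  | mem x hx =>
    obtain ⟨X, _, h⟩ := hx
    rw [h]
    exact ℬ.counit_prim X.2
  | zero => exact map_zero ℬ.counit
  | add x y _ _ hx hy =>
    change ℬ.counit (ℬ.toB x + ℬ.toB y) = 0
    rw [map_add, hx, hy, add_zero]
  | smul z x _ hx => exact ℬ.counit_eta_mul_prim hx z

/-- On pure tensors `s(a) t(b) - s(a b) = -s(a) (s(b) - t(b))`. -/
theorem ofB_eta_sub_mem_envSpan (z : Env K A) :
    ℬ.ofB (ℬ.η z - src ℬ.η (ℬ.counit (ℬ.η z))) ∈ ℬ.envSpan ℬ.stSub := by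
  induction z using TensorProduct.induction_on with
  | zero =>
    rw [map_zero, map_zero, map_zero, sub_zero]
    exact zero_mem _
  | add z z' hz hz' =>
    convert add_mem hz hz' using 1
    rw [← ofB_add, map_add, map_add, map_add]
    congr 1
    abel
  | tmul a b =>
    have h := ℬ.counit_tgt_one b.unop
    rw [op_unop] at h
    rw [eta_tmul, ℬ.counit_src, h, map_mul, ← mul_sub]
    have hm : (⟨_, ℬ.src_sub_tgt_mem_prim b.unop⟩ : ℬ.prim) ∈ (ℬ.stSub : Set ℬ.prim) :=
      ⟨b.unop, rfl⟩
    have h2 := Submodule.smul_mem _ (-(a ⊗ₜ 1 : Env K A)) (ℬ.ofB_mem_envSpan hm)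
    rw [← ofB_eta_mul] at h2
    convert h2 using 2
    change _ = ℬ.η (-(a ⊗ₜ 1)) * (src ℬ.η b.unop - tgt ℬ.η b)
    rw [map_neg, eta_tmul, map_one, mul_one]
    noncomm_ring

variable {ℬ}

/-- The counit vanishes on `Aᵉ · L`, so an element `η(z)` of it lies in `Aᵉ · ⟨s - t⟩` by
`ofB_eta_sub_mem_envSpan`; (CM4) then makes it zero. -/
theorem span_one_inf_envSpan {L : LieSubalgebra K ℬ.prim} (h : ℬ.envSpan ℬ.stSub ⊓ ℬ.envSpan L = ⊥) :
    Submodule.span (Env K A) {ℬ.ofB 1} ⊓ ℬ.envSpan L = ⊥ := by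
  rw [eq_bot_iff]
  rintro x ⟨h1, h2⟩
  obtain ⟨z, rfl⟩ := Submodule.mem_span_singleton.1 h1
  rw [← h]
  refine ⟨?_, h2⟩
  have h3 := ℬ.ofB_eta_sub_mem_envSpan z
  have h4 := ℬ.counit_envSpan h2
  rw [← ofB_eta] at h4 ⊢
  change ℬ.counit (ℬ.η z) = 0 at h4
  rwa [h4, map_zero, sub_zero] at h3

/-- In the free case there is at least one basis vector, and the kernel of `η` annihilates it. -/
theorem MilnorMoore.injective_eta {L : LieSubalgebra K ℬ.prim} (h : ℬ.MilnorMoore L) :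
    Function.Injective ℬ.η := by
  rcases h.cm3 with h3 | ⟨h3, I, b, c, hc⟩
  · exact h3.2
  · rw [injective_iff_map_eq_zero]
    intro z hz
    have hI : Nonempty I := by
      by_contra hI
      rw [not_nonempty_iff] at hI
      apply h3
      rw [eq_bot_iff]
      intro x hx
      have := c.repr.injective (Subsingleton.elim (c.repr ⟨x, hx⟩) (c.repr 0))
      exact congrArg Subtype.val this
    obtain ⟨i⟩ := hI
    have h0 : z • c i = 0 := by
      apply Subtype.ext
      change ℬ.η z * ℬ.toB (c i) = 0
      rw [hz, zero_mul]
    have := congrArg (fun v => c.repr v i) h0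
    simpa using this

theorem MilnorMoore.exists_add {L : LieSubalgebra K ℬ.prim} (h : ℬ.MilnorMoore L) (X : ℬ.prim) :
    ∃ (Y : L) (a : A), (X : B) = (Y : ℬ.prim) + (src ℬ.η a - tgt ℬ.η (op a)) := by
  obtain ⟨δ, hδ, e, _, he⟩ := h.cm1
  obtain ⟨z, rfl⟩ := e.surjective X
  obtain ⟨a, ha⟩ := z.left.2
  refine ⟨z.right, a, ?_⟩
  refine (congrArg Subtype.val (he z)).trans ?_
  rw [← ha]
  rfl

variable [CharZero K]

/-- It allows a functional on degree at most one to be prescribed separately on `η(Aᵉ)` and on `Aᵉ ·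
L`. -/
theorem MilnorMoore.primFilt_one_le {L : LieSubalgebra K ℬ.prim} (h : ℬ.MilnorMoore L) :
    ℬ.primFilt 1 ≤ Submodule.span (Env K A) {ℬ.ofB 1} ⊔ ℬ.envSpan L := by
  intro x hx
  rw [mem_primFilt_iff L.incl h.exists_add] at hx
  have key : ∀ y ∈ ℬ.powFilt L.incl 1,
      ℬ.ofB y ∈ Submodule.span (Env K A) {ℬ.ofB 1} ⊔ ℬ.envSpan L := by
    intro y hy
    rw [powFilt] at hy
    induction hy using Submodule.span_induction with
    | zero => exact zero_mem _
    | add x y _ _ hx hy => exact add_mem hx hy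
    | smul c x _ hx =>
      rw [ofB_smul]
      exact Submodule.smul_mem _ _ hx
    | mem x hx =>
      obtain ⟨z, X, m, hm, rfl⟩ := hx
      rw [ofB_eta_mul]
      refine Submodule.smul_mem _ _ ?_
      interval_cases m
      · rw [pow_zero]
        exact Submodule.mem_sup_left (Submodule.mem_span_singleton_self _)
      · rw [pow_one]
        exact Submodule.mem_sup_right (ℬ.ofB_mem_envSpan X.2)
  exact key _ hx

theorem MilnorMoore.monotone_primFilt {L : LieSubalgebra K ℬ.prim} (h : ℬ.MilnorMoore L) :
    Monotone ℬ.primFilt := by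
  intro m n hmn x hx
  rw [mem_primFilt_iff L.incl h.exists_add] at hx ⊢
  exact powFilt_mono _ hmn hx

/-- The coordinates with respect to a basis of `L` extend to `Aᵉ`-linear functionals on `B`. -/
theorem MilnorMoore.exists_functionals {L : LieSubalgebra K ℬ.prim} (h : ℬ.MilnorMoore L) :
    ∃ (I : Type uB) (b : Module.Basis I K L) (π : I → ℬ.AsModule →ₗ[Env K A] Env K A),
      (∀ i, π i (ℬ.ofB 1) = 0) ∧
      ∀ i (X : L), π i (ℬ.ofB (X : ℬ.prim)) = algebraMap K (Env K A) (b.repr X i) := by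
  classical
  rcases h.cm3 with h3 | ⟨h3, I, b, c, hc⟩
  -- If `Aᵉ · L = 0` then `L = 0`, and the empty family of functionals is enough.
  · have : Subsingleton L := by
      refine ⟨fun X Y => ?_⟩
      have h0 : ∀ X : L, X = 0 := by
        intro X
        have := ℬ.ofB_mem_envSpan (S := L) X.2
        rw [h3.1] at this
        exact Subtype.ext (Subtype.ext this)
      rw [h0 X, h0 Y]
    exact ⟨PEmpty, Module.Basis.empty L, PEmpty.elim, fun i => i.elim, fun i => i.elim⟩
  · have hex : ∀ i, ∃ π : ℬ.AsModule →ₗ[Env K A] Env K A, π (ℬ.ofB 1) = 0 ∧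
        ∀ x : ℬ.envSpan L, π x = c.coord i x := by
      intro i
      -- The functional is zero on `η(Aᵉ)` and the `i`-th coordinate on `Aᵉ · L`; these two pieces
      -- glue because their domains meet in zero.
      let f : ℬ.AsModule →ₗ.[Env K A] Env K A := ⟨Submodule.span (Env K A) {ℬ.ofB 1}, 0⟩
      let g : ℬ.AsModule →ₗ.[Env K A] Env K A := ⟨ℬ.envSpan L, c.coord i⟩
      have hfg : ∀ (x : f.domain) (y : g.domain), (x : ℬ.AsModule) = y → f x = g y := by
        intro x y hxy
        have hx : (x : ℬ.AsModule) = 0 := by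
          have : (x : ℬ.AsModule) ∈ Submodule.span (Env K A) {ℬ.ofB 1} ⊓ ℬ.envSpan L :=
            ⟨x.2, hxy ▸ y.2⟩
          rwa [span_one_inf_envSpan h.cm4, Submodule.mem_bot] at this
        have hy : y = 0 := Subtype.ext (hxy.symm.trans hx)
        rw [hy, LinearPMap.map_zero]
        rfl
      obtain ⟨π, hπ⟩ := exists_extend_of_filtration ℬ.primFilt h.monotone_primFilt
        (fun n => h.cm2.1 (n + 1)) h.cm2.2
        ((f.sup g hfg).toFun ∘ₗ Submodule.inclusion (h.primFilt_one_le))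
      have hmem : ∀ y, y ∈ ℬ.powFilt L.incl 1 → ℬ.ofB y ∈ ℬ.primFilt 1 := fun y hy =>
        (mem_primFilt_iff L.incl h.exists_add).2 hy
      have hle : ℬ.envSpan L ≤ ℬ.primFilt 1 := by
        rw [envSpan, Submodule.span_le]
        rintro x ⟨X, hX, hx⟩
        refine hmem x ?_
        have := eta_mul_pow_mem (ℬ := ℬ) L.incl 1 ⟨X, hX⟩ (le_refl 1)
        rw [map_one, one_mul, pow_one] at this
        change ℬ.toB x ∈ _
        rwa [hx]
      refine ⟨π, ?_, fun x => ?_⟩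
      · have h1 : ℬ.ofB 1 ∈ ℬ.primFilt 1 := hmem 1 (by
          simpa using eta_mem_powFilt (ℬ := ℬ) L.incl 1 1)
        refine (hπ ⟨_, h1⟩).trans ?_
        have := LinearPMap.sup_apply (f := f) (g := g) hfg ⟨_, Submodule.mem_span_singleton_self _⟩ 0
          ⟨ℬ.ofB 1, h.primFilt_one_le h1⟩ (add_zero _)
        refine this.trans ?_
        rw [LinearPMap.map_zero, add_zero]
        rfl
      · refine (hπ ⟨x, hle x.2⟩).trans ?_
        have := LinearPMap.sup_apply (f := f) (g := g) hfg 0 x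
          ⟨x, h.primFilt_one_le (hle x.2)⟩ (zero_add _)
        refine this.trans ?_
        rw [LinearPMap.map_zero, zero_add]
        rfl
    choose π hπ1 hπ2 using hex
    refine ⟨I, b, π, hπ1, fun i X => ?_⟩
    have hb : ∀ k, π i (ℬ.ofB (b k : ℬ.prim)) = if k = i then 1 else 0 := by
      intro k
      have : ℬ.ofB (b k : ℬ.prim) = (c k : ℬ.AsModule) := (hc k).symm
      rw [this, hπ2, Module.Basis.coord_apply, Module.Basis.repr_self, Finsupp.single_apply]
    have hlin : ∃ φ : L →ₗ[K] Env K A, ∀ X : L, φ X = π i (ℬ.ofB (X : ℬ.prim)) :=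
      ⟨⟨⟨fun X => π i (ℬ.ofB (X : ℬ.prim)), fun X Y => map_add (π i) _ _⟩, fun r X => by
        change π i (ℬ.ofB (r • ((X : ℬ.prim) : B))) = r • _
        rw [ofB_smul, map_smul, algebraMap_smul]⟩, fun X => rfl⟩
    -- The value on all of `L` follows from the values on the basis once `π i` is restricted to a
    -- `K`-linear map on `L`.
    obtain ⟨φ, hφ⟩ := hlin
    have : φ = (Algebra.linearMap K (Env K A)) ∘ₗ b.coord i := by
      refine b.ext fun k => ?_
      rw [hφ, hb, LinearMap.comp_apply, Module.Basis.coord_apply, Module.Basis.repr_self,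
        Finsupp.single_apply]
      split_ifs <;> simp [Algebra.TensorProduct.one_def]
    rw [← hφ, this]
    rfl

variable (ℬ) in
/-- The bimodule functional attached to an `Aᵉ`-linear map `B → Aᵉ`. -/
def bimoduleFunctional (π : ℬ.AsModule →ₗ[Env K A] Env K A) : BimoduleFunctional ℬ where
  toLin :=
    { toFun := fun x => envMul K A (π (ℬ.ofB x))
      map_add' := fun x y => by rw [ofB_add, map_add, map_add]
      map_smul' := fun c x => by
        rw [ofB_smul, map_smul, algebraMap_smul, map_smul, RingHom.id_apply] }
  map_src a x := by
    change envMul K A (π (ℬ.ofB (src ℬ.η a * x))) = a * envMul K A (π (ℬ.ofB x))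
    rw [← envMul_left]
    exact congrArg (envMul K A) (π.map_smul (a ⊗ₜ 1) (ℬ.ofB x))
  map_tgt a x := by
    change envMul K A (π (ℬ.ofB (tgt ℬ.η (op a) * x))) = envMul K A (π (ℬ.ofB x)) * a
    rw [← envMul_right]
    exact congrArg (envMul K A) (π.map_smul (1 ⊗ₜ op a) (ℬ.ofB x))

/-- The bialgebroids satisfying the conditions are Connes–Moscovici bialgebroids. -/
theorem MilnorMoore.isomorphic {L : Type uL} [LieRing L] [LieAlgebra K L] {ω : L →ₗ⁅K⁆ Der K A}
    {j : L →ₗ⁅K⁆ ℬ.prim} (hinj : Function.Injective j) (hj : ∀ X, ℬ.anchor (j X) = ω X)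
    (h : ℬ.MilnorMoore j.range) : ℬ.Isomorphic (connesMoscovici ω) := by
  refine (ofCM ω hj).isomorphic ⟨?_, ?_⟩
  · obtain ⟨I, b, π, h1, hπ⟩ := h.exists_functionals
    let e : L ≃ₗ[K] j.range := LinearEquiv.ofInjective j.toLinearMap hinj
    rw [injective_iff_map_eq_zero]
    intro x hx
    obtain ⟨n, hn⟩ := CM.exists_mem_powFilt ω x
    refine (ofCM ω hj).eq_zero_of_map_eq_zero h.injective_eta (CM.prim ω) (b.map e.symm)
      (fun i => ℬ.bimoduleFunctional (π i)) (fun i => ?_) (fun i X => ?_) n x hn hx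
    · change envMul K A (π i (ℬ.ofB 1)) = 0
      rw [h1, map_zero]
    · have h2 : (ofCM ω hj).toAlgHom (CM.prim ω X : CM ω) = j X := ofCMAlgHom_mid_ι hj X
      rw [h2]
      change envMul K A (π i (ℬ.ofB ((e X : ℬ.prim) : B))) = _
      rw [hπ, Algebra.algebraMap_eq_smul_one, map_smul, Algebra.TensorProduct.one_def, envMul_tmul]
      simp [Algebra.algebraMap_eq_smul_one]
  -- For surjectivity, each `η(z) j(X) ^ m` in the primitive filtration is the image of the
  -- corresponding element with `X ∈ L`.
  · intro x
    obtain ⟨n, hn⟩ := h.cm2.2 (ℬ.ofB x)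
    have hj' : ∀ X : ℬ.prim, ∃ (Y : L) (a : A),
        (X : B) = j Y + (src ℬ.η a - tgt ℬ.η (op a)) := by
      intro X
      obtain ⟨⟨_, Y, rfl⟩, a, ha⟩ := h.exists_add X
      exact ⟨Y, a, ha⟩
    rw [mem_primFilt_iff j hj'] at hn
    have : ℬ.powFilt j n ≤ LinearMap.range (ofCM ω hj).toAlgHom.toLinearMap := by
      rw [powFilt, Submodule.span_le]
      rintro _ ⟨z, X, m, hm, rfl⟩
      refine ⟨(connesMoscovici ω).η z * CM.mid ω (ι K X) ^ m, ?_⟩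
      have h2 : (ofCM ω hj).toAlgHom (CM.mid ω (ι K X)) = j X := ofCMAlgHom_mid_ι hj X
      rw [AlgHom.toLinearMap_apply, map_mul, map_pow, h2, Hom.map_eta]
    exact this hn

end LeftBialgebroid
end
end ConnesMoscovici

namespace ConnesMoscovici

noncomputable section

open UniversalEnvelopingAlgebra (ι)

namespace CM

variable {K : Type uK} {A : Type uA} {L : Type uL} [Field K] [Ring A] [Algebra K A]
  [LieRing L] [LieAlgebra K L] (ω : L →ₗ⁅K⁆ Der K A)

/-! ### Primitive elements of the Connes–Moscovici bialgebroid. -/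

section Slices

variable (φ : A →ₗ[K] K)

/-- `a ⊗ u ⊗ b ↦ φ(c a) (u ⊗ b)`. -/
def sliceLeft : A →ₗ[K] CM ω →ₗ[K] UniversalEnvelopingAlgebra K L ⊗[K] A :=
  LinearMap.mk₂ K
    (fun c z => lift₃ ω (LinearMap.mk₂ K
      (fun a u => φ (c * a) • TensorProduct.mk K (UniversalEnvelopingAlgebra K L) A u)
      (by intros; ext; simp [mul_add, add_smul]) (by intros; ext; simp [mul_smul])
      (by intros; ext; simp) (by intros; ext; simp [smul_smul, mul_comm])) z)
    (fun c c' z => by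
      rw [← LinearMap.add_apply]
      refine LinearMap.congr_fun (hom_ext ?_) z
      intros; simp [add_mul, add_smul])
    (fun r c z => by
      rw [← LinearMap.smul_apply]
      refine LinearMap.congr_fun (hom_ext ?_) z
      intros; simp [mul_smul])
    (by intros; simp) (by intros; simp)

theorem sliceLeft_pure (c a : A) (u : UniversalEnvelopingAlgebra K L) (b : A) :
    sliceLeft ω φ c (pure ω a u b) = φ (c * a) • (u ⊗ₜ[K] b) := rfl

theorem sliceLeft_mul (c d : A) (z : CM ω) :
    sliceLeft ω φ (c * d) z = sliceLeft ω φ c (mulL ω d z) := by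
  have : sliceLeft ω φ (c * d) = sliceLeft ω φ c ∘ₗ mulL ω d :=
    hom_ext (by intros; simp [sliceLeft_pure, mul_assoc])
  exact LinearMap.congr_fun this z

/-- `(b, z) ↦ w ⊗ sliceLeft(b, z)`. -/
def tmulSlice : A ⊗[K] UniversalEnvelopingAlgebra K L →ₗ[K] A →ₗ[K] CM ω →ₗ[K]
    (A ⊗[K] UniversalEnvelopingAlgebra K L) ⊗[K] (UniversalEnvelopingAlgebra K L ⊗[K] A) where
  toFun w := (sliceLeft ω φ).compr₂ (TensorProduct.mk K (A ⊗[K] UniversalEnvelopingAlgebra K L)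
    (UniversalEnvelopingAlgebra K L ⊗[K] A) w)
  map_add' w w' := by
    refine LinearMap.ext fun b => LinearMap.ext fun z => ?_
    exact TensorProduct.add_tmul _ _ _
  map_smul' r w := by
    refine LinearMap.ext fun b => LinearMap.ext fun z => ?_
    exact (TensorProduct.smul_tmul' _ _ _).symm

/-- The bilinear map `(a ⊗ u ⊗ b, a' ⊗ u' ⊗ b') ↦ φ(b a') (a ⊗ u) ⊗ (u' ⊗ b')`. -/
def contract₂ : CM ω →ₗ[K] CM ω →ₗ[K] (A ⊗[K] UniversalEnvelopingAlgebra K L) ⊗[K]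
    (UniversalEnvelopingAlgebra K L ⊗[K] A) :=
  lift₃ ω (M := CM ω →ₗ[K] (A ⊗[K] UniversalEnvelopingAlgebra K L) ⊗[K]
    (UniversalEnvelopingAlgebra K L ⊗[K] A))
    ((TensorProduct.mk K A (UniversalEnvelopingAlgebra K L)).compr₂ (tmulSlice ω φ))

theorem contract₂_pure (a : A) (u : UniversalEnvelopingAlgebra K L) (b : A) (z : CM ω) :
    contract₂ ω φ (pure ω a u b) z = (a ⊗ₜ u) ⊗ₜ sliceLeft ω φ b z := rfl

/-- The map `B ⊗_A B → (A ⊗ U(L)) ⊗ (U(L) ⊗ A)` contracting the two inner factors `A` by `φ`. -/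
def contract : Tens (eta ω) →ₗ[K] (A ⊗[K] UniversalEnvelopingAlgebra K L) ⊗[K]
    (UniversalEnvelopingAlgebra K L ⊗[K] A) :=
  tensLift (eta ω) (contract₂ ω φ) (by
    intro c x y
    rw [tgt_eta_mul, src_eta_mul]
    have : (contract₂ ω φ).flip y ∘ₗ mulR ω c = (contract₂ ω φ).flip (mulL ω c y) := hom_ext (by
      intro a u b
      rw [LinearMap.comp_apply, mulR_pure, LinearMap.flip_apply, contract₂_pure,
        LinearMap.flip_apply, contract₂_pure, sliceLeft_mul])
    exact LinearMap.congr_fun this x)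

theorem contract_tens (a : A) (u : UniversalEnvelopingAlgebra K L) (b a' : A)
    (u' : UniversalEnvelopingAlgebra K L) (b' : A) :
    contract ω φ (tens (eta ω) (pure ω a u b) (pure ω a' u' b')) =
      φ (b * a') • ((a ⊗ₜ u) ⊗ₜ (u' ⊗ₜ b')) := by
  rw [contract, tensLift_tens, contract₂_pure, sliceLeft_pure, TensorProduct.tmul_smul]

/-- `(a ⊗ u) ⊗ (v ⊗ b) ↦ a ⊗ f(u ⊗ v) ⊗ b`. -/
def insertMid (f : UniversalEnvelopingAlgebra K L ⊗[K] UniversalEnvelopingAlgebra K L →ₗ[K]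
    UniversalEnvelopingAlgebra K L) : (A ⊗[K] UniversalEnvelopingAlgebra K L) ⊗[K]
    (UniversalEnvelopingAlgebra K L ⊗[K] A) →ₗ[K] CM ω :=
  LinearMap.lTensor A (LinearMap.rTensor A f ∘ₗ
    (TensorProduct.assoc K (UniversalEnvelopingAlgebra K L) (UniversalEnvelopingAlgebra K L)
      A).symm.toLinearMap) ∘ₗ
    (TensorProduct.assoc K A (UniversalEnvelopingAlgebra K L)
      (UniversalEnvelopingAlgebra K L ⊗[K] A)).toLinearMap

theorem insertMid_tmul (f : UniversalEnvelopingAlgebra K L ⊗[K] UniversalEnvelopingAlgebra K L →ₗ[K]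
    UniversalEnvelopingAlgebra K L) (a b : A) (u v : UniversalEnvelopingAlgebra K L) :
    insertMid ω f ((a ⊗ₜ u) ⊗ₜ (v ⊗ₜ b)) = pure ω a (f (u ⊗ₜ v)) b := rfl

/-- The inner factors of `Δ(a ⊗ u ⊗ b)` are both `1`, so contraction by `φ` loses nothing, and `f`
undoes the comultiplication of `U(L)`. -/
theorem insertMid_comul (hφ : φ 1 = 1)
    (f : UniversalEnvelopingAlgebra K L ⊗[K] UniversalEnvelopingAlgebra K L →ₗ[K]
      UniversalEnvelopingAlgebra K L) (hf : ∀ u, f (comulU K L u) = u) (x : CM ω) :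
    insertMid ω f (contract ω φ (comul ω x)) = x := by
  have : insertMid ω f ∘ₗ contract ω φ ∘ₗ comul ω = LinearMap.id := hom_ext (by
    intro a u b
    have h : insertMid ω f ∘ₗ contract ω φ ∘ₗ comulPair ω a b = (pure₃ ω a).flip b ∘ₗ f := by
      apply TensorProduct.ext'
      intro v w
      simp only [LinearMap.comp_apply, comulPair_tmul, contract_tens, mul_one, hφ, one_smul,
        insertMid_tmul]
      rfl
    have h2 := LinearMap.congr_fun h (comulU K L u)
    simp only [LinearMap.comp_apply, hf] at h2
    exact h2)
  exact LinearMap.congr_fun this x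

variable (K L) in
/-- `ε ⊗ id : U(L) ⊗ U(L) → U(L)`. -/
def counitLeft : UniversalEnvelopingAlgebra K L ⊗[K] UniversalEnvelopingAlgebra K L →ₗ[K]
    UniversalEnvelopingAlgebra K L :=
  (TensorProduct.lid K _).toLinearMap ∘ₗ LinearMap.rTensor _ (counitU K L).toLinearMap

variable (K L) in
/-- `id ⊗ ε : U(L) ⊗ U(L) → U(L)`. -/
def counitRight : UniversalEnvelopingAlgebra K L ⊗[K] UniversalEnvelopingAlgebra K L →ₗ[K]
    UniversalEnvelopingAlgebra K L :=
  (TensorProduct.rid K _).toLinearMap ∘ₗ LinearMap.lTensor _ (counitU K L).toLinearMap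

theorem counitLeft_tmul (u v : UniversalEnvelopingAlgebra K L) :
    counitLeft K L (u ⊗ₜ v) = counitU K L u • v := by simp [counitLeft]

theorem counitRight_tmul (u v : UniversalEnvelopingAlgebra K L) :
    counitRight K L (u ⊗ₜ v) = counitU K L v • u := by simp [counitRight]

theorem counitLeft_comulU (u : UniversalEnvelopingAlgebra K L) :
    counitLeft K L (comulU K L u) = u := AlgHom.congr_fun (counitU_comulU K (L := L)) u

theorem counitRight_comulU (u : UniversalEnvelopingAlgebra K L) :
    counitRight K L (comulU K L u) = u := AlgHom.congr_fun (comulU_counitU K (L := L)) u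

/-- `a ⊗ u ⊗ b ↦ φ(a) φ(b) u`. -/
def sliceMid : CM ω →ₗ[K] UniversalEnvelopingAlgebra K L :=
  (TensorProduct.rid K _).toLinearMap ∘ₗ LinearMap.lTensor _ φ ∘ₗ sliceLeft ω φ 1

theorem sliceMid_pure (a : A) (u : UniversalEnvelopingAlgebra K L) (b : A) :
    sliceMid ω φ (pure ω a u b) = φ a • φ b • u := by
  simp [sliceMid, sliceLeft_pure]

theorem mid_injective (hφ : φ 1 = 1) : Function.Injective (mid ω) := by
  intro u v h
  have := congrArg (sliceMid ω φ) h
  simpa [mid_apply, sliceMid_pure, hφ] using this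

variable {φ} (hφ : φ 1 = 1)
include hφ

/-- A primitive element is a sum of elements of `A ⊗ 1 ⊗ 1`, `1 ⊗ U(L) ⊗ 1` and `1 ⊗ 1 ⊗ A`. -/
theorem exists_eq_of_mem_prim {x : CM ω} (hx : x ∈ (connesMoscovici ω).prim) :
    ∃ (c : A) (v : UniversalEnvelopingAlgebra K L) (d : A),
      x = src (eta ω) c + mid ω v + tgt (eta ω) (op d) := by
  have hx' : comul ω x = tens (eta ω) x 1 + tens (eta ω) 1 x := hx
  -- Reconstructing `x` from `Δ(x) = x ⊗ 1 + 1 ⊗ x` with either counit gives two formulas. The first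
  -- is `x = σ(x) + 1 ⊗ 1 ⊗ β(x)`, the second has `α(x) ⊗ 1 ⊗ 1` and a term depending on `1 ⊗ x`.
  have h1 := insertMid_comul ω φ hφ (counitRight K L) counitRight_comulU x
  have h2 := insertMid_comul ω φ hφ (counitLeft K L) counitLeft_comulU x
  rw [hx', map_add, map_add] at h1 h2
  obtain ⟨α, hα⟩ : ∃ α : CM ω →ₗ[K] A, ∀ a u b, α (pure ω a u b) = counitU K L u • φ b • a :=
    ⟨(TensorProduct.rid K A).toLinearMap ∘ₗ LinearMap.lTensor A
      ((TensorProduct.lid K K).toLinearMap ∘ₗ TensorProduct.map (counitU K L).toLinearMap φ),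
      fun a u b => by
        change (TensorProduct.rid K A) (a ⊗ₜ ((TensorProduct.lid K K) (counitU K L u ⊗ₜ φ b))) = _
        simp [smul_smul]⟩
  obtain ⟨β, hβ⟩ : ∃ β : CM ω →ₗ[K] A, ∀ a u b, β (pure ω a u b) = counitU K L u • φ a • b :=
    ⟨(TensorProduct.lid K A).toLinearMap ∘ₗ LinearMap.rTensor A (counitU K L).toLinearMap ∘ₗ
      sliceLeft ω φ 1,
      fun a u b => by
        simp [sliceLeft_pure, smul_smul, mul_comm]⟩
  obtain ⟨σ, hσ⟩ : ∃ σ : CM ω →ₗ[K] CM ω, ∀ a u b, σ (pure ω a u b) = φ b • pure ω a u 1 :=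
    ⟨lift₃ ω (LinearMap.mk₂ K (fun a u => φ.smulRight (pure ω a u 1))
      (by intros; ext; simp [← pure₃_apply]) (by intros; ext; simp [← pure₃_apply, smul_smul, mul_comm])
      (by intros; ext; simp [← pure₃_apply]) (by intros; ext; simp [← pure₃_apply, smul_smul, mul_comm])),
      fun a u b => rfl⟩
  have e1 : insertMid ω (counitRight K L) ∘ₗ contract ω φ ∘ₗ (tens (eta ω)).flip 1 = σ :=
    hom_ext (by
      intro a u b
      rw [LinearMap.comp_apply, LinearMap.comp_apply, LinearMap.flip_apply, one_def, contract_tens,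
        mul_one, map_smul, insertMid_tmul, counitRight_tmul, map_one, one_smul, hσ])
  have e2 : insertMid ω (counitRight K L) ∘ₗ contract ω φ ∘ₗ tens (eta ω) 1 =
      (pure₃ ω 1 1) ∘ₗ β := hom_ext (by
      intro a u b
      rw [LinearMap.comp_apply, LinearMap.comp_apply, one_def, contract_tens,
        one_mul, map_smul, insertMid_tmul, counitRight_tmul, LinearMap.comp_apply, hβ]
      simp [← pure₃_apply, smul_smul, mul_comm])
  have e3 : insertMid ω (counitLeft K L) ∘ₗ contract ω φ ∘ₗ (tens (eta ω)).flip 1 =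
      ((pure₃ ω).flip 1).flip 1 ∘ₗ α := hom_ext (by
      intro a u b
      rw [LinearMap.comp_apply, LinearMap.comp_apply, LinearMap.flip_apply, one_def, contract_tens,
        mul_one, map_smul, insertMid_tmul, counitLeft_tmul, LinearMap.comp_apply, hα]
      simp [← pure₃_apply, smul_smul, mul_comm])
  have e4 : insertMid ω (counitLeft K L) ∘ₗ contract ω φ ∘ₗ tens (eta ω) 1 ∘ₗ σ =
      (mid ω).toLinearMap ∘ₗ sliceMid ω φ := hom_ext (by
      intro a u b
      rw [LinearMap.comp_apply, LinearMap.comp_apply, LinearMap.comp_apply, hσ, map_smul, one_def,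
        map_smul, contract_tens,
        one_mul, map_smul, map_smul, insertMid_tmul, counitLeft_tmul, LinearMap.comp_apply,
        sliceMid_pure, map_one, one_smul, AlgHom.toLinearMap_apply, map_smul, map_smul, mid_apply,
        smul_comm])
  have e5 : insertMid ω (counitLeft K L) ∘ₗ contract ω φ ∘ₗ tens (eta ω) 1 ∘ₗ pure₃ ω 1 1 =
      pure₃ ω 1 1 := by
    ext b
    change insertMid ω (counitLeft K L) (contract ω φ (tens (eta ω) (pure ω 1 1 1) (pure ω 1 1 b))) =
      pure ω 1 1 b
    rw [contract_tens, mul_one, hφ, one_smul, insertMid_tmul, counitLeft_tmul, map_one, one_smul]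
  have e1' := LinearMap.congr_fun e1 x
  have e2' := LinearMap.congr_fun e2 x
  have e3' := LinearMap.congr_fun e3 x
  have e4' := LinearMap.congr_fun e4 x
  have e5' := LinearMap.congr_fun e5 (β x)
  simp only [LinearMap.comp_apply, LinearMap.flip_apply] at e1' e2' e3' e4' e5'
  rw [e1', e2'] at h1
  rw [e3'] at h2
  refine ⟨α x, sliceMid ω φ x, β x, ?_⟩
  rw [src_eta, tgt_eta]
  -- Inserting the first formula into the term with `1 ⊗ x` of the second separates the middle part
  -- from the right part.
  have h3 := congrArg (fun w => insertMid ω (counitLeft K L) (contract ω φ (tens (eta ω) 1 w))) h1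
  simp only [map_add] at h3
  rw [e5', e4'] at h3
  rw [← h3, ← add_assoc] at h2
  exact h2.symm

/-- The primitive elements of `A ⊙ U(L) ⊙ A` are the sums of an element of `L` and some
`s(a) - t(a)`. -/
theorem exists_eq_add_of_mem_prim [CharZero K] {x : CM ω} (hx : x ∈ (connesMoscovici ω).prim) :
    ∃ (Y : L) (a : A), x = mid ω (ι K Y) + (src (eta ω) a - tgt (eta ω) (op a)) := by
  have hx' : comul ω x = tens (eta ω) x 1 + tens (eta ω) 1 x := hx
  obtain ⟨c, v, d, h⟩ : ∃ (c : A) (v : UniversalEnvelopingAlgebra K L) (d : A),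
      x = src (eta ω) c + mid ω v + tgt (eta ω) (op d) ∧ counitU K L v = 0 := by
    obtain ⟨c, v, d, h⟩ := exists_eq_of_mem_prim ω hφ hx
    -- The constant term of `v` is absorbed into `c`, so that `ε(v) = 0`.
    refine ⟨c + algebraMap K A (counitU K L v), v - algebraMap K _ (counitU K L v), d, ?_, ?_⟩
    · rw [h, map_add, map_sub, AlgHom.commutes, AlgHom.commutes]
      abel
    · rw [map_sub, AlgHom.commutes]
      exact sub_self _
  have hs := comul_src ω c 1
  have ht := comul_tgt ω d 1
  rw [mul_one, comul_one, tensActL_tens, mul_one] at hs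
  rw [mul_one, comul_one, tensActR_tens, mul_one] at ht
  have hb := tens_balanced (eta ω) d 1 1
  rw [mul_one, mul_one] at hb
  have hv : comul ω (mid ω v) = tens (eta ω) (mid ω v) 1 + tens (eta ω) 1 (mid ω v) +
      tens (eta ω) 1 (src (eta ω) (c + d)) := by
    rw [h.1] at hx'
    simp only [map_add, hs, ht, LinearMap.add_apply, hb] at hx' ⊢
    have := sub_eq_zero.2 hx'
    rw [← sub_eq_zero, ← this]
    abel
  -- Applying `ε ⊗_A B` to `hv` returns `v = v + s(c + d)`, and `ε` recovers `c + d` from `s(c +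
  -- d)`.
  have hcd : c + d = 0 := by
    have h1 := counit_comul ω (mid ω v)
    rw [hv] at h1
    have h3 : counit ω (mid ω v) = 0 := by rw [mid_apply, counit_pure, h.2, zero_smul]
    have h4 : counit ω 1 = 1 := (connesMoscovici ω).counit_one
    simp only [map_add, counitTens_tens, h3, h4, map_zero, zero_mul, zero_add, map_one, one_mul,
      add_eq_left] at h1
    have h5 := congrArg (counit ω) h1
    rw [← map_add, map_zero] at h5
    exact ((connesMoscovici ω).counit_src_one (c + d)).symm.trans h5
  rw [hcd, map_zero, map_zero, add_zero] at hv
  have hprim : comulU K L v = v ⊗ₜ 1 + 1 ⊗ₜ v := by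
    -- `W` removes the two outer factors `A` by means of `φ`, which carries the primitivity of `1 ⊗
    -- v ⊗ 1` over to `v` in `U(L)`.
    let W : (A ⊗[K] UniversalEnvelopingAlgebra K L) ⊗[K] (UniversalEnvelopingAlgebra K L ⊗[K] A) →ₗ[K]
        UniversalEnvelopingAlgebra K L ⊗[K] UniversalEnvelopingAlgebra K L :=
      TensorProduct.map ((TensorProduct.lid K _).toLinearMap ∘ₗ LinearMap.rTensor _ φ)
        ((TensorProduct.rid K _).toLinearMap ∘ₗ LinearMap.lTensor _ φ)
    have hW : ∀ a u u' b, W ((a ⊗ₜ u) ⊗ₜ (u' ⊗ₜ b)) = (φ a • u) ⊗ₜ (φ b • u') := by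
      intro a u u' b
      simp [W]
    have h1 : W ∘ₗ contract ω φ ∘ₗ comulPair ω 1 1 = LinearMap.id := by
      apply TensorProduct.ext'
      intro u u'
      simp only [LinearMap.comp_apply, comulPair_tmul, contract_tens, mul_one, hφ, one_smul, hW,
        LinearMap.id_apply]
    have h2 := congrArg (fun w => W (contract ω φ w)) hv
    simp only [mid_apply, comul_pure, map_add, one_def, contract_tens, mul_one, hφ, one_smul,
      hW] at h2
    rw [← h2]
    exact (LinearMap.congr_fun h1 (comulU K L v)).symm
  obtain ⟨Y, hY⟩ := mem_ιRange_of_primitive hprim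
  refine ⟨Y, c, ?_⟩
  have hd : d = -c := by rw [eq_neg_iff_add_eq_zero, add_comm, hcd]
  rw [h.1, hd, op_neg, map_neg, ← hY]
  change _ + mid ω (ι K Y) + _ = _
  abel

end Slices

/-! ### Coordinates in `Aᵉ ⊗ V`. -/

section Coordinates

variable {V : Type*} [AddCommGroup V] [Module K V] (q : UniversalEnvelopingAlgebra K L →ₗ[K] V)

/-- The map `A ⊙ U(L) ⊙ A → Aᵉ ⊗ V`, `a ⊗ u ⊗ b ↦ (a ⊗ b) ⊗ q(u)`. -/
def coord : CM ω →ₗ[K] Env K A ⊗[K] V :=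
  lift₃ ω (LinearMap.mk₂ K
    (fun a u => (TensorProduct.mk K (Env K A) V).flip (q u) ∘ₗ TensorProduct.mk K A Aᵐᵒᵖ a ∘ₗ
      (opLinearEquiv K).toLinearMap)
    (by intros; ext; simp [])
    (by intros; ext; simp)
    (by intros; ext; simp)
    (by intros; ext; simp))

theorem coord_pure (a : A) (u : UniversalEnvelopingAlgebra K L) (b : A) :
    coord ω q (pure ω a u b) = (a ⊗ₜ op b) ⊗ₜ q u := rfl

theorem coord_eta_mul (z : Env K A) (x : CM ω) : coord ω q (eta ω z * x) = z • coord ω q x := by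
  induction z using TensorProduct.induction_on with
  | zero => simp
  | add z z' hz hz' => rw [map_add, add_mul, map_add, hz, hz', add_smul]
  | tmul a b =>
    have hs : ∀ x, coord ω q (mulL ω a x) = (a ⊗ₜ 1 : Env K A) • coord ω q x := by
      intro x
      have : coord ω q ∘ₗ mulL ω a =
          (DistribSMul.toLinearMap K (Env K A ⊗[K] V) (a ⊗ₜ 1 : Env K A)) ∘ₗ coord ω q :=
        hom_ext (by
          intro a' u b'
          simp [coord_pure, TensorProduct.smul_tmul'])
      exact LinearMap.congr_fun this x
    have ht : ∀ x, coord ω q (mulR ω b.unop x) = (1 ⊗ₜ b : Env K A) • coord ω q x := by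
      intro x
      have : coord ω q ∘ₗ mulR ω b.unop =
          (DistribSMul.toLinearMap K (Env K A ⊗[K] V) (1 ⊗ₜ b : Env K A)) ∘ₗ coord ω q :=
        hom_ext (by
          intro a' u b'
          simp [coord_pure, TensorProduct.smul_tmul'])
      exact LinearMap.congr_fun this x
    rw [eta_tmul, mul_assoc, src_eta_mul, hs, ← op_unop b, tgt_eta_mul, ht, smul_smul, op_unop,
      Algebra.TensorProduct.tmul_mul_tmul, mul_one, one_mul]

theorem coord_mid (u : UniversalEnvelopingAlgebra K L) : coord ω q (mid ω u) = 1 ⊗ₜ q u := rfl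

end Coordinates

end CM
end
end ConnesMoscovici

namespace ConnesMoscovici

noncomputable section

open UniversalEnvelopingAlgebra (ι)

/-! ### Projectivity by base change, and a retraction of `U(L)` onto `L`. -/

section BaseChange

variable {K R M V U : Type*} [Field K] [Ring R] [Algebra K R] [AddCommGroup M] [Module R M]
  [Module K M] [IsScalarTower K R M] [AddCommGroup V] [Module K V] [AddCommGroup U] [Module K U]

variable (R) in
/-- The `R`-linear map `R ⊗ V → M` extending a `K`-linear map `V → M`. -/
def extendScalars (l : V →ₗ[K] M) : R ⊗[K] V →ₗ[R] M :=
  TensorProduct.AlgebraTensorModule.lift (LinearMap.toSpanSingleton R (V →ₗ[K] M) l)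

theorem extendScalars_tmul (l : V →ₗ[K] M) (r : R) (x : V) :
    extendScalars R l (r ⊗ₜ x) = r • l x := rfl

/-- Subquotients of a module with coordinates in `R ⊗ U` which are spanned by subspaces of `U` are
projective. -/
theorem projective_span_quotient (m : U →ₗ[K] M) (Θ : M →ₗ[R] R ⊗[K] U)
    (hΘ : ∀ u, Θ (m u) = 1 ⊗ₜ u) {W' W : Submodule K U} (hW : W' ≤ W) {N' N : Submodule R M}
    (hN' : N' = Submodule.span R (m '' W')) (hN : N = Submodule.span R (m '' W)) :
    Module.Projective R (N ⧸ N'.comap N.subtype) := by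
  -- Over the field the quotient `W / W'` has a linear section `σ`, and its projection extends to a
  -- map `q` on all of `U`. After base change they give maps between `N / N'` and the free module `R
  -- ⊗ (W / W')`.
  obtain ⟨σ, hσ⟩ := (W'.comap W.subtype).mkQ.exists_rightInverse_of_surjective
    (Submodule.range_mkQ _)
  obtain ⟨q, hq⟩ := (W'.comap W.subtype).mkQ.exists_extend
  have hq' : ∀ w : W, q w = (W'.comap W.subtype).mkQ w := LinearMap.congr_fun hq
  have hm : ∀ w : W, m w ∈ N := fun w => hN ▸ Submodule.subset_span ⟨w, w.2, rfl⟩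
  let mN : W →ₗ[K] N := LinearMap.codRestrict (N.restrictScalars K) (m ∘ₗ W.subtype) hm
  let b := Algebra.TensorProduct.basis R (Module.Basis.ofVectorSpace K (W ⧸ W'.comap W.subtype))
  have hfree : Module.Projective R (R ⊗[K] (W ⧸ W'.comap W.subtype)) := .of_basis b
  let f : N →ₗ[R] R ⊗[K] (W ⧸ W'.comap W.subtype) := q.baseChange R ∘ₗ Θ ∘ₗ N.subtype
  have hf : ∀ w : W, f (mN w) = 1 ⊗ₜ (W'.comap W.subtype).mkQ w := by
    intro w
    change q.baseChange R (Θ (m w)) = _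
    rw [hΘ, LinearMap.baseChange_tmul, hq']
  have hker : N'.comap N.subtype ≤ LinearMap.ker f := by
    have : N' ≤ LinearMap.ker (q.baseChange R ∘ₗ Θ) := by
      rw [hN', Submodule.span_le]
      rintro _ ⟨w, hw, rfl⟩
      change q.baseChange R (Θ (m w)) = 0
      have h0 : (W'.comap W.subtype).mkQ ⟨w, hW hw⟩ = 0 := (Submodule.Quotient.mk_eq_zero _).2 hw
      rw [hΘ, LinearMap.baseChange_tmul, hq' ⟨w, hW hw⟩, h0, TensorProduct.tmul_zero]
    exact fun x hx => this hx
  let F := (N'.comap N.subtype).liftQ f hker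
  let G : R ⊗[K] (W ⧸ W'.comap W.subtype) →ₗ[R] N ⧸ N'.comap N.subtype :=
    extendScalars R ((N'.comap N.subtype).mkQ.restrictScalars K ∘ₗ mN ∘ₗ σ)
  have hGF : ∀ w : W, G (f (mN w)) = (N'.comap N.subtype).mkQ (mN w) := by
    intro w
    rw [hf, extendScalars_tmul, one_smul]
    change (N'.comap N.subtype).mkQ (mN (σ ((W'.comap W.subtype).mkQ w))) = _
    rw [← sub_eq_zero, ← map_sub, ← map_sub, Submodule.mkQ_apply, Submodule.Quotient.mk_eq_zero]
    change m (σ ((W'.comap W.subtype).mkQ w) - w : W) ∈ N'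
    rw [hN']
    refine Submodule.subset_span ⟨_, ?_, rfl⟩
    change σ ((W'.comap W.subtype).mkQ w) - w ∈ W'.comap W.subtype
    rw [← Submodule.Quotient.mk_eq_zero, ← Submodule.mkQ_apply, map_sub, sub_eq_zero]
    exact LinearMap.congr_fun hσ _
  -- The composite through the free module is the identity, as is seen on the generators `m(w)`; so
  -- the quotient is a direct summand.
  refine Module.Projective.of_split F G (Submodule.linearMap_qext _ (LinearMap.ext fun x => ?_))
  change G (f x) = (N'.comap N.subtype).mkQ x
  obtain ⟨x, hx⟩ := x
  have key : ∀ y ∈ Submodule.span R (m '' W), ∀ hy : y ∈ N,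
      G (f ⟨y, hy⟩) = (N'.comap N.subtype).mkQ ⟨y, hy⟩ := by
    intro y hy
    induction hy using Submodule.span_induction with
    | mem y h =>
      obtain ⟨w, hw, rfl⟩ := h
      exact fun _ => hGF ⟨w, hw⟩
    | zero =>
      intro h
      exact (congrArg (fun z => G (f z)) (Subtype.ext rfl : (⟨0, h⟩ : N) = 0)).trans (by
        rw [map_zero, map_zero]
        exact (map_zero _).symm)
    | add y z hy' hz' hy hz =>
      intro h
      rw [← hN] at hy' hz'
      have e : (⟨y + z, h⟩ : N) = ⟨y, hy'⟩ + ⟨z, hz'⟩ := rfl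
      rw [e, map_add, map_add, map_add, hy, hz]
    | smul r y hy' hy =>
      intro h
      rw [← hN] at hy'
      have e : (⟨r • y, h⟩ : N) = r • ⟨y, hy'⟩ := rfl
      rw [e, map_smul, map_smul, map_smul, hy]
  exact key x (hN ▸ hx) hx

end BaseChange

/-- Injectivity of `ι` provides a linear retraction `p`; subtracting `ε(·) p(1)` kills `1` without
changing the values on `L`. The condition at `1` separates `Aᵉ · L` from `η(Aᵉ)`. -/
theorem exists_leftInverse_ι (K : Type uK) (L : Type uL) [Field K] [CharZero K] [LieRing L]
    [LieAlgebra K L] :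
    ∃ q : UniversalEnvelopingAlgebra K L →ₗ[K] L, (∀ X, q (ι K X) = X) ∧ q 1 = 0 := by
  obtain ⟨p, hp⟩ := LinearMap.exists_leftInverse_of_injective (ι K (L := L)).toLinearMap
    (LinearMap.ker_eq_bot.2 ι_injective)
  have hp' : ∀ X, p (ι K X) = X := LinearMap.congr_fun hp
  refine ⟨p - (counitU K L).toLinearMap.smulRight (p 1), fun X => ?_, ?_⟩
  · rw [LinearMap.sub_apply, LinearMap.smulRight_apply, AlgHom.toLinearMap_apply, counitU_ι, zero_smul,
      sub_zero, hp']
  · simp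

/-! ### Transport of primitive elements, and the semi-direct product. -/

namespace LeftBialgebroid

section General

variable {K : Type uK} {A : Type uA} {B : Type uB} {C : Type uC}
  [Field K] [Ring A] [Algebra K A] [Ring B] [Algebra K B] [Ring C] [Algebra K C]
  {ℬ : LeftBialgebroid K A B} {𝒞 : LeftBialgebroid K A C}

instance : Module K ℬ.AsModule := inferInstanceAs (Module K B)

instance : IsScalarTower K (Env K A) ℬ.AsModule where
  smul_assoc c z x := by
    change ℬ.η (c • z) * ℬ.toB x = c • (ℬ.η z * ℬ.toB x)
    rw [map_smul, smul_mul_assoc]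

theorem Hom.map_mem_prim (f : Hom ℬ 𝒞) {X : B} (hX : X ∈ ℬ.prim) : f.toAlgHom X ∈ 𝒞.prim := by
  rw [mem_prim, ← f.map_comul, ℬ.mem_prim.1 hX, map_add, tensMap_tens, tensMap_tens, map_one]

/-- The map induced on primitive elements by a morphism of bialgebroids. -/
def Hom.primMap (f : Hom ℬ 𝒞) : ℬ.prim →ₗ⁅K⁆ 𝒞.prim where
  toFun X := ⟨f.toAlgHom X, f.map_mem_prim X.2⟩
  map_add' X Y := Subtype.ext (map_add f.toAlgHom (X : B) Y)
  map_smul' c X := Subtype.ext (map_smul f.toAlgHom c (X : B))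
  map_lie' := by
    intro X Y
    refine Subtype.ext ?_
    change f.toAlgHom ((X : B) * Y - Y * X) = _
    rw [map_sub, map_mul, map_mul]
    rfl

theorem Hom.anchor_primMap (f : Hom ℬ 𝒞) (X : ℬ.prim) : 𝒞.anchor (f.primMap X) = ℬ.anchor X := by
  refine Subtype.ext (LinearMap.ext fun a => ?_)
  rw [anchor_apply, anchor_apply, ← f.map_src]
  change 𝒞.counit (f.toAlgHom X * f.toAlgHom (src ℬ.η a)) = _
  rw [← map_mul, f.map_counit]

/-- The same derivation `ω(X)` governs commutation with source and target, so the bracket is `s(c) -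
t(c)` with `c = ω(X)(a)`. -/
theorem lie_mem_stSub (X : ℬ.prim) {Y : ℬ.prim} (hY : Y ∈ ℬ.stSub) : ⁅X, Y⁆ ∈ ℬ.stSub := by
  obtain ⟨a, ha⟩ := hY
  refine ⟨ℬ.counit ((X : B) * src ℬ.η a), ?_⟩
  rw [LieSubalgebra.coe_bracket, ha, LieRing.of_associative_ring_bracket, mul_sub, sub_mul,
    ℬ.prim_mul_tgt X.2]
  have h := ℬ.prim_mul_src X.2 a
  generalize ℬ.counit ((X : B) * src ℬ.η a) = c at h ⊢
  rw [h]
  abel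

variable (L : LieSubalgebra K ℬ.prim)

/-- The action of a subalgebra of `Prim(B)` on `⟨s - t⟩` by commutators. -/
def stAction : L →ₗ⁅K⁆ LieDerivation K ℬ.stSub ℬ.stSub where
  toFun X :=
    { toFun := fun Y => ⟨⁅(X : ℬ.prim), (Y : ℬ.prim)⁆, lie_mem_stSub _ Y.2⟩
      map_add' := fun Y Z => Subtype.ext (lie_add _ _ _)
      map_smul' := fun c Y => Subtype.ext (lie_smul _ _ _)
      leibniz' := fun Y Z => Subtype.ext (by
        change ⁅(X : ℬ.prim), ⁅(Y : ℬ.prim), (Z : ℬ.prim)⁆⁆ =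
          ⁅(Y : ℬ.prim), ⁅(X : ℬ.prim), (Z : ℬ.prim)⁆⁆ - ⁅(Z : ℬ.prim), ⁅(X : ℬ.prim), (Y : ℬ.prim)⁆⁆
        rw [leibniz_lie, ← lie_skew (Z : ℬ.prim)]
        abel) }
  map_add' X Y := LieDerivation.ext fun Z => Subtype.ext (add_lie _ _ _)
  map_smul' c X := LieDerivation.ext fun Z => Subtype.ext (smul_lie _ _ _)
  map_lie' {X Y} := LieDerivation.ext fun Z => Subtype.ext (by
    rw [LieDerivation.commutator_apply]
    exact lie_lie (X : ℬ.prim) (Y : ℬ.prim) (Z : ℬ.prim))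

variable {L}

/-- A subalgebra complementary to `⟨s - t⟩` makes `Prim(B)` a semi-direct product. -/
theorem exists_semidirect
    (hL : ∀ X : ℬ.prim, ∃ (Y : L) (a : A), (X : B) = (Y : ℬ.prim) + (src ℬ.η a - tgt ℬ.η (op a)))
    (hd : ∀ X ∈ L, X ∈ ℬ.stSub → X = 0) :
    ∃ (δ : L →ₗ⁅K⁆ LieDerivation K ℬ.stSub ℬ.stSub)
      (hδ : AnchorCompatible (ℬ.anchor.comp ℬ.stSub.incl) (ℬ.anchor.comp L.incl) δ)
      (e : LieAlgebra.SemiDirectSum ℬ.stSub L δ ≃ₗ⁅K⁆ ℬ.prim),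
      (∀ z, ℬ.anchor (e z) = semidirectAnchor _ _ δ hδ z) ∧
        ∀ z, e z = (z.right : ℬ.prim) + (z.left : ℬ.prim) := by
  let f : LieAlgebra.SemiDirectSum ℬ.stSub L (stAction L) →ₗ⁅K⁆ ℬ.prim :=
    { toFun := fun z => (z.right : ℬ.prim) + (z.left : ℬ.prim)
      map_add' := fun x y => add_add_add_comm _ _ _ _
      map_smul' := fun c x => (smul_add c _ _).symm
      map_lie' := by
        intro x y
        change ⁅(x.right : ℬ.prim), (y.right : ℬ.prim)⁆ + (⁅(x.left : ℬ.prim), (y.left : ℬ.prim)⁆ +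
          ⁅(x.right : ℬ.prim), (y.left : ℬ.prim)⁆ - ⁅(y.right : ℬ.prim), (x.left : ℬ.prim)⁆) =
          ⁅(x.right : ℬ.prim) + (x.left : ℬ.prim), (y.right : ℬ.prim) + (y.left : ℬ.prim)⁆
        rw [add_lie, lie_add, lie_add, ← lie_skew (x.left : ℬ.prim) (y.right : ℬ.prim)]
        abel }
  have hf : Function.Bijective f := by
    refine ⟨(injective_iff_map_eq_zero f).2 fun z hz => ?_, fun X => ?_⟩
    · have hz' : (z.right : ℬ.prim) = -(z.left : ℬ.prim) := eq_neg_of_add_eq_zero_left hz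
      have hr : (z.right : ℬ.prim) = 0 := hd _ z.right.2 (hz' ▸ neg_mem z.left.2)
      have hl : (z.left : ℬ.prim) = 0 := by rw [← neg_eq_zero, ← hz', hr]
      exact LieAlgebra.SemiDirectSum.ext (Subtype.ext hl) (Subtype.ext hr)
    · obtain ⟨Y, a, h⟩ := hL X
      exact ⟨⟨⟨⟨_, ℬ.src_sub_tgt_mem_prim a⟩, a, rfl⟩, Y⟩, Subtype.ext h.symm⟩
  refine ⟨stAction L, fun X Y => (LieHom.map_lie ℬ.anchor _ _).symm, LieEquiv.ofBijective f hf,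
    fun z => map_add ℬ.anchor _ _, fun z => rfl⟩

end General

end LeftBialgebroid
end
end ConnesMoscovici

namespace ConnesMoscovici

noncomputable section

open UniversalEnvelopingAlgebra (ι)

namespace LeftBialgebroid

/-! ### From the isomorphism to the conditions. -/

section Forward

variable {K : Type uK} {A : Type uA} {B : Type uB} {L : Type uL} [Field K] [Ring A] [Algebra K A]
  [Ring B] [Algebra K B] [LieRing L] [LieAlgebra K L] {ω : L →ₗ⁅K⁆ Der K A}
  {ℬ : LeftBialgebroid K A B} (g : Hom ℬ (connesMoscovici ω)) (Φ : Hom (connesMoscovici ω) ℬ)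

/-- The coordinate map `B → Aᵉ ⊗ V` obtained from `B → A ⊙ U(L) ⊙ A` and `q : U(L) → V`. -/
def coordMap {V : Type*} [AddCommGroup V] [Module K V] (q : UniversalEnvelopingAlgebra K L →ₗ[K] V) :
    ℬ.AsModule →ₗ[Env K A] Env K A ⊗[K] V where
  toFun x := CM.coord ω q (g.toAlgHom (ℬ.toB x))
  map_add' x y := by
    change CM.coord ω q (g.toAlgHom (ℬ.toB x + ℬ.toB y)) = _
    rw [map_add, map_add]
  map_smul' z x := by
    rw [toB_smul, map_mul, g.map_eta]
    exact CM.coord_eta_mul ω q z _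

/-- The map `U(L) → B`. -/
def midMap : UniversalEnvelopingAlgebra K L →ₗ[K] ℬ.AsModule where
  toFun u := ℬ.ofB (Φ.toAlgHom (CM.mid ω u))
  map_add' u v := by rw [map_add, map_add, ofB_add]
  map_smul' c u := by
    rw [map_smul, map_smul]
    rfl

theorem coordMap_midMap {g : Hom ℬ (connesMoscovici ω)} {Φ : Hom (connesMoscovici ω) ℬ}
    (h : ∀ y, g.toAlgHom (Φ.toAlgHom y) = y) {V : Type*} [AddCommGroup V] [Module K V]
    (q : UniversalEnvelopingAlgebra K L →ₗ[K] V) (u : UniversalEnvelopingAlgebra K L) :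
    coordMap g q (midMap Φ u) = 1 ⊗ₜ q u := by
  change CM.coord ω q (g.toAlgHom (Φ.toAlgHom (CM.mid ω u))) = _
  rw [h, CM.coord_mid]

theorem coordMap_eta {V : Type*} [AddCommGroup V] [Module K V]
    (q : UniversalEnvelopingAlgebra K L →ₗ[K] V) (z : Env K A) :
    coordMap g q (ℬ.ofB (ℬ.η z)) = z ⊗ₜ q 1 := by
  change CM.coord ω q (g.toAlgHom (ℬ.η z)) = _
  rw [g.map_eta]
  have := CM.coord_eta_mul ω q z (CM.mid ω 1)
  rw [CM.coord_mid, map_one, mul_one] at this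
  refine this.trans ?_
  rw [TensorProduct.smul_tmul', smul_eq_mul, mul_one]

/-- The map `L → Prim(B)`. -/
def primOfHom : L →ₗ⁅K⁆ ℬ.prim :=
  Φ.primMap.comp (CM.prim ω)

theorem coe_primOfHom (X : L) : (primOfHom Φ X : B) = Φ.toAlgHom (CM.mid ω (ι K X)) := rfl

theorem ofB_primOfHom (X : L) : ℬ.ofB (primOfHom Φ X : B) = midMap Φ (ι K X) := rfl

theorem anchor_primOfHom (X : L) : ℬ.anchor (primOfHom Φ X) = ω X := by
  refine (Φ.anchor_primMap _).trans (Subtype.ext (LinearMap.ext fun a => ?_))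
  exact CM.counit_mid_ι_mul_src ω X a

variable {Φ}

/-- The coordinate map of a retraction `q` with `q(1) = 0` kills `Aᵉ · ⟨s - t⟩`, and it has a left
inverse on `Aᵉ · L`. -/
theorem range_primOfHom_disjoint [CharZero K] (h : ∀ y, g.toAlgHom (Φ.toAlgHom y) = y) :
    ℬ.envSpan ℬ.stSub ⊓ ℬ.envSpan (primOfHom Φ).range = ⊥ := by
  obtain ⟨q, hq, hq1⟩ := exists_leftInverse_ι K L
  rw [eq_bot_iff]
  rintro x ⟨hx1, hx2⟩
  let F := coordMap g q
  let G := extendScalars (Env K A) (midMap Φ ∘ₗ (ι K (L := L)).toLinearMap)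
  have h1 : ℬ.envSpan ℬ.stSub ≤ LinearMap.ker F := by
    rw [envSpan, Submodule.span_le]
    rintro y ⟨X, ⟨a, ha⟩, hy⟩
    have h2 : y = ℬ.ofB (ℬ.η (a ⊗ₜ 1 - 1 ⊗ₜ op a)) := by
      refine (hy.trans ha).trans ?_
      rw [map_sub, eta_tmul, eta_tmul, map_one, map_one, mul_one, one_mul]
      rfl
    change coordMap g q y = 0
    rw [h2, coordMap_eta, hq1, TensorProduct.tmul_zero]
  have h2 : ℬ.envSpan (primOfHom Φ).range ≤ LinearMap.eqLocus (G ∘ₗ F) LinearMap.id := by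
    rw [envSpan, Submodule.span_le]
    rintro y ⟨_, ⟨X, rfl⟩, hy⟩
    have hy' : y = midMap Φ (ι K X) := hy
    change G (coordMap g q y) = y
    rw [hy', coordMap_midMap h, hq, extendScalars_tmul, one_smul]
    rfl
  have h3 : G (F x) = x := h2 hx2
  rw [Submodule.mem_bot, ← h3, LinearMap.mem_ker.1 (h1 hx1), map_zero]

-- The coordinate map of the counit of `U(L)` sends `η(z)` to `z ⊗ 1`, from which `z` is recovered.
include g in
theorem injective_eta_of_hom : Function.Injective ℬ.η := by
  rw [injective_iff_map_eq_zero]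
  intro z hz
  have h1 := coordMap_eta g (counitU K L).toLinearMap z
  have h2 : ℬ.ofB (ℬ.η z) = 0 := hz
  rw [h2, map_zero, AlgHom.toLinearMap_apply, map_one] at h1
  have h3 := congrArg (TensorProduct.rid K (Env K A)) h1
  rw [map_zero, TensorProduct.rid_tmul, one_smul] at h3
  exact h3.symm

/-- The coordinate map carries a `K`-basis of `L` to the standard basis of the free module `Aᵉ ⊗ L`,
so that basis is independent over `Aᵉ`. -/
theorem exists_basis_envSpan [CharZero K] (h : ∀ y, g.toAlgHom (Φ.toAlgHom y) = y)
    (hinj : Function.Injective (primOfHom Φ)) :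
    ∃ (I : Type uB) (b : Module.Basis I K (primOfHom Φ).range)
      (c : Module.Basis I (Env K A) (ℬ.envSpan (primOfHom Φ).range)),
      ∀ i, ℬ.toB (c i : ℬ.AsModule) = ((b i : ℬ.prim) : B) := by
  obtain ⟨q, hq, -⟩ := exists_leftInverse_ι K L
  let b := Module.Basis.ofVectorSpace K (primOfHom Φ).range
  let e : L ≃ₗ[K] (primOfHom Φ).range := LinearEquiv.ofInjective (primOfHom Φ).toLinearMap hinj
  let v : _ → ℬ.AsModule := fun i => ℬ.ofB ((b i : ℬ.prim) : B)
  have hv : ∀ i, v i = midMap Φ (ι K ((b.map e.symm) i)) := by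
    intro i
    rw [← ofB_primOfHom, Module.Basis.map_apply]
    exact congrArg (fun X : (primOfHom Φ).range => ℬ.ofB ((X : ℬ.prim) : B))
      (e.apply_symm_apply (b i)).symm
  have hli : LinearIndependent (Env K A) v := by
    refine LinearIndependent.of_comp (coordMap g q) ?_
    have : coordMap g q ∘ v = Algebra.TensorProduct.basis (Env K A) (b.map e.symm) := by
      funext i
      rw [Function.comp_apply, hv, coordMap_midMap h, hq, Algebra.TensorProduct.basis_apply]
    rw [this]
    exact (Algebra.TensorProduct.basis (Env K A) (b.map e.symm)).linearIndependent
  have hspan : Submodule.span (Env K A) (Set.range v) = ℬ.envSpan (primOfHom Φ).range := by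
    apply le_antisymm
    · rw [Submodule.span_le]
      rintro _ ⟨i, rfl⟩
      exact ℬ.ofB_mem_envSpan (b i).2
    · rw [envSpan, Submodule.span_le]
      rintro x ⟨X, hX, hx⟩
      have key : ∀ Y : (primOfHom Φ).range,
          ℬ.ofB ((Y : ℬ.prim) : B) ∈ Submodule.span (Env K A) (Set.range v) := by
        intro Y
        have hY := b.mem_span Y
        induction hY using Submodule.span_induction with
        | mem Y hY =>
          obtain ⟨i, rfl⟩ := hY
          exact Submodule.subset_span ⟨i, rfl⟩
        | zero => exact zero_mem _
        | add Y Z _ _ hY hZ => exact add_mem hY hZ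
        | smul c Y _ hY =>
          have := Submodule.smul_mem _ (algebraMap K (Env K A) c) hY
          rw [← ofB_smul] at this
          exact this
      have := key ⟨X, hX⟩
      rwa [show x = ℬ.ofB (X : B) from hx]
  refine ⟨_, b, (Module.Basis.span hli).map (LinearEquiv.ofEq _ _ hspan), fun i => ?_⟩
  rw [Module.Basis.map_apply]
  exact congrArg Subtype.val (Module.Basis.span_apply hli i)

/-- The `n`-th filtration term is `Aᵉ` times the span of powers of degree at most `n` in `U(L)`, so
`projective_span_quotient` applies with the full coordinates in `Aᵉ ⊗ U(L)`. -/
theorem gradedProjective_of_hom [CharZero K] (h : ∀ y, g.toAlgHom (Φ.toAlgHom y) = y)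
    (hj : ∀ X : ℬ.prim, ∃ (Y : L) (a : A),
      (X : B) = primOfHom Φ Y + (src ℬ.η a - tgt ℬ.η (op a))) : ℬ.GradedProjective := by
  have hF : ∀ n, ℬ.primFilt n = Submodule.span (Env K A) (midMap Φ '' powSpan (ιRange K L) n) := by
    intro n
    apply le_antisymm
    · intro x hx
      rw [mem_primFilt_iff _ hj] at hx
      have : ℬ.powFilt (primOfHom Φ) n ≤ (Submodule.restrictScalars K (Submodule.span (Env K A)
          (midMap Φ '' powSpan (ιRange K L) n)) : Submodule K ℬ.AsModule) := by
        rw [powFilt]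
        refine Submodule.span_le.2 ?_
        rintro _ ⟨z, X, m, hm, rfl⟩
        change z • ℬ.ofB ((primOfHom Φ X : B) ^ m) ∈ Submodule.span _ _
        refine Submodule.smul_mem _ _ (Submodule.subset_span
          ⟨ι K X ^ m, pow_mem_powSpan (ι_mem_ιRange X) hm, ?_⟩)
        rw [coe_primOfHom, ← map_pow Φ.toAlgHom, ← map_pow (CM.mid ω)]
        rfl
      exact this hx
    · rw [Submodule.span_le]
      rintro _ ⟨u, hu, rfl⟩
      change midMap Φ u ∈ ℬ.primFilt n
      rw [mem_primFilt_iff _ hj]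
      have : powSpan (ιRange K L) n ≤ (ℬ.powFilt (primOfHom Φ) n).comap
          (Φ.toAlgHom.comp (CM.mid ω)).toLinearMap := by
        rw [powSpan, Submodule.span_le]
        rintro _ ⟨_, ⟨X, rfl⟩, m, hm, rfl⟩
        have := eta_mul_pow_mem (ℬ := ℬ) (primOfHom Φ) 1 X hm
        rw [map_one, one_mul, coe_primOfHom, ← map_pow, ← map_pow] at this
        exact this
      exact this hu
  have hΘ := coordMap_midMap h (LinearMap.id : UniversalEnvelopingAlgebra K L →ₗ[K] _)
  intro n
  cases n with
  | zero =>
    -- In degree `0` the smaller subspace is zero, matching `F_{-1} = 0`.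
    refine projective_span_quotient (midMap Φ) _ hΘ (bot_le : ⊥ ≤ powSpan (ιRange K L) 0) ?_ (hF 0)
    rw [Submodule.bot_coe, Set.image_singleton, map_zero, Submodule.span_zero_singleton]
    rfl
  | succ n =>
    exact projective_span_quotient (midMap Φ) _ hΘ (powSpan_mono _ n.le_succ) (hF n) (hF (n + 1))

theorem primitivelyGenerated_of_hom [CharZero K] (h : ∀ x, Φ.toAlgHom (g.toAlgHom x) = x)
    (hj : ∀ X : ℬ.prim, ∃ (Y : L) (a : A),
      (X : B) = primOfHom Φ Y + (src ℬ.η a - tgt ℬ.η (op a))) : ℬ.PrimitivelyGenerated := by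
  intro x
  obtain ⟨n, hn⟩ := CM.exists_mem_powFilt ω (g.toAlgHom (ℬ.toB x))
  refine ⟨n, (mem_primFilt_iff _ hj).2 ?_⟩
  have : (connesMoscovici ω).powFilt (CM.prim ω) n ≤
      (ℬ.powFilt (primOfHom Φ) n).comap Φ.toAlgHom.toLinearMap := by
    rw [powFilt, Submodule.span_le]
    rintro _ ⟨z, X, m, hm, rfl⟩
    change Φ.toAlgHom ((connesMoscovici ω).η z * (CM.prim ω X : CM ω) ^ m) ∈ ℬ.powFilt (primOfHom Φ) n
    rw [map_mul, map_pow, Φ.map_eta]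
    exact eta_mul_pow_mem _ z X hm
  have h2 := this hn
  change Φ.toAlgHom (g.toAlgHom (ℬ.toB x)) ∈ ℬ.powFilt (primOfHom Φ) n at h2
  rwa [h] at h2

/-- A bialgebroid isomorphic to `A ⊙ U(L) ⊙ A` satisfies the conditions. -/
theorem Isomorphic.exists_milnorMoore [CharZero K] [Nontrivial A]
    (h : ℬ.Isomorphic (connesMoscovici ω)) :
    ∃ j : L →ₗ⁅K⁆ ℬ.prim, Function.Injective j ∧ (∀ X, ℬ.anchor (j X) = ω X) ∧
      ℬ.MilnorMoore j.range := by
  obtain ⟨g, Φ, hΦg, hgΦ⟩ := h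
  -- Since `A ≠ 0`, the scalars embed in `A` and a linear `φ` with `φ(1) = 1` exists.
  obtain ⟨φ, hφ⟩ := LinearMap.exists_leftInverse_of_injective (Algebra.linearMap K A)
    (LinearMap.ker_eq_bot.2 (algebraMap K A).injective)
  have hφ1 : φ 1 = 1 := by
    have := LinearMap.congr_fun hφ 1
    rwa [LinearMap.comp_apply, Algebra.linearMap_apply, map_one] at this
  have hinj : Function.Injective (primOfHom Φ) := by
    intro X Y hXY
    have h1 : Φ.toAlgHom (CM.mid ω (ι K X)) = Φ.toAlgHom (CM.mid ω (ι K Y)) :=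
      congrArg Subtype.val hXY
    have h2 := congrArg g.toAlgHom h1
    rw [hgΦ, hgΦ] at h2
    exact ι_injective (CM.mid_injective ω φ hφ1 h2)
  have hj : ∀ X : ℬ.prim, ∃ (Y : L) (a : A),
      (X : B) = primOfHom Φ Y + (src ℬ.η a - tgt ℬ.η (op a)) := by
    intro X
    obtain ⟨Y, a, hX⟩ := CM.exists_eq_add_of_mem_prim ω hφ1 (g.map_mem_prim X.2)
    refine ⟨Y, a, ?_⟩
    rw [← hΦg (X : B), hX, map_add, map_sub]
    exact congrArg₂ (fun x y => _ + (x - y)) (Φ.map_src a) (Φ.map_tgt a)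
  have hdisj := range_primOfHom_disjoint g hgΦ
  refine ⟨primOfHom Φ, hinj, anchor_primOfHom Φ, ?_, ?_, ?_, hdisj⟩
  · refine exists_semidirect (fun X => ?_) fun X hX hX' => ?_
    · obtain ⟨Y, a, hX⟩ := hj X
      exact ⟨⟨_, Y, rfl⟩, a, hX⟩
    · have h1 : ℬ.ofB X ∈ ℬ.envSpan ℬ.stSub ⊓ ℬ.envSpan (primOfHom Φ).range :=
        ⟨ℬ.ofB_mem_envSpan hX', ℬ.ofB_mem_envSpan hX⟩
      rw [hdisj] at h1
      exact Subtype.ext h1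
  · exact ⟨gradedProjective_of_hom g hgΦ hj, primitivelyGenerated_of_hom g hΦg hj⟩
  · by_cases hb : ℬ.envSpan (primOfHom Φ).range = ⊥
    · exact Or.inl ⟨hb, injective_eta_of_hom g⟩
    · exact Or.inr ⟨hb, exists_basis_envSpan g hgΦ hinj⟩

end Forward

end LeftBialgebroid
end
end ConnesMoscovici

namespace ConnesMoscovici

noncomputable section

/-! ### The zero base algebra, and the conclusion. -/

namespace LeftBialgebroid

variable {K : Type uK} {A : Type uA} {B : Type uB} [Field K] [Ring A] [Algebra K A]
  [Ring B] [Algebra K B] {ℬ : LeftBialgebroid K A B}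

theorem subsingleton_of_base (ℬ : LeftBialgebroid K A B) [Subsingleton A] : Subsingleton B := by
  refine subsingleton_of_zero_eq_one ?_
  rw [← map_one (src ℬ.η), Subsingleton.elim (1 : A) 0, map_zero]

/-- Over `A = 0` the conditions hold trivially. -/
theorem milnorMoore_of_subsingleton [Subsingleton A] (L : LieSubalgebra K ℬ.prim) :
    ℬ.MilnorMoore L := by
  have hB := ℬ.subsingleton_of_base
  have hM : Subsingleton ℬ.AsModule := hB
  have hbot : ∀ N : Submodule (Env K A) ℬ.AsModule, N = ⊥ := fun N => Subsingleton.elim _ _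
  have hE : Subsingleton (Env K A) := by
    refine subsingleton_of_zero_eq_one ?_
    rw [Algebra.TensorProduct.one_def, Subsingleton.elim (1 : A) 0, TensorProduct.zero_tmul]
  refine ⟨exists_semidirect (fun X => ⟨0, 0, Subsingleton.elim _ _⟩)
    fun X _ _ => Subsingleton.elim _ _, ⟨fun n => inferInstance, fun x => ⟨0, ?_⟩⟩,
    Or.inl ⟨hbot _, Function.injective_of_subsingleton _⟩, hbot _⟩
  rw [Subsingleton.elim x 0]
  exact zero_mem _

theorem MilnorMoore.envSpan_univ {L : LieSubalgebra K ℬ.prim} (h : ℬ.MilnorMoore L) :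
    ℬ.envSpan Set.univ = ℬ.envSpan L ⊔ ℬ.envSpan ℬ.stSub := by
  apply le_antisymm
  · rw [envSpan, Submodule.span_le]
    rintro x ⟨X, -, hx⟩
    obtain ⟨Y, a, hX⟩ := h.exists_add X
    have hst : (⟨_, ℬ.src_sub_tgt_mem_prim a⟩ : ℬ.prim) ∈ (ℬ.stSub : Set ℬ.prim) := ⟨a, rfl⟩
    have h2 := Submodule.add_mem_sup (ℬ.ofB_mem_envSpan Y.2) (ℬ.ofB_mem_envSpan hst)
    rw [← ofB_add] at h2
    rwa [show x = ℬ.ofB _ from hx.trans hX]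
  · exact sup_le (Submodule.span_mono fun x ⟨X, _, hx⟩ => ⟨X, trivial, hx⟩)
      (Submodule.span_mono fun x ⟨X, _, hx⟩ => ⟨X, trivial, hx⟩)

end LeftBialgebroid
end
end ConnesMoscovici

theorem mainTheorem4 {K : Type uK} [Field K] [CharZero K] {A : Type uA} [Ring A] [Algebra K A]
    {B : Type uB} [Ring B] [Algebra K B] (ℬ : LeftBialgebroid K A B) :
    -- `ℬ` is some `A ⊙ U(L) ⊙ A` if and only if the conditions hold for some `L ⊆ Prim(ℬ)`
    ((∃ (L : Type uB) (_ : LieRing L) (_ : LieAlgebra K L) (ω : L →ₗ⁅K⁆ Der K A),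
        ℬ.Isomorphic (connesMoscovici ω)) ↔
      ∃ L : LieSubalgebra K ℬ.prim, ℬ.MilnorMoore L) ∧
    -- for a given anchored Lie algebra `(L, ω)`: `ℬ` is `A ⊙ U(L) ⊙ A` if and only if `(L, ω)` is
    -- (isomorphic to) an anchored Lie subalgebra of `Prim(ℬ)` for which the conditions hold
    (Nontrivial A → ∀ (L : Type uL) [LieRing L] [LieAlgebra K L] (ω : L →ₗ⁅K⁆ Der K A),
      ℬ.Isomorphic (connesMoscovici ω) ↔
        ∃ j : L →ₗ⁅K⁆ ℬ.prim, Function.Injective j ∧ (∀ X, ℬ.anchor (j X) = ω X) ∧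
          ℬ.MilnorMoore j.range) ∧
    -- under the conditions, `Aᵉ · Prim(ℬ)` is the direct sum of `Aᵉ · L` and `Aᵉ · ⟨s - t⟩`
    (∀ L : LieSubalgebra K ℬ.prim, ℬ.MilnorMoore L →
      ℬ.envSpan Set.univ = ℬ.envSpan L ⊔ ℬ.envSpan ℬ.stSub ∧
        Disjoint (ℬ.envSpan L) (ℬ.envSpan ℬ.stSub)) := by
  refine ⟨⟨?_, ?_⟩, fun _ L _ _ ω => ⟨fun h => h.exists_milnorMoore, ?_⟩, fun L h => ⟨?_, ?_⟩⟩
  · rintro ⟨L, _, _, ω, h⟩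
    -- For `A = 0` no normalised functional on `A` exists; but then `B = 0` and any subalgebra will
    -- do.
    rcases subsingleton_or_nontrivial A with hA | hA
    · exact ⟨⊤, LeftBialgebroid.milnorMoore_of_subsingleton ⊤⟩
    · obtain ⟨j, -, -, h⟩ := h.exists_milnorMoore
      exact ⟨_, h⟩
  · rintro ⟨L, h⟩
    -- The required anchored Lie algebra is `L` itself with the restricted anchor.
    refine ⟨L, inferInstance, inferInstance, ℬ.anchor.comp L.incl,
      LeftBialgebroid.MilnorMoore.isomorphic (j := L.incl) Subtype.val_injective (fun _ => rfl) ?_⟩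
    rwa [LieSubalgebra.incl_range]
  · rintro ⟨j, hinj, hj, h⟩
    exact h.isomorphic hinj hj
  · exact h.envSpan_univ
  · rw [disjoint_iff, inf_comm]
    exact h.cm4
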